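/- **Setting.** A tabular episodic MDP has finite sets of $S$ states and $A$ actions, $H$ steps per episode, transition distributions $\mathbb P_h(\cdot\mid s,a)$ and deterministic rewards $r_h(s,a)\in[0,1]$ $(1\le h\le H)$. For a policy $\pi$ (a distribution over actions for every step and state), $V_h^\pi(s)$ is the expected total reward from step $h$ on, starting at $s$; $V_{H+1}^\pi=0$. Put $V_h^\star=\sup_\pi V_h^\pi$ (supremum over all policies), $Q_h^\star(s,a)=r_h(s,a)+\mathbb E_{s'\sim\mathbb P_h(\cdot\mid s,a)}V_{h+1}^\star(s')$, $\Delta_h(s,a)=V_h^\star(s)-Q_h^\star(s,a)$, $\Delta_{\min}=\inf\{\Delta_h(s,a):\Delta_h(s,a)>0\}$ and $\mathbb Q^\star=\max_{s,a,h}\mathrm{Var}_{s'\sim\mathbb P_h(\cdot\mid s,a)}(V_{h+1}^\star(s'))$. It is assumed that $\Delta_h(s,a)>0$ for at least one $(s,a,h)$. There are $K$ episodes, $T=KH\ge 2$. The initial state $s_1^k$ of each episode is chosen arbitrarily by an adversary, possibly at random and depending on the past. If $\pi^k$ is the policy used in episode $k$, then $\mathrm{Regret}(T)=\sum_{k=1}^K\bigl(V_1^\star(s_1^k)-V_1^{\pi^k}(s_1^k)\bigr)$.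 **Algorithm (UCB-Advantage).** Parameters: $\beta\in(0,H]$, $p\in(0,1)$, $c_0>0$; $\iota=\log(2/p)$, $N_0=\lceil c_0SAH^5\iota/\beta^2\rceil$. Let $e_1=H$, $e_{i+1}=\lfloor(1+\tfrac1H)e_i\rfloor$ and $\mathcal L=\{\sum_{i=1}^je_i:j\ge1\}$. Initially all accumulators are $0$, $Q_h(s,a)=V_h(s)=H-h+1$ and $V_h^{\rm ref}(s)=H$ for $h\le H$; always $V_{H+1}=V^{\rm ref}_{H+1}=0$. In each episode, after $s_1$ is observed, do the following for $h=1,\dots,H$. Take $a_h\in\arg\max_aQ_h(s_h,a)$ (ties broken arbitrarily, at the start of the episode and for all states) and observe $s_{h+1}\sim\mathbb P_h(\cdot\mid s_h,a_h)$. For the triple $(s_h,a_h,h)$ increase $n$ and $\check n$ by $1$, and with $v=V_{h+1}(s_{h+1})$, $w=V^{\rm ref}_{h+1}(s_{h+1})$ increase $\mu^{\rm ref}$ by $w$, $\sigma^{\rm ref}$ by $w^2$, $\check\mu$ by $v-w$, $\check v$ by $v$, and $\check\sigma$ by $(v-w)^2$. If then $n\in\mathcal L$, put $$b=2\sqrt{\tfrac{\sigma^{\rm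 ref}/n-(\mu^{\rm ref}/n)^2}{n}\,\iota}+2\sqrt{\tfrac{\check\sigma/\check n-(\check\mu/\check n)^2}{\check n}\,\iota}+5\Bigl(\tfrac{H\iota}{n}+\tfrac{H\iota}{\check n}+\tfrac{H\iota^{3/4}}{n^{3/4}}+\tfrac{H\iota^{3/4}}{\check n^{3/4}}\Bigr),\qquad \bar b=2\sqrt{\tfrac{H^2}{\check n}\,\iota},$$ replace $Q_h(s_h,a_h)$ by $\min\{r_h(s_h,a_h)+\check v/\check n+\bar b,\ r_h(s_h,a_h)+\mu^{\rm ref}/n+\check\mu/\check n+b,\ Q_h(s_h,a_h)\}$, then $V_h(s_h)$ by $\max_aQ_h(s_h,a)$, and reset $\check n,\check\mu,\check v,\check\sigma$ of this triple to $0$. Finally, if the number of visits to $(s_h,h)$ equals $N_0$, set $V^{\rm ref}_h(s_h)=V_h(s_h)$. The policy $\pi^k$ is the greedy one, $\pi^k_h(s)\in\arg\max_aQ_h(s,a)$, for the $Q$ at the start of episode $k$. **Theorem.** There is an absolute constant $c_{\min}>0$ such that for all constants $c\ge c_{\min}$ and $c_0>0$ there is a constant $C>0$, depending only on $c$ and $c_0$,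 such that for every MDP, $K$, adversary and tie-breaking as above and every $\beta\in(0,H]$, UCB-Advantage with $p=(SAT)^{-c}$ satisfies $$\mathbb E[\mathrm{Regret}(T)]\le C\left(\frac{(\mathbb Q^\star+\beta^2H)\,H^3SA\log(SAT)}{\Delta_{\min}}+\frac{H^8S^2A\log(SAT)\log T}{\beta^2}\right).$$ -/

import Mathlib

open MeasureTheory Finset

namespace UCBAdvantage

noncomputable section

/-! ### Tabular episodic Markov decision processes

Steps are indexed from `0`: step `h : Fin H` here is step `h + 1` of the `1`-based convention.
Value functions are indexed by `h : ℕ` and vanish for `h ≥ H`. -/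

/-- A tabular episodic MDP with finite state space `S`, finite action space `A`, `H` steps per
episode, inhomogeneous transition kernels and deterministic rewards in `[0, 1]`. -/
structure MDP (S A : Type*) [Fintype S] (H : ℕ) where
  /-- `P h s a` is the distribution of the next state. -/
  P : Fin H → S → A → stdSimplex ℝ S
  /-- `r h s a` is the reward. -/
  r : Fin H → S → A → ℝ
  r_nonneg : ∀ h s a, 0 ≤ r h s a
  r_le_one : ∀ h s a, r h s a ≤ 1

/-- A (possibly randomized) policy: a distribution over actions for every step and state. -/
abbrev Policy (S A : Type*) [Fintype A] (H : ℕ) := Fin H → S → stdSimplex ℝ A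

/-- A deterministic policy, viewed as a policy. -/
def detPolicy {S A : Type*} [Fintype A] [DecidableEq A] {H : ℕ} (p : Fin H → S → A) :
    Policy S A H :=
  fun h s => stdSimplex.vertex (p h s)

namespace MDP

variable {S A : Type*} [Fintype S] [Fintype A] {H : ℕ} (M : MDP S A H)

/-- The expectation of `f (s')` for `s'` drawn from `P h s a`. -/
def expect (h : Fin H) (s : S) (a : A) (f : S → ℝ) : ℝ :=
  ∑ s', M.P h s a s' * f s'

/-- The variance of `f (s')` for `s'` drawn from `P h s a`. -/
def cvar (h : Fin H) (s : S) (a : A) (f : S → ℝ) : ℝ :=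
  M.expect h s a (fun s' => f s' ^ 2) - (M.expect h s a f) ^ 2

/-- `M.V π h s` is the expected total reward collected by `π` from step `h` on, starting in `s`. -/
def V (π : Policy S A H) (h : ℕ) : S → ℝ :=
  if hh : h < H then fun s =>
    ∑ a, π ⟨h, hh⟩ s a * (M.r ⟨h, hh⟩ s a + M.expect ⟨h, hh⟩ s a (V π (h + 1)))
  else fun _ => 0
termination_by H - h

/-- The optimal value function: the supremum of the value functions of all policies. -/
def Vstar (h : ℕ) (s : S) : ℝ := ⨆ π : Policy S A H, M.V π h s

/-- The optimal action value function. -/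
def Qstar (h : Fin H) (s : S) (a : A) : ℝ :=
  M.r h s a + M.expect h s a (M.Vstar (h + 1))

/-- The suboptimality gap of `(s, a, h)`. -/
def gap (h : Fin H) (s : S) (a : A) : ℝ := M.Vstar h s - M.Qstar h s a

/-- The minimum gap: the infimum of the positive suboptimality gaps. -/
def gapMin : ℝ := sInf {x | ∃ h s a, x = M.gap h s a ∧ 0 < x}

/-- The maximum conditional variance of the optimal value function. -/
def maxVar : ℝ := ⨆ x : Fin H × S × A, M.cvar x.1 x.2.1 x.2.2 (M.Vstar (x.1 + 1))

end MDP

/-! ### The algorithm -/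

/-- The stage lengths: `e₁ = H` and `eᵢ₊₁ = ⌊(1 + 1/H) eᵢ⌋` (natural-number division is the
floor); the sequence is indexed from `0` here. -/
def stageLen (H : ℕ) : ℕ → ℕ
  | 0 => H
  | i + 1 => (H + 1) * stageLen H i / H

/-- The visit counts at which a stage ends: the sums of the first `j ≥ 1` stage lengths. -/
def stageEnds (H : ℕ) : Set ℕ := {n | ∃ j, 1 ≤ j ∧ n = ∑ i ∈ range j, stageLen H i}

/-- The variables of the algorithm. -/
structure AlgState (S A : Type*) (H : ℕ) where
  /-- number of all visits -/
  n : Fin H → S → A → ℕ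
  /-- number of visits in the current stage -/
  nc : Fin H → S → A → ℕ
  /-- sum of the next-state reference values, over all visits -/
  muRef : Fin H → S → A → ℝ
  /-- sum of the squared next-state reference values, over all visits -/
  sigRef : Fin H → S → A → ℝ
  /-- sum of the next-state advantages (value minus reference), over the current stage -/
  muAdv : Fin H → S → A → ℝ
  /-- sum of the next-state values, over the current stage -/
  vAdv : Fin H → S → A → ℝ
  /-- sum of the squared next-state advantages, over the current stage -/
  sigAdv : Fin H → S → A → ℝ
  /-- the action value estimates -/
  Q : Fin H → S → A → ℝ
  /-- the value estimates -/
  V : Fin H → S → ℝ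
  /-- the reference values -/
  Vref : Fin H → S → ℝ

/-- Initialization: all accumulators are `0`, value estimates are the number of remaining steps,
and the reference values are `H`. -/
def AlgState.init (S A : Type*) (H : ℕ) : AlgState S A H where
  n := fun _ _ _ => 0
  nc := fun _ _ _ => 0
  muRef := fun _ _ _ => 0
  sigRef := fun _ _ _ => 0
  muAdv := fun _ _ _ => 0
  vAdv := fun _ _ _ => 0
  sigAdv := fun _ _ _ => 0
  Q := fun h _ _ => (H : ℝ) - (h : ℕ)
  V := fun h _ => (H : ℝ) - (h : ℕ)
  Vref := fun _ _ => (H : ℝ)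

/-- The value at step `h + 1`, which is `0` if `h` is the last step. -/
def nextVal {S : Type*} {H : ℕ} (f : Fin H → S → ℝ) (h : Fin H) (s : S) : ℝ :=
  if hh : (h : ℕ) + 1 < H then f ⟨h + 1, hh⟩ s else 0

/-- The bonus `b` of the reference-advantage update. -/
def advBonus (H : ℕ) (ι : ℝ) (n nc : ℕ) (muRef sigRef muAdv sigAdv : ℝ) : ℝ :=
  2 * √((sigRef / n - (muRef / n) ^ 2) / n * ι)
    + 2 * √((sigAdv / nc - (muAdv / nc) ^ 2) / nc * ι)
    + 5 * (H * ι / n + H * ι / nc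
        + H * ι ^ (3 / 4 : ℝ) / (n : ℝ) ^ (3 / 4 : ℝ)
        + H * ι ^ (3 / 4 : ℝ) / (nc : ℝ) ^ (3 / 4 : ℝ))

/-- The bonus of the Hoeffding-type update. -/
def hoeffdingBonus (H : ℕ) (ι : ℝ) (nc : ℕ) : ℝ := 2 * √((H : ℝ) ^ 2 / nc * ι)

section Update

variable {S A : Type*} [Fintype A] [DecidableEq S] [DecidableEq A] {H : ℕ}

/-- Overwrite the entry `(h, s, a)` of a table by `x`. -/
def setQ {β : Type*} (f : Fin H → S → A → β) (h : Fin H) (s : S) (a : A) (x : β) :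
    Fin H → S → A → β :=
  fun i t b => if i = h ∧ t = s ∧ b = a then x else f i t b

/-- Overwrite the entry `(h, s)` of a table by `x`. -/
def setV (f : Fin H → S → ℝ) (h : Fin H) (s : S) (x : ℝ) : Fin H → S → ℝ :=
  fun i t => if i = h ∧ t = s then x else f i t

open scoped Classical in
/-- The update at step `h`, after action `a` was taken in state `s` and `s'` was observed next.
`r` is the reward function, `ι` the logarithmic factor, and `N₀` the number of visits after
which a reference value is settled. -/
def stepUpdate (r : Fin H → S → A → ℝ) (ι : ℝ) (N₀ : ℕ) (st : AlgState S A H)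
    (h : Fin H) (s : S) (a : A) (s' : S) : AlgState S A H :=
  let v' := nextVal st.V h s'
  let ref' := nextVal st.Vref h s'
  -- the accumulators of `(s, a, h)` including the present visit
  let n := st.n h s a + 1
  let nc := st.nc h s a + 1
  let muRef := st.muRef h s a + ref'
  let sigRef := st.sigRef h s a + ref' ^ 2
  let muAdv := st.muAdv h s a + (v' - ref')
  let vAdv := st.vAdv h s a + v'
  let sigAdv := st.sigAdv h s a + (v' - ref') ^ 2
  -- does the present visit end a stage?
  let ends : Prop := n ∈ stageEnds H
  let newQ := min (r h s a + vAdv / nc + hoeffdingBonus H ι nc)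
    (min (r h s a + muRef / n + muAdv / nc + advBonus H ι n nc muRef sigRef muAdv sigAdv)
      (st.Q h s a))
  let nTab := setQ st.n h s a n
  let Q := if ends then setQ st.Q h s a newQ else st.Q
  let V := if ends then setV st.V h s (⨆ b, Q h s b) else st.V
  { n := nTab
    nc := setQ st.nc h s a (if ends then 0 else nc)
    muRef := setQ st.muRef h s a muRef
    sigRef := setQ st.sigRef h s a sigRef
    muAdv := setQ st.muAdv h s a (if ends then 0 else muAdv)
    vAdv := setQ st.vAdv h s a (if ends then 0 else vAdv)
    sigAdv := setQ st.sigAdv h s a (if ends then 0 else sigAdv)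
    Q := Q
    V := V
    Vref := if ∑ b, nTab h s b = N₀ then setV st.Vref h s (V h s) else st.Vref }

/-- One episode: the step updates for `h = 1, …, H` in this order. `x` are the states of the
episode and `p` is the policy. The step-`h` update changes only the step-`h` entries of the
tables, so acting greedily with respect to the current `Q` at each step is the same as acting
greedily with respect to the `Q` at the start of the episode. -/
def episodeUpdate (r : Fin H → S → A → ℝ) (ι : ℝ) (N₀ : ℕ) (st : AlgState S A H)
    (x : Fin (H + 1) → S) (p : Fin H → S → A) : AlgState S A H :=
  (List.finRange H).foldl
    (fun st h => stepUpdate r ι N₀ st h (x h.castSucc) (p h (x h.castSucc)) (x h.succ)) st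

/-- The variables after `k` episodes, given the states `x k` and the policy `p k` of each
episode `k` (episodes are indexed from `0`). -/
def algState (r : Fin H → S → A → ℝ) (ι : ℝ) (N₀ : ℕ)
    (x : ℕ → Fin (H + 1) → S) (p : ℕ → Fin H → S → A) : ℕ → AlgState S A H
  | 0 => AlgState.init S A H
  | k + 1 => episodeUpdate r ι N₀ (algState r ι N₀ x p k) (x k) (p k)

end Update

/-- `IsRun M ι N₀ K μ ℱ X π`: on the probability space `(Ω, μ)`, the states `X k h` and the
policies `π k` of the episodes `k < K` form a run of the algorithm on the MDP `M`.
`ℱ (k * (H + 1) + h)` is the information available when the `h`-th state of episode `k` has been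
observed; it contains all earlier states, and possibly private randomness of the adversary and
of the learner. The adversary chooses the first state `X k 0` of each episode arbitrarily, given
the past. The learner breaks ties in the argmax arbitrarily, given the past. -/
structure IsRun {S A Ω : Type*} [Fintype S] [Fintype A] [DecidableEq S] [DecidableEq A]
    {mΩ : MeasurableSpace Ω} {H : ℕ} (M : MDP S A H) (ι : ℝ) (N₀ K : ℕ)
    (μ : Measure Ω) (ℱ : Filtration ℕ mΩ)
    (X : ℕ → Fin (H + 1) → Ω → S) (π : ℕ → Ω → Fin H → S → A) : Prop where
  /-- The states are observed. -/
  measurable_state : ∀ k < K, ∀ (h : Fin (H + 1)) (s : S),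
    MeasurableSet[ℱ (k * (H + 1) + h)] {ω | X k h ω = s}
  /-- The policy of an episode is fixed at its start. -/
  measurable_policy : ∀ k < K, ∀ p : Fin H → S → A,
    MeasurableSet[ℱ (k * (H + 1))] {ω | π k ω = p}
  /-- The policy is greedy with respect to the current estimate `Q`. -/
  greedy : ∀ k < K, ∀ (ω : Ω) (h : Fin H) (s : S) (a : A),
    (algState M.r ι N₀ (fun j i => X j i ω) (fun j => π j ω) k).Q h s a ≤
      (algState M.r ι N₀ (fun j i => X j i ω) (fun j => π j ω) k).Q h s (π k ω h s)
  /-- Given the past, the next state has the distribution prescribed by the MDP. -/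
  transition : ∀ k < K, ∀ (h : Fin H) (s' : S),
    μ[{ω | X k h.succ ω = s'}.indicator (fun _ => (1 : ℝ)) | ℱ (k * (H + 1) + h)] =ᵐ[μ]
      fun ω => M.P h (X k h.castSucc ω) (π k ω h (X k h.castSucc ω)) s'

/-- The regret over `K` episodes with initial states `x k` and deterministic policies `p k`. -/
def regret {S A : Type*} [Fintype S] [Fintype A] [DecidableEq A] {H : ℕ} (M : MDP S A H)
    (K : ℕ) (x : ℕ → S) (p : ℕ → Fin H → S → A) : ℝ :=
  ∑ k ∈ range K, (M.Vstar 0 (x k) - M.V (detPolicy (p k)) 0 (x k))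

/-- `ι = log (2 / p)`, where `p` is the failure probability. -/
def logFactor (p : ℝ) : ℝ := Real.log (2 / p)

/-- The number of visits `N₀ = ⌈c₀ S A H⁵ ι / β²⌉` after which a reference value is settled. -/
def settleCount (S A : Type*) [Fintype S] [Fintype A] (H : ℕ) (c₀ β ι : ℝ) : ℕ :=
  ⌈c₀ * Fintype.card S * Fintype.card A * (H : ℝ) ^ 5 * ι / β ^ 2⌉₊

end

end UCBAdvantage

open UCBAdvantage

/-!
The proof has a deterministic half and a probabilistic half, which meet in `ConcentrationEvent`:
the event that the sums over visits of seven families of functions of the next state (optimal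
values, reference values, advantages, their squares, and the settled parts of the reference
values) are close to the sums of their conditional expectations.

**Deterministic half.** On the concentration event all estimates are optimistic (`optimistic`):
the bonuses are empirical Bernstein and Hoeffding widths, and reference values decrease in time,
so that replacing their average over the last stage by the average over all visits only increases
the estimate. After the first stage, the error `Q - Q⋆` at the state and action of episode `k` is
at most a local cost plus the average of the errors at the next step over the last completed stage
of that triple. In the other direction, an episode is used in at most `(1 + 1 / H) e` such averages
with weight `1 / e`, where `e` is the length of its stage. Unrolling this recursion over the `H`
steps therefore multiplies weights by at most `(1 + 1 / H) ^ H ≤ 3`, so that a sum of errors with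
weights in `[0, 1]` is at most `H` times the largest sum of local costs of one step with weights in
`[0, 3]` and the same total weight (`sum_mul_ownError_le`). This inequality is used twice.

* With the cost `√(H³ ι / m)` of the Hoeffding-type update, `m` being the visit number, it shows
  that after `N₀` visits the value estimate of a state is accurate up to a multiple `β'` of `β`
  (`V_sub_Vstar_le_of_visits`), hence so are settled reference values.
* With accurate reference values the reference-advantage update costs only
  `√((ℚ⋆ + β'² H) ι / m)` plus terms of order `1 / m` (`ownError_le_advantage`): the deviations of
  the reference part are governed by the variance of `V⋆`, those of the advantage part by `β'`.

For the regret, the episodes whose action has a positive gap at step `h` get the weight `1`, so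
that the sum `R` of the gaps is at most the weighted sum of the errors. In the cost sum one has
`∑ w √(D / m) ≤ ε W + O(S A D / ε)`, where `W` is the number of these episodes, and
`W Δ_min ≤ R`. With `ε = Δ_min / (2 H)` the term `H ε W` is at most `R / 2` and is absorbed
(`sum_ownGap_le`). No decomposition of the gaps into dyadic layers is needed.

**Probabilistic half.** The families are predictable: at episode `j` they depend only on earlier
episodes. For a fixed window of visit numbers and `|λ| ≤ 1 / 2`, the exponentials of
`∑ (λ (g - 𝔼 g) - λ² Var g)` form a supermartingale, because the state observed next has the
prescribed conditional distribution. Markov's inequality and a union bound over windows, over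
`λ = ± 1 / (2 q)` with `q ≤ K`, over triples and over families make the concentration event fail
with a probability that is polynomially small in `S A T`
(`IsRun.measureReal_not_concentrationEvent_le`). The union over all windows of visit numbers
replaces stopping times, and the optimization over `q` gives Freedman's inequality. Finally, the
expected regret equals the expected sum of the gaps of all actions (`IsRun.integral_regret_eq`),
since the gaps of an episode telescope along its transitions.
-/

namespace UCBAdvantage

set_option linter.unusedSectionVars false

noncomputable section

/-! ### Bellman optimality and the decomposition of the regret into gaps -/

namespace MDP

variable {S A : Type*} [Fintype S] [Fintype A] {H : ℕ} (M : MDP S A H)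

lemma expect_mono (h : Fin H) (s : S) (a : A) {f g : S → ℝ} (hfg : ∀ t, f t ≤ g t) :
    M.expect h s a f ≤ M.expect h s a g :=
  sum_le_sum fun t _ => mul_le_mul_of_nonneg_left (hfg t) (stdSimplex.zero_le _ t)

lemma expect_const (h : Fin H) (s : S) (a : A) (c : ℝ) :
    M.expect h s a (fun _ => c) = c := by
  simp only [expect]
  rw [← sum_mul, stdSimplex.sum_eq_one, one_mul]

lemma expect_sub (h : Fin H) (s : S) (a : A) (f g : S → ℝ) :
    M.expect h s a (fun t => f t - g t) = M.expect h s a f - M.expect h s a g := by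
  simp only [expect, mul_sub, sum_sub_distrib]

lemma expect_add (h : Fin H) (s : S) (a : A) (f g : S → ℝ) :
    M.expect h s a (fun t => f t + g t) = M.expect h s a f + M.expect h s a g := by
  simp only [expect, mul_add, sum_add_distrib]

lemma expect_mul_left (h : Fin H) (s : S) (a : A) (c : ℝ) (f : S → ℝ) :
    M.expect h s a (fun t => c * f t) = c * M.expect h s a f := by
  simp only [expect, mul_sum, mul_left_comm]

lemma expect_le (h : Fin H) (s : S) (a : A) {f : S → ℝ} {c : ℝ} (hf : ∀ t, f t ≤ c) :
    M.expect h s a f ≤ c :=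
  (M.expect_mono h s a hf).trans_eq (M.expect_const h s a c)

lemma le_expect (h : Fin H) (s : S) (a : A) {f : S → ℝ} {c : ℝ} (hf : ∀ t, c ≤ f t) :
    c ≤ M.expect h s a f :=
  (M.expect_const h s a c).symm.trans_le (M.expect_mono h s a hf)

lemma cvar_eq_expect_sq (h : Fin H) (s : S) (a : A) (f : S → ℝ) :
    M.cvar h s a f = M.expect h s a (fun t => (f t - M.expect h s a f) ^ 2) := by
  have : (fun t => (f t - M.expect h s a f) ^ 2) =
      fun t => (f t ^ 2 - (2 * M.expect h s a f) * f t) + M.expect h s a f ^ 2 := by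
    funext t; ring
  rw [this, expect_add, expect_sub, expect_mul_left, expect_const, cvar]
  ring

lemma cvar_nonneg (h : Fin H) (s : S) (a : A) (f : S → ℝ) : 0 ≤ M.cvar h s a f := by
  rw [cvar_eq_expect_sq]
  exact M.le_expect h s a fun t => sq_nonneg _

lemma cvar_le_expect_sq (h : Fin H) (s : S) (a : A) (f : S → ℝ) :
    M.cvar h s a f ≤ M.expect h s a (fun t => f t ^ 2) :=
  sub_le_self _ (sq_nonneg _)

lemma cvar_mul_left (h : Fin H) (s : S) (a : A) (c : ℝ) (f : S → ℝ) :
    M.cvar h s a (fun t => c * f t) = c ^ 2 * M.cvar h s a f := by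
  simp only [cvar, mul_pow, expect_mul_left]
  ring

lemma V_of_lt (π : Policy S A H) {h : ℕ} (hh : h < H) (s : S) :
    M.V π h s = ∑ a, π ⟨h, hh⟩ s a *
      (M.r ⟨h, hh⟩ s a + M.expect ⟨h, hh⟩ s a (M.V π (h + 1))) := by
  rw [V, dif_pos hh]

lemma V_of_le (π : Policy S A H) {h : ℕ} (hh : H ≤ h) (s : S) : M.V π h s = 0 := by
  rw [V, dif_neg (not_lt.2 hh)]

/-- The value function of dynamic programming: the Bellman recursion with a maximum over
actions. -/
def bellmanV (h : ℕ) : S → ℝ :=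
  if hh : h < H then fun s =>
    ⨆ a, (M.r ⟨h, hh⟩ s a + M.expect ⟨h, hh⟩ s a (bellmanV (h + 1)))
  else fun _ => 0
termination_by H - h

lemma bellmanV_of_lt {h : ℕ} (hh : h < H) (s : S) :
    M.bellmanV h s = ⨆ a, (M.r ⟨h, hh⟩ s a + M.expect ⟨h, hh⟩ s a (M.bellmanV (h + 1))) := by
  rw [bellmanV, dif_pos hh]

lemma bellmanV_of_le {h : ℕ} (hh : H ≤ h) (s : S) : M.bellmanV h s = 0 := by
  rw [bellmanV, dif_neg (not_lt.2 hh)]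

lemma V_detPolicy [DecidableEq A] (p : Fin H → S → A) (h : Fin H) (s : S) :
    M.V (detPolicy p) h s =
      M.r h s (p h s) + M.expect h s (p h s) (M.V (detPolicy p) (h + 1)) := by
  rw [V_of_lt _ _ h.2]
  simp [detPolicy, stdSimplex.vertex_coe, Pi.single_apply]

lemma V_le_bellmanV (π : Policy S A H) (h : ℕ) (s : S) : M.V π h s ≤ M.bellmanV h s := by
  by_cases hh : h < H
  · rw [V_of_lt _ _ hh, bellmanV_of_lt _ hh]
    calc _ ≤ ∑ a, π ⟨h, hh⟩ s a *
          ⨆ a, (M.r ⟨h, hh⟩ s a + M.expect ⟨h, hh⟩ s a (M.bellmanV (h + 1))) := by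
          refine sum_le_sum fun a _ => mul_le_mul_of_nonneg_left ?_ (stdSimplex.zero_le _ a)
          refine le_trans ?_ (le_ciSup (Set.finite_range _).bddAbove a)
          exact add_le_add le_rfl (M.expect_mono _ _ _ fun t => V_le_bellmanV π (h + 1) t)
      _ = _ := by rw [← sum_mul, stdSimplex.sum_eq_one, one_mul]
  · rw [V_of_le _ _ (not_lt.1 hh), bellmanV_of_le _ (not_lt.1 hh)]
termination_by H - h

lemma exists_policy_eq_bellmanV [Nonempty A] :
    ∃ π : Policy S A H, ∀ h s, M.V π h s = M.bellmanV h s := by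
  classical
  have hex : ∀ (h : Fin H) (s : S), ∃ a,
      M.r h s a + M.expect h s a (M.bellmanV (h + 1)) = M.bellmanV h s := by
    intro h s
    rw [bellmanV_of_lt _ h.2]
    exact exists_eq_ciSup_of_finite
  choose p hp using hex
  refine ⟨detPolicy p, ?_⟩
  have key : ∀ n h, H - h = n → ∀ s, M.V (detPolicy p) h s = M.bellmanV h s := by
    intro n
    induction n with
    | zero =>
      intro h hn s
      rw [V_of_le _ _ (by omega), bellmanV_of_le _ (by omega)]
    | succ n ih =>
      intro h hn s
      have hh : h < H := by omega
      have := M.V_detPolicy p ⟨h, hh⟩ s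
      rw [this, ← hp ⟨h, hh⟩ s]
      congr 2
      funext t
      exact ih (h + 1) (by omega) t
  exact fun h => key _ h rfl

lemma Vstar_eq_bellmanV [Nonempty A] (h : ℕ) (s : S) : M.Vstar h s = M.bellmanV h s := by
  obtain ⟨π, hπ⟩ := M.exists_policy_eq_bellmanV
  refine le_antisymm (ciSup_le fun π' => M.V_le_bellmanV π' h s) ?_
  rw [← hπ h s]
  exact le_ciSup (f := fun π => M.V π h s)
    ⟨M.bellmanV h s, by rintro _ ⟨π', rfl⟩; exact M.V_le_bellmanV π' h s⟩ π

lemma Vstar_of_le [Nonempty A] {h : ℕ} (hh : H ≤ h) (s : S) : M.Vstar h s = 0 := by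
  rw [Vstar_eq_bellmanV, bellmanV_of_le _ hh]

lemma Vstar_eq_iSup_Qstar [Nonempty A] (h : Fin H) (s : S) :
    M.Vstar h s = ⨆ a, M.Qstar h s a := by
  rw [Vstar_eq_bellmanV, bellmanV_of_lt _ h.2]
  congr 1
  funext a
  rw [Qstar]
  congr 2
  funext t
  rw [Vstar_eq_bellmanV]

lemma Qstar_le_Vstar [Nonempty A] (h : Fin H) (s : S) (a : A) :
    M.Qstar h s a ≤ M.Vstar h s := by
  rw [Vstar_eq_iSup_Qstar]
  exact le_ciSup (Set.finite_range _).bddAbove a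

lemma exists_Qstar_eq_Vstar [Nonempty A] (h : Fin H) (s : S) :
    ∃ a, M.Qstar h s a = M.Vstar h s := by
  rw [Vstar_eq_iSup_Qstar]
  exact exists_eq_ciSup_of_finite

lemma Vstar_bounds [Nonempty A] {h : ℕ} (hh : h ≤ H) (s : S) :
    0 ≤ M.Vstar h s ∧ M.Vstar h s ≤ (H : ℝ) - h := by
  rcases hh.lt_or_eq with hlt | rfl
  · have ih := fun t => Vstar_bounds (h := h + 1) hlt t
    obtain ⟨a, ha⟩ := M.exists_Qstar_eq_Vstar ⟨h, hlt⟩ s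
    have ha' : M.Vstar h s = M.r ⟨h, hlt⟩ s a + M.expect ⟨h, hlt⟩ s a (M.Vstar (h + 1)) :=
      ha.symm
    have h1 := M.le_expect ⟨h, hlt⟩ s a (fun t => (ih t).1)
    have h2 := M.expect_le ⟨h, hlt⟩ s a (fun t => (ih t).2)
    have h3 := M.r_nonneg ⟨h, hlt⟩ s a
    have h4 := M.r_le_one ⟨h, hlt⟩ s a
    push_cast at h2
    constructor <;> linarith
  · rw [Vstar_of_le _ le_rfl]; simp
termination_by H - h

lemma Vstar_nonneg [Nonempty A] (h : ℕ) (s : S) : 0 ≤ M.Vstar h s := by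
  rcases le_total h H with hh | hh
  · exact (M.Vstar_bounds hh s).1
  · rw [M.Vstar_of_le hh]

lemma Vstar_le [Nonempty A] (h : ℕ) (s : S) : M.Vstar h s ≤ H := by
  rcases le_total h H with hh | hh
  · exact (M.Vstar_bounds hh s).2.trans (sub_le_self _ (Nat.cast_nonneg _))
  · rw [M.Vstar_of_le hh]; exact Nat.cast_nonneg _

lemma Qstar_le [Nonempty A] (h : Fin H) (s : S) (a : A) :
    M.Qstar h s a ≤ (H : ℝ) - (h : ℕ) :=
  (M.Qstar_le_Vstar h s a).trans (M.Vstar_bounds h.2.le s).2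

lemma Qstar_nonneg [Nonempty A] (h : Fin H) (s : S) (a : A) : 0 ≤ M.Qstar h s a :=
  add_nonneg (M.r_nonneg h s a) (M.le_expect h s a fun t => M.Vstar_nonneg _ t)

lemma gap_nonneg [Nonempty A] (h : Fin H) (s : S) (a : A) : 0 ≤ M.gap h s a :=
  sub_nonneg.2 (M.Qstar_le_Vstar h s a)

lemma gap_le [Nonempty A] (h : Fin H) (s : S) (a : A) : M.gap h s a ≤ H := by
  have := M.Qstar_nonneg h s a
  have := M.Vstar_le h s
  simp only [gap]; linarith

lemma gapMin_le (h : Fin H) (s : S) (a : A) (hg : 0 < M.gap h s a) :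
    M.gapMin ≤ M.gap h s a :=
  csInf_le ⟨0, by rintro _ ⟨_, _, _, _, hx⟩; exact hx.le⟩ ⟨h, s, a, rfl, hg⟩

lemma gapMin_pos (hg : ∃ h s a, 0 < M.gap h s a) : 0 < M.gapMin := by
  obtain ⟨h, s, a, hg⟩ := hg
  have hfin : {x | ∃ h s a, x = M.gap h s a ∧ 0 < x}.Finite := by
    refine (Set.finite_range fun y : Fin H × S × A => M.gap y.1 y.2.1 y.2.2).subset ?_
    rintro _ ⟨h, s, a, rfl, _⟩
    exact ⟨(h, s, a), rfl⟩
  have hne : {x | ∃ h s a, x = M.gap h s a ∧ 0 < x}.Nonempty := ⟨_, h, s, a, rfl, hg⟩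
  obtain ⟨_, _, _, _, hx⟩ := hne.csInf_mem hfin
  exact hx

lemma cvar_le_maxVar (h : Fin H) (s : S) (a : A) :
    M.cvar h s a (M.Vstar (h + 1)) ≤ M.maxVar :=
  le_ciSup (f := fun x : Fin H × S × A => M.cvar x.1 x.2.1 x.2.2 (M.Vstar (x.1 + 1)))
    (Set.finite_range _).bddAbove (h, s, a)

lemma maxVar_nonneg : 0 ≤ M.maxVar := Real.iSup_nonneg fun _ => M.cvar_nonneg _ _ _ _

/-- One step of the decomposition of the regret of a deterministic policy into gaps. -/
lemma Vstar_sub_V_detPolicy [DecidableEq A] (p : Fin H → S → A) (h : Fin H) (s : S) :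
    M.Vstar h s - M.V (detPolicy p) h s = M.gap h s (p h s) +
      M.expect h s (p h s) (fun t => M.Vstar (h + 1) t - M.V (detPolicy p) (h + 1) t) := by
  rw [V_detPolicy, expect_sub, gap, Qstar]
  ring

end MDP

/-! ### Stages -/

lemma stageLen_succ (H i : ℕ) : stageLen H (i + 1) = (H + 1) * stageLen H i / H := rfl

lemma stageLen_succ_eq {H : ℕ} (hH : 1 ≤ H) (i : ℕ) :
    stageLen H (i + 1) = stageLen H i + stageLen H i / H := by
  rw [stageLen_succ, add_mul, one_mul, add_comm, Nat.add_mul_div_left _ _ hH, add_comm]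

lemma le_stageLen {H : ℕ} (hH : 1 ≤ H) (i : ℕ) : H ≤ stageLen H i := by
  induction i with
  | zero => exact le_rfl
  | succ i ih => rw [stageLen_succ_eq hH]; exact ih.trans (Nat.le_add_right _ _)

lemma stageLen_pos {H : ℕ} (hH : 1 ≤ H) (i : ℕ) : 0 < stageLen H i := hH.trans (le_stageLen hH i)

lemma stageLen_succ_le {H : ℕ} (hH : 1 ≤ H) (i : ℕ) :
    (stageLen H (i + 1) : ℝ) ≤ (1 + 1 / H) * stageLen H i := by
  have hH' : (0 : ℝ) < H := by exact_mod_cast hH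
  rw [stageLen_succ]
  refine Nat.cast_div_le.trans (le_of_eq ?_)
  push_cast
  field_simp

lemma stageLen_succ_le_two_mul {H : ℕ} (hH : 1 ≤ H) (i : ℕ) :
    stageLen H (i + 1) ≤ 2 * stageLen H i := by
  rw [stageLen_succ_eq hH]
  have := Nat.div_le_self (stageLen H i) H
  omega

/-- The number of visits after the first `j` stages. -/
def stageEnd (H j : ℕ) : ℕ := ∑ i ∈ range j, stageLen H i

lemma stageEnd_zero (H : ℕ) : stageEnd H 0 = 0 := rfl

lemma stageEnd_succ (H j : ℕ) : stageEnd H (j + 1) = stageEnd H j + stageLen H j :=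
  sum_range_succ _ _

lemma stageEnd_strictMono {H : ℕ} (hH : 1 ≤ H) : StrictMono (stageEnd H) :=
  strictMono_nat_of_lt_succ fun j => by
    rw [stageEnd_succ]; exact Nat.lt_add_of_pos_right (stageLen_pos hH j)

/-- A stage has a length of at least the fraction `1 / (4 H)` of all visits up to its end. -/
lemma stageEnd_succ_le {H : ℕ} (hH : 1 ≤ H) (j : ℕ) :
    stageEnd H (j + 1) ≤ 4 * H * stageLen H j := by
  have key : ∀ j, stageEnd H j ≤ 2 * H * (stageLen H j - H) := by
    intro j
    induction j with
    | zero => simp [stageEnd_zero]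
    | succ j ih =>
      have h1 := le_stageLen hH j
      rw [stageEnd_succ, stageLen_succ_eq hH]
      have h2 : stageLen H j ≤ 2 * H * (stageLen H j / H) := by
        have h3 := Nat.div_add_mod (stageLen H j) H
        have h4 := Nat.mod_lt (stageLen H j) hH
        have h5 : 1 ≤ stageLen H j / H := (Nat.one_le_div_iff hH).2 h1
        nlinarith
      rw [Nat.sub_add_comm h1, mul_add]
      omega
  have h1 := key j
  have h2 : 2 * H * (stageLen H j - H) ≤ 2 * H * stageLen H j :=
    Nat.mul_le_mul_left _ (Nat.sub_le _ _)
  have h3 : stageLen H j ≤ 2 * H * stageLen H j :=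
    Nat.le_mul_of_pos_left _ (by omega)
  rw [stageEnd_succ]
  linarith

/-- The number of completed stages after `n` visits. -/
def stageIdx (H n : ℕ) : ℕ := Nat.findGreatest (fun j => stageEnd H j ≤ n) n

lemma stageEnd_stageIdx_le (H n : ℕ) : stageEnd H (stageIdx H n) ≤ n :=
  Nat.findGreatest_spec (P := fun j => stageEnd H j ≤ n) (Nat.zero_le n) (Nat.zero_le n)

lemma lt_stageEnd_stageIdx_succ {H : ℕ} (hH : 1 ≤ H) (n : ℕ) :
    n < stageEnd H (stageIdx H n + 1) := by
  rcases le_or_gt (stageIdx H n + 1) n with hle | hlt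
  · exact not_le.1 (Nat.findGreatest_is_greatest (P := fun j => stageEnd H j ≤ n)
      (Nat.lt_succ_self _) hle)
  · exact hlt.trans_le ((stageEnd_strictMono hH).le_apply)

lemma stageIdx_eq_iff {H : ℕ} (hH : 1 ≤ H) {n j : ℕ} :
    stageIdx H n = j ↔ stageEnd H j ≤ n ∧ n < stageEnd H (j + 1) := by
  refine ⟨?_, fun ⟨h1, h2⟩ => ?_⟩
  · rintro rfl
    exact ⟨stageEnd_stageIdx_le H n, lt_stageEnd_stageIdx_succ hH n⟩
  · have h3 := (stageEnd_strictMono hH).lt_iff_lt.1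
      ((stageEnd_stageIdx_le H n).trans_lt h2)
    have h4 := (stageEnd_strictMono hH).lt_iff_lt.1
      (h1.trans_lt (lt_stageEnd_stageIdx_succ hH n))
    omega

lemma succ_mem_stageEnds_iff {H : ℕ} (hH : 1 ≤ H) (n : ℕ) :
    n + 1 ∈ stageEnds H ↔ n + 1 = stageEnd H (stageIdx H n + 1) := by
  have h1 := stageEnd_stageIdx_le H n
  have h2 := lt_stageEnd_stageIdx_succ hH n
  constructor
  · rintro ⟨j, -, hj⟩
    change n + 1 = stageEnd H j at hj
    have h3 := (stageEnd_strictMono hH).lt_iff_lt.1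
      (show stageEnd H (stageIdx H n) < stageEnd H j by omega)
    have h4 := (stageEnd_strictMono hH).monotone (show stageIdx H n + 1 ≤ j by omega)
    omega
  · intro h
    exact ⟨_, by omega, h⟩

/-! ### Visits and their numbers -/

section Window

variable (v : ℕ → Prop) [DecidablePred v]

/-- The times before `K` of the visits with numbers in `[lo, hi)`, where `v` tells whether a
time is a visit, and visits are numbered from `0`. -/
def window (K lo hi : ℕ) : Finset ℕ :=
  (range K).filter fun j => v j ∧ lo ≤ Nat.count v j ∧ Nat.count v j < hi

variable {v}

lemma mem_window {K lo hi j : ℕ} :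
    j ∈ window v K lo hi ↔ j < K ∧ v j ∧ lo ≤ Nat.count v j ∧ Nat.count v j < hi := by
  simp [window]

/-- A sum over visits is a sum over visit numbers. -/
lemma sum_filter_count {β : Type*} [AddCommMonoid β] (F : ℕ → β) (K : ℕ) :
    ∑ j ∈ (range K).filter v, F (Nat.count v j) = ∑ m ∈ range (Nat.count v K), F m := by
  induction K with
  | zero => simp
  | succ K ih =>
    rw [sum_filter, sum_range_succ, ← sum_filter, ih, Nat.count_succ]
    split_ifs
    · rw [sum_range_succ]
    · simp

lemma card_window_eq (K lo hi : ℕ) :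
    #(window v K lo hi) = #((range (Nat.count v K)).filter fun m => lo ≤ m ∧ m < hi) := by
  have h := sum_filter_count (v := v) (fun m => if lo ≤ m ∧ m < hi then 1 else 0) K
  rw [← sum_filter, ← sum_filter, ← card_eq_sum_ones, ← card_eq_sum_ones, filter_filter] at h
  exact h

lemma card_window_le (K lo hi : ℕ) : #(window v K lo hi) ≤ hi - lo := by
  rw [card_window_eq, ← Nat.card_Ico]
  refine card_le_card fun m hm => ?_
  simp only [mem_filter] at hm
  exact mem_Ico.2 hm.2

lemma card_window {K lo hi : ℕ} (hhi : hi ≤ Nat.count v K) : #(window v K lo hi) = hi - lo := by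
  rw [card_window_eq, ← Nat.card_Ico]
  congr 1
  ext m
  simp only [mem_filter, mem_range, mem_Ico]
  omega

lemma lt_of_mem_window {K lo hi k j : ℕ} (hj : j ∈ window v K lo hi)
    (hk : hi ≤ Nat.count v k) : j < k := by
  by_contra hlt
  have := Nat.count_monotone v (not_lt.1 hlt)
  have := (mem_window.1 hj).2.2.2
  omega

lemma window_self (K lo : ℕ) : window v K lo lo = ∅ := by
  ext j
  simp only [mem_window, notMem_empty, iff_false]
  omega

lemma sum_window_succ {β : Type*} [AddCommMonoid β] (g : ℕ → β) {K lo k : ℕ} (hk : v k)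
    (hkK : k < K) (hlo : lo ≤ Nat.count v k) :
    ∑ j ∈ window v K lo (Nat.count v k + 1), g j
      = ∑ j ∈ window v K lo (Nat.count v k), g j + g k := by
  have : window v K lo (Nat.count v k + 1) = insert k (window v K lo (Nat.count v k)) := by
    ext j
    simp only [mem_window, mem_insert]
    constructor
    · rintro ⟨h1, h2, h3, h4⟩
      by_cases hjk : j = k
      · exact Or.inl hjk
      · right
        refine ⟨h1, h2, h3, lt_of_le_of_ne (by omega) fun he => hjk ?_⟩
        exact Nat.count_injective h2 hk he
    · rintro (rfl | ⟨h1, h2, h3, h4⟩)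
      · exact ⟨hkK, hk, hlo, by omega⟩
      · exact ⟨h1, h2, h3, by omega⟩
  rw [this, sum_insert (by simp [mem_window]), add_comm]

lemma window_subset (K : ℕ) {lo lo' hi hi' : ℕ} (hlo : lo' ≤ lo) (hhi : hi ≤ hi') :
    window v K lo hi ⊆ window v K lo' hi' := by
  intro j
  simp only [mem_window]
  rintro ⟨h1, h2, h3, h4⟩
  exact ⟨h1, h2, by omega, by omega⟩

end Window

/-! ### The variables of the algorithm along a trajectory -/

section Rows

variable {S A : Type*} [Fintype A] [DecidableEq S] [DecidableEq A] {H : ℕ}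

/-- Two states of the algorithm agree in all variables that belong to the step `h`. -/
structure RowEq (st st' : AlgState S A H) (h : Fin H) : Prop where
  n : st.n h = st'.n h
  nc : st.nc h = st'.nc h
  muRef : st.muRef h = st'.muRef h
  sigRef : st.sigRef h = st'.sigRef h
  muAdv : st.muAdv h = st'.muAdv h
  vAdv : st.vAdv h = st'.vAdv h
  sigAdv : st.sigAdv h = st'.sigAdv h
  Q : st.Q h = st'.Q h
  V : st.V h = st'.V h
  Vref : st.Vref h = st'.Vref h

lemma RowEq.refl (st : AlgState S A H) (h : Fin H) : RowEq st st h :=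
  ⟨rfl, rfl, rfl, rfl, rfl, rfl, rfl, rfl, rfl, rfl⟩

lemma RowEq.trans {st st' st'' : AlgState S A H} {h : Fin H} (e : RowEq st st' h)
    (e' : RowEq st' st'' h) : RowEq st st'' h :=
  ⟨e.n.trans e'.n, e.nc.trans e'.nc, e.muRef.trans e'.muRef, e.sigRef.trans e'.sigRef,
    e.muAdv.trans e'.muAdv, e.vAdv.trans e'.vAdv, e.sigAdv.trans e'.sigAdv, e.Q.trans e'.Q,
    e.V.trans e'.V, e.Vref.trans e'.Vref⟩

lemma setQ_of_ne {β : Type*} (f : Fin H → S → A → β) {h i : Fin H} (hi : i ≠ h) (s : S) (a : A)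
    (y : β) : setQ f h s a y i = f i := by
  funext t b; simp [setQ, hi]

lemma setV_of_ne (f : Fin H → S → ℝ) {h i : Fin H} (hi : i ≠ h) (s : S) (y : ℝ) :
    setV f h s y i = f i := by
  funext t; simp [setV, hi]

lemma setQ_congr {β : Type*} {f g : Fin H → S → A → β} {h : Fin H} (hfg : f h = g h) (s : S)
    (a : A) (y : β) : setQ f h s a y h = setQ g h s a y h := by
  funext t b; simp only [setQ, hfg]

lemma setV_congr {f g : Fin H → S → ℝ} {h : Fin H} (hfg : f h = g h) (s : S) (y : ℝ) :
    setV f h s y h = setV g h s y h := by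
  funext t; simp only [setV, hfg]

variable (r : Fin H → S → A → ℝ) (ι : ℝ) (N₀ : ℕ)

lemma rowEq_stepUpdate_of_ne (st : AlgState S A H) {h i : Fin H} (hi : i ≠ h) (s : S) (a : A)
    (s' : S) : RowEq (stepUpdate r ι N₀ st h s a s') st i := by
  constructor <;> simp only [stepUpdate] <;> (try split_ifs) <;>
    simp only [setQ_of_ne _ hi, setV_of_ne _ hi]

lemma rowEq_stepUpdate {st st' : AlgState S A H} {h : Fin H} (e : RowEq st st' h)
    (hV : nextVal st.V h = nextVal st'.V h) (hVref : nextVal st.Vref h = nextVal st'.Vref h)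
    (s : S) (a : A) (s' : S) :
    RowEq (stepUpdate r ι N₀ st h s a s') (stepUpdate r ι N₀ st' h s a s') h := by
  have hQ : ∀ y, setQ st.Q h s a y h = setQ st'.Q h s a y h := fun y => setQ_congr e.Q _ _ _
  have hn : ∀ y, setQ st.n h s a y h = setQ st'.n h s a y h := fun y => setQ_congr e.n _ _ _
  have hV' : ∀ y, setV st.V h s y h = setV st'.V h s y h := fun y => setV_congr e.V _ _
  have hVref' : ∀ y, setV st.Vref h s y h = setV st'.Vref h s y h :=
    fun y => setV_congr e.Vref _ _
  by_cases hc : st'.n h s a + 1 ∈ stageEnds H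
  · have hc' : st.n h s a + 1 ∈ stageEnds H := by rwa [e.n]
    constructor <;>
      simp only [stepUpdate, if_pos hc, if_pos hc', ite_apply, hQ, hn, hV', hVref',
        setQ_congr e.nc, setQ_congr e.muRef, setQ_congr e.sigRef, setQ_congr e.muAdv,
        setQ_congr e.vAdv, setQ_congr e.sigAdv, e.n, e.nc, e.muRef, e.sigRef, e.muAdv, e.vAdv,
        e.sigAdv, e.Q, e.Vref, hV, hVref]
  · have hc' : st.n h s a + 1 ∉ stageEnds H := by rwa [e.n]
    constructor <;>
      simp only [stepUpdate, if_neg hc, if_neg hc', ite_apply, hn, hVref',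
        setQ_congr e.nc, setQ_congr e.muRef, setQ_congr e.sigRef, setQ_congr e.muAdv,
        setQ_congr e.vAdv, setQ_congr e.sigAdv, e.n, e.nc, e.muRef, e.sigRef, e.muAdv, e.vAdv,
        e.sigAdv, e.Q, e.V, e.Vref, hV, hVref]

lemma nextVal_congr {f g : Fin H → S → ℝ} (h : Fin H) (hfg : ∀ i, h < i → f i = g i) :
    nextVal f h = nextVal g h := by
  funext s
  simp only [nextVal]
  split_ifs with hh
  · rw [hfg _ (Fin.lt_def.2 (Nat.lt_succ_self _))]
  · rfl

/-- The step updates run forward in `h`, and the update of the step `h` reads only the rows `h` and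
`h + 1`. Hence it finds both rows as they were at the start of the episode. -/
lemma rowEq_foldl (s : Fin H → S) (a : Fin H → A) (s' : Fin H → S) (l : List (Fin H))
    (hl : l.Pairwise (· < ·)) (st : AlgState S A H) (h : Fin H) :
    RowEq (l.foldl (fun st h => stepUpdate r ι N₀ st h (s h) (a h) (s' h)) st)
      (if h ∈ l then stepUpdate r ι N₀ st h (s h) (a h) (s' h) else st) h := by
  induction l generalizing st with
  | nil => simpa using RowEq.refl st h
  | cons i l ih =>
    rw [List.pairwise_cons] at hl
    refine (ih hl.2 _).trans ?_
    by_cases hi : h = i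
    · subst hi
      have : h ∉ l := fun hm => lt_irrefl _ (hl.1 h hm)
      simpa [this] using RowEq.refl _ h
    · by_cases hm : h ∈ l
      · have hlt : i < h := hl.1 h hm
        simp only [hm, List.mem_cons, or_true, if_true]
        have hrow : ∀ t, i < t → RowEq (stepUpdate r ι N₀ st i (s i) (a i) (s' i)) st t :=
          fun t ht => rowEq_stepUpdate_of_ne r ι N₀ st ht.ne' _ _ _
        exact rowEq_stepUpdate r ι N₀ (hrow h hlt)
          (nextVal_congr h fun t ht => (hrow t (hlt.trans ht)).V)
          (nextVal_congr h fun t ht => (hrow t (hlt.trans ht)).Vref) _ _ _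
      · simp only [hm, List.mem_cons, hi, or_self, if_false]
        exact rowEq_stepUpdate_of_ne r ι N₀ st hi _ _ _

variable (x : ℕ → Fin (H + 1) → S) (p : ℕ → Fin H → S → A)

/-- During an episode the variables of the step `h` change by one step update, which uses the
value estimates from the start of the episode. -/
lemma rowEq_algState_succ (k : ℕ) (h : Fin H) :
    RowEq (algState r ι N₀ x p (k + 1))
      (stepUpdate r ι N₀ (algState r ι N₀ x p k) h (x k h.castSucc) (p k h (x k h.castSucc))
        (x k h.succ)) h := by
  have := rowEq_foldl r ι N₀ (fun h => x k h.castSucc) (fun h => p k h (x k h.castSucc))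
    (fun h => x k h.succ) (List.finRange H) (List.pairwise_lt_finRange H)
    (algState r ι N₀ x p k) h
  rw [if_pos (List.mem_finRange h)] at this
  exact this

/-- Episode `k` visits the state `s` and takes the action `a` at step `h`. -/
def Visit (h : Fin H) (s : S) (a : A) (k : ℕ) : Prop := x k h.castSucc = s ∧ p k h s = a

instance (h : Fin H) (s : S) (a : A) : DecidablePred (Visit x p h s a) :=
  fun _ => inferInstanceAs (Decidable (_ ∧ _))

lemma visit_iff {h : Fin H} {s : S} {a : A} {k : ℕ} :
    Visit x p h s a k ↔ s = x k h.castSucc ∧ a = p k h (x k h.castSucc) := by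
  simp only [Visit]
  constructor
  · rintro ⟨rfl, rfl⟩; exact ⟨rfl, rfl⟩
  · rintro ⟨rfl, rfl⟩; exact ⟨rfl, rfl⟩

lemma setQ_visit {β : Type*} (f : Fin H → S → A → β) (h : Fin H) (s : S) (a : A) (k : ℕ) (y : β) :
    setQ f h (x k h.castSucc) (p k h (x k h.castSucc)) y h s a =
      if Visit x p h s a k then y else f h s a := by
  simp only [setQ, true_and, visit_iff]

lemma setV_visit (f : Fin H → S → ℝ) (h : Fin H) (s : S) (k : ℕ) (y : ℝ) :
    setV f h (x k h.castSucc) y h s = if x k h.castSucc = s then y else f h s := by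
  simp only [setV, true_and, eq_comm]

variable (K : ℕ)

/-- The value estimate of the next state that episode `j` observes at step `h`. -/
def obsV (h : Fin H) (j : ℕ) (s' : S) : ℝ := nextVal (algState r ι N₀ x p j).V h s'

/-- The reference value of the next state that episode `j` observes at step `h`. -/
def obsRef (h : Fin H) (j : ℕ) (s' : S) : ℝ := nextVal (algState r ι N₀ x p j).Vref h s'

/-- The sum of `g j (s')` over the visits to `(h, s, a)` with numbers in `[lo, hi)`, where `s'` is
the state reached in the visiting episode `j`. -/
def visitSum (h : Fin H) (s : S) (a : A) (lo hi : ℕ) (g : ℕ → S → ℝ) : ℝ :=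
  ∑ j ∈ window (Visit x p h s a) K lo hi, g j (x j h.succ)

/-- The number of visits to `(h, s, a)` before episode `k`. -/
def visitCount (h : Fin H) (s : S) (a : A) (k : ℕ) : ℕ := Nat.count (Visit x p h s a) k

lemma algState_n (h : Fin H) (s : S) (a : A) (k : ℕ) :
    (algState r ι N₀ x p k).n h s a = visitCount x p h s a k := by
  induction k with
  | zero => rfl
  | succ k ih =>
    rw [(rowEq_algState_succ r ι N₀ x p k h).n, visitCount, Nat.count_succ]
    simp only [stepUpdate]
    rw [setQ_visit, ih]
    split_ifs with hv
    · obtain ⟨rfl, rfl⟩ := (visit_iff x p).1 hv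
      rw [ih]; rfl
    · rfl

/-- The estimate of `Q` of the Hoeffding-type update at the end of the stage `j`. -/
def hoeffdingEst (h : Fin H) (s : S) (a : A) (j : ℕ) : ℝ :=
  r h s a + visitSum x p K h s a (stageEnd H j) (stageEnd H (j + 1)) (obsV r ι N₀ x p h)
    / stageLen H j + hoeffdingBonus H ι (stageLen H j)

/-- The estimate of `Q` of the reference-advantage update at the end of the stage `j`. -/
def advEst (h : Fin H) (s : S) (a : A) (j : ℕ) : ℝ :=
  r h s a + visitSum x p K h s a 0 (stageEnd H (j + 1)) (obsRef r ι N₀ x p h)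
      / stageEnd H (j + 1)
    + visitSum x p K h s a (stageEnd H j) (stageEnd H (j + 1))
        (fun i s' => obsV r ι N₀ x p h i s' - obsRef r ι N₀ x p h i s') / stageLen H j
    + advBonus H ι (stageEnd H (j + 1)) (stageLen H j)
        (visitSum x p K h s a 0 (stageEnd H (j + 1)) (obsRef r ι N₀ x p h))
        (visitSum x p K h s a 0 (stageEnd H (j + 1)) (fun i s' => obsRef r ι N₀ x p h i s' ^ 2))
        (visitSum x p K h s a (stageEnd H j) (stageEnd H (j + 1))
          (fun i s' => obsV r ι N₀ x p h i s' - obsRef r ι N₀ x p h i s'))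
        (visitSum x p K h s a (stageEnd H j) (stageEnd H (j + 1))
          (fun i s' => (obsV r ι N₀ x p h i s' - obsRef r ι N₀ x p h i s') ^ 2))

/-- The stage of `(h, s, a)` at the start of episode `k`. -/
def visitStage (h : Fin H) (s : S) (a : A) (k : ℕ) : ℕ := stageIdx H (visitCount x p h s a k)

/-- The accumulators of `(h, s, a)` at the start of episode `k` are sums over visits. -/
structure AccumulatorInv (h : Fin H) (s : S) (a : A) (k : ℕ) : Prop where
  nc : (algState r ι N₀ x p k).nc h s a =
    visitCount x p h s a k - stageEnd H (visitStage x p h s a k)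
  muRef : (algState r ι N₀ x p k).muRef h s a =
    visitSum x p K h s a 0 (visitCount x p h s a k) (obsRef r ι N₀ x p h)
  sigRef : (algState r ι N₀ x p k).sigRef h s a =
    visitSum x p K h s a 0 (visitCount x p h s a k) (fun i s' => obsRef r ι N₀ x p h i s' ^ 2)
  muAdv : (algState r ι N₀ x p k).muAdv h s a =
    visitSum x p K h s a (stageEnd H (visitStage x p h s a k)) (visitCount x p h s a k)
      (fun i s' => obsV r ι N₀ x p h i s' - obsRef r ι N₀ x p h i s')
  vAdv : (algState r ι N₀ x p k).vAdv h s a =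
    visitSum x p K h s a (stageEnd H (visitStage x p h s a k)) (visitCount x p h s a k)
      (obsV r ι N₀ x p h)
  sigAdv : (algState r ι N₀ x p k).sigAdv h s a =
    visitSum x p K h s a (stageEnd H (visitStage x p h s a k)) (visitCount x p h s a k)
      (fun i s' => (obsV r ι N₀ x p h i s' - obsRef r ι N₀ x p h i s') ^ 2)

lemma visitCount_succ (h : Fin H) (s : S) (a : A) (k : ℕ) :
    visitCount x p h s a (k + 1) =
      visitCount x p h s a k + if Visit x p h s a k then 1 else 0 :=
  Nat.count_succ _ _

lemma visitSum_self (h : Fin H) (s : S) (a : A) (lo : ℕ) (g : ℕ → S → ℝ) :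
    visitSum x p K h s a lo lo g = 0 := by
  rw [visitSum, window_self, sum_empty]

variable {K}

lemma visitSum_succ {h : Fin H} {s : S} {a : A} {lo k : ℕ} (hv : Visit x p h s a k)
    (hk : k < K) (hlo : lo ≤ visitCount x p h s a k) (g : ℕ → S → ℝ) :
    visitSum x p K h s a lo (visitCount x p h s a k + 1) g =
      visitSum x p K h s a lo (visitCount x p h s a k) g + g k (x k h.succ) :=
  sum_window_succ (v := Visit x p h s a) (fun j => g j (x j h.succ)) hv hk hlo

/-- A visit in episode `k` that ends a stage. -/
def EndsStage (h : Fin H) (s : S) (a : A) (k : ℕ) : Prop :=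
  Visit x p h s a k ∧
    visitCount x p h s a k + 1 = stageEnd H (visitStage x p h s a k + 1)

lemma visitStage_succ_of_endsStage (hH : 1 ≤ H) {h : Fin H} {s : S} {a : A} {k : ℕ}
    (he : EndsStage x p h s a k) :
    visitStage x p h s a (k + 1) = visitStage x p h s a k + 1 := by
  have h1 := visitCount_succ x p h s a k
  rw [if_pos he.1, he.2] at h1
  rw [visitStage, stageIdx_eq_iff hH, h1]
  exact ⟨le_rfl, stageEnd_strictMono hH (Nat.lt_succ_self _)⟩

lemma visitStage_succ_of_not_endsStage (hH : 1 ≤ H) {h : Fin H} {s : S} {a : A} {k : ℕ}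
    (he : ¬ EndsStage x p h s a k) :
    visitStage x p h s a (k + 1) = visitStage x p h s a k := by
  have h1 := visitCount_succ x p h s a k
  have h2 := (stageIdx_eq_iff hH).1 (rfl : visitStage x p h s a k = _)
  simp only [EndsStage, not_and] at he
  rw [visitStage, stageIdx_eq_iff hH, h1]
  split_ifs at h1 ⊢ with hv
  · have := he hv
    omega
  · exact h2

lemma accumulatorInv (hH : 1 ≤ H) (h : Fin H) (s : S) (a : A) {k : ℕ} (hk : k ≤ K) :
    AccumulatorInv r ι N₀ x p K h s a k := by
  induction k with
  | zero =>
    have h0 : visitCount x p h s a 0 = 0 := rfl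
    have h1 : visitStage x p h s a 0 = 0 := by
      rw [visitStage, stageIdx_eq_iff hH, h0]
      exact ⟨le_rfl, stageEnd_strictMono hH Nat.zero_lt_one⟩
    constructor <;> simp only [h0, h1, stageEnd_zero, visitSum_self] <;> rfl
  | succ k ih =>
    have ih := ih (by omega)
    have hrow := rowEq_algState_succ r ι N₀ x p k h
    have hlo : stageEnd H (visitStage x p h s a k) ≤ visitCount x p h s a k :=
      stageEnd_stageIdx_le H _
    have hends : visitCount x p h s a k + 1 ∈ stageEnds H ↔
        visitCount x p h s a k + 1 = stageEnd H (visitStage x p h s a k + 1) :=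
      succ_mem_stageEnds_iff hH _
    by_cases hv : Visit x p h s a k
    · obtain ⟨hs, ha⟩ := (visit_iff x p).1 hv
      have hc : visitCount x p h s a (k + 1) = visitCount x p h s a k + 1 := by
        rw [visitCount_succ, if_pos hv]
      have hends' : (algState r ι N₀ x p k).n h s a + 1 ∈ stageEnds H ↔
          EndsStage x p h s a k := by
        rw [algState_n, hends, EndsStage, and_iff_right hv]
      by_cases he : EndsStage x p h s a k
      · have hst := visitStage_succ_of_endsStage x p hH he
        constructor
        · rw [hrow.nc]; simp only [stepUpdate]; rw [setQ_visit, if_pos hv, ← ha, ← hs,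
            if_pos (hends'.2 he), hst, hc, he.2, Nat.sub_self]
        · rw [hrow.muRef]; simp only [stepUpdate]; rw [setQ_visit, if_pos hv, ← ha, ← hs,
            hc, visitSum_succ x p hv hk (Nat.zero_le _), ih.muRef]; rfl
        · rw [hrow.sigRef]; simp only [stepUpdate]; rw [setQ_visit, if_pos hv, ← ha, ← hs,
            hc, visitSum_succ x p hv hk (Nat.zero_le _), ih.sigRef]; rfl
        · rw [hrow.muAdv]; simp only [stepUpdate]; rw [setQ_visit, if_pos hv, ← ha, ← hs,
            if_pos (hends'.2 he), hst, hc, he.2, visitSum_self]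
        · rw [hrow.vAdv]; simp only [stepUpdate]; rw [setQ_visit, if_pos hv, ← ha, ← hs,
            if_pos (hends'.2 he), hst, hc, he.2, visitSum_self]
        · rw [hrow.sigAdv]; simp only [stepUpdate]; rw [setQ_visit, if_pos hv, ← ha, ← hs,
            if_pos (hends'.2 he), hst, hc, he.2, visitSum_self]
      · have hst := visitStage_succ_of_not_endsStage x p hH he
        have he' := mt hends'.1 he
        constructor
        · rw [hrow.nc]; simp only [stepUpdate]; rw [setQ_visit, if_pos hv, ← ha, ← hs,
            if_neg he', hst, hc, ih.nc]
          omega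
        · rw [hrow.muRef]; simp only [stepUpdate]; rw [setQ_visit, if_pos hv, ← ha, ← hs,
            hc, visitSum_succ x p hv hk (Nat.zero_le _), ih.muRef]; rfl
        · rw [hrow.sigRef]; simp only [stepUpdate]; rw [setQ_visit, if_pos hv, ← ha, ← hs,
            hc, visitSum_succ x p hv hk (Nat.zero_le _), ih.sigRef]; rfl
        · rw [hrow.muAdv]; simp only [stepUpdate]; rw [setQ_visit, if_pos hv, ← ha, ← hs,
            if_neg he', hst, hc, visitSum_succ x p hv hk hlo, ih.muAdv]; rfl
        · rw [hrow.vAdv]; simp only [stepUpdate]; rw [setQ_visit, if_pos hv, ← ha, ← hs,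
            if_neg he', hst, hc, visitSum_succ x p hv hk hlo, ih.vAdv]; rfl
        · rw [hrow.sigAdv]; simp only [stepUpdate]; rw [setQ_visit, if_pos hv, ← ha, ← hs,
            if_neg he', hst, hc, visitSum_succ x p hv hk hlo, ih.sigAdv]; rfl
    · have hc : visitCount x p h s a (k + 1) = visitCount x p h s a k := by
        rw [visitCount_succ, if_neg hv]; rfl
      have hst : visitStage x p h s a (k + 1) = visitStage x p h s a k := by
        rw [visitStage, hc]; rfl
      constructor
      · rw [hrow.nc, hc, hst, ← ih.nc]; simp only [stepUpdate]; rw [setQ_visit, if_neg hv]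
      · rw [hrow.muRef, hc, ← ih.muRef]; simp only [stepUpdate]; rw [setQ_visit, if_neg hv]
      · rw [hrow.sigRef, hc, ← ih.sigRef]; simp only [stepUpdate]; rw [setQ_visit, if_neg hv]
      · rw [hrow.muAdv, hc, hst, ← ih.muAdv]; simp only [stepUpdate]; rw [setQ_visit, if_neg hv]
      · rw [hrow.vAdv, hc, hst, ← ih.vAdv]; simp only [stepUpdate]; rw [setQ_visit, if_neg hv]
      · rw [hrow.sigAdv, hc, hst, ← ih.sigAdv]; simp only [stepUpdate]; rw [setQ_visit, if_neg hv]

/-- At the end of a stage the estimate of `Q` becomes the minimum of the two new estimates and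
the old one. -/
lemma algState_Q_succ_of_endsStage (hH : 1 ≤ H) {h : Fin H} {s : S} {a : A} {k : ℕ} (hk : k < K)
    (he : EndsStage x p h s a k) :
    (algState r ι N₀ x p (k + 1)).Q h s a =
      min (hoeffdingEst r ι N₀ x p K h s a (visitStage x p h s a k))
        (min (advEst r ι N₀ x p K h s a (visitStage x p h s a k))
          ((algState r ι N₀ x p k).Q h s a)) := by
  have hv := he.1
  obtain ⟨hs, ha⟩ := (visit_iff x p).1 hv
  have inv := accumulatorInv r ι N₀ x p hH h s a hk.le
  have hlo : stageEnd H (visitStage x p h s a k) ≤ visitCount x p h s a k :=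
    stageEnd_stageIdx_le H _
  have hends : (algState r ι N₀ x p k).n h s a + 1 ∈ stageEnds H := by
    rw [algState_n]
    exact (succ_mem_stageEnds_iff hH _).2 he.2
  have hlen : (algState r ι N₀ x p k).nc h s a + 1 = stageLen H (visitStage x p h s a k) := by
    have h1 := he.2
    rw [stageEnd_succ] at h1
    rw [inv.nc]
    omega
  have hn : (algState r ι N₀ x p k).n h s a + 1 = stageEnd H (visitStage x p h s a k + 1) := by
    rw [algState_n, he.2]
  have e1 : (algState r ι N₀ x p k).muRef h s a + nextVal (algState r ι N₀ x p k).Vref h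
      (x k h.succ) = visitSum x p K h s a 0 (stageEnd H (visitStage x p h s a k + 1))
        (obsRef r ι N₀ x p h) := by
    rw [← he.2, visitSum_succ x p hv hk (Nat.zero_le _), inv.muRef]; rfl
  have e2 : (algState r ι N₀ x p k).sigRef h s a + nextVal (algState r ι N₀ x p k).Vref h
      (x k h.succ) ^ 2 = visitSum x p K h s a 0 (stageEnd H (visitStage x p h s a k + 1))
        (fun i s' => obsRef r ι N₀ x p h i s' ^ 2) := by
    rw [← he.2, visitSum_succ x p hv hk (Nat.zero_le _), inv.sigRef]; rfl
  have e3 : (algState r ι N₀ x p k).muAdv h s a + (nextVal (algState r ι N₀ x p k).V h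
      (x k h.succ) - nextVal (algState r ι N₀ x p k).Vref h (x k h.succ)) =
      visitSum x p K h s a (stageEnd H (visitStage x p h s a k))
        (stageEnd H (visitStage x p h s a k + 1))
        (fun i s' => obsV r ι N₀ x p h i s' - obsRef r ι N₀ x p h i s') := by
    rw [← he.2, visitSum_succ x p hv hk hlo, inv.muAdv]; rfl
  have e4 : (algState r ι N₀ x p k).vAdv h s a + nextVal (algState r ι N₀ x p k).V h
      (x k h.succ) = visitSum x p K h s a (stageEnd H (visitStage x p h s a k))
        (stageEnd H (visitStage x p h s a k + 1)) (obsV r ι N₀ x p h) := by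
    rw [← he.2, visitSum_succ x p hv hk hlo, inv.vAdv]; rfl
  have e5 : (algState r ι N₀ x p k).sigAdv h s a + (nextVal (algState r ι N₀ x p k).V h
      (x k h.succ) - nextVal (algState r ι N₀ x p k).Vref h (x k h.succ)) ^ 2 =
      visitSum x p K h s a (stageEnd H (visitStage x p h s a k))
        (stageEnd H (visitStage x p h s a k + 1))
        (fun i s' => (obsV r ι N₀ x p h i s' - obsRef r ι N₀ x p h i s') ^ 2) := by
    rw [← he.2, visitSum_succ x p hv hk hlo, inv.sigAdv]; rfl
  rw [(rowEq_algState_succ r ι N₀ x p k h).Q]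
  simp only [stepUpdate]
  rw [← ha, ← hs, if_pos hends, e1, e2, e3, e4, e5, hn, hlen]
  simp [setQ, hoeffdingEst, advEst]

lemma algState_Q_succ_of_not_endsStage (hH : 1 ≤ H) {h : Fin H} {s : S} {a : A} {k : ℕ}
    (he : ¬ EndsStage x p h s a k) :
    (algState r ι N₀ x p (k + 1)).Q h s a = (algState r ι N₀ x p k).Q h s a := by
  rw [(rowEq_algState_succ r ι N₀ x p k h).Q]
  simp only [stepUpdate]
  split_ifs with hends
  · rw [setQ_visit, if_neg]
    intro hv
    obtain ⟨hs, ha⟩ := (visit_iff x p).1 hv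
    rw [← ha, ← hs, algState_n] at hends
    exact he ⟨hv, (succ_mem_stageEnds_iff hH _).1 hends⟩
  · rfl

lemma algState_V (h : Fin H) (s : S) (k : ℕ) [Nonempty A] :
    (algState r ι N₀ x p k).V h s = ⨆ a, (algState r ι N₀ x p k).Q h s a := by
  induction k with
  | zero => simp [algState, AlgState.init]
  | succ k ih =>
    rw [(rowEq_algState_succ r ι N₀ x p k h).Q, (rowEq_algState_succ r ι N₀ x p k h).V]
    simp only [stepUpdate]
    split_ifs with hends
    · rw [setV_visit]
      split_ifs with hs
      · rw [hs]
      · rw [ih]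
        congr 1
        funext b
        simp [setQ, Ne.symm hs]
    · exact ih

/-- The number of visits to the state `s` at step `h` before episode `k`. -/
def stateCount (h : Fin H) (s : S) (k : ℕ) : ℕ := Nat.count (fun j => x j h.castSucc = s) k

lemma sum_visitCount (h : Fin H) (s : S) (k : ℕ) :
    ∑ a, visitCount x p h s a k = stateCount x h s k := by
  induction k with
  | zero => simp [visitCount, stateCount]
  | succ k ih =>
    simp only [visitCount_succ, sum_add_distrib, ih, stateCount, Nat.count_succ, Visit]
    congr 1
    by_cases hs : x k h.castSucc = s <;> simp [hs]

/-- The reference value is replaced by the value estimate at the visit with the number `N₀`. -/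
lemma algState_Vref_succ (h : Fin H) (s : S) (k : ℕ) :
    (algState r ι N₀ x p (k + 1)).Vref h s =
      if x k h.castSucc = s ∧ stateCount x h s k + 1 = N₀ then
        (algState r ι N₀ x p (k + 1)).V h s
      else (algState r ι N₀ x p k).Vref h s := by
  have hrow := rowEq_algState_succ r ι N₀ x p k h
  by_cases hs : x k h.castSucc = s
  · have hcount : ∑ b, (algState r ι N₀ x p (k + 1)).n h s b = stateCount x h s k + 1 := by
      simp only [algState_n]
      rw [sum_visitCount, stateCount, Nat.count_succ, if_pos hs, stateCount]
    rw [← hcount, hrow.V, hrow.n, hrow.Vref]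
    subst hs
    simp only [stepUpdate, true_and]
    split_ifs <;> simp [setV]
  · rw [if_neg (fun h => hs h.1), hrow.Vref]
    simp only [stepUpdate]
    split_ifs <;> simp only [setV_visit, if_neg hs]

lemma algState_Q_succ_le (hH : 1 ≤ H) (h : Fin H) (s : S) (a : A) (k : ℕ) :
    (algState r ι N₀ x p (k + 1)).Q h s a ≤ (algState r ι N₀ x p k).Q h s a := by
  by_cases he : EndsStage x p h s a k
  · rw [algState_Q_succ_of_endsStage r ι N₀ x p hH (Nat.lt_succ_self k) he]
    exact (min_le_right _ _).trans (min_le_right _ _)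
  · exact (algState_Q_succ_of_not_endsStage r ι N₀ x p hH he).le

lemma algState_V_antitone (hH : 1 ≤ H) [Nonempty A] (h : Fin H) (s : S) :
    Antitone fun k => (algState r ι N₀ x p k).V h s := by
  refine antitone_nat_of_succ_le fun k => ?_
  simp only [algState_V]
  exact ciSup_mono (Set.finite_range _).bddAbove fun a => algState_Q_succ_le r ι N₀ x p hH h s a k

lemma algState_V_le_Vref (hH : 1 ≤ H) [Nonempty A] (h : Fin H) (s : S) (k : ℕ) :
    (algState r ι N₀ x p k).V h s ≤ (algState r ι N₀ x p k).Vref h s := by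
  induction k with
  | zero => simp [algState, AlgState.init]
  | succ k ih =>
    rw [algState_Vref_succ]
    split_ifs
    · exact le_rfl
    · exact (algState_V_antitone r ι N₀ x p hH h s (Nat.le_succ k)).trans ih

lemma algState_Vref_antitone (hH : 1 ≤ H) [Nonempty A] (h : Fin H) (s : S) :
    Antitone fun k => (algState r ι N₀ x p k).Vref h s := by
  refine antitone_nat_of_succ_le fun k => ?_
  rw [algState_Vref_succ]
  split_ifs
  · exact (algState_V_antitone r ι N₀ x p hH h s (Nat.le_succ k)).trans
      (algState_V_le_Vref r ι N₀ x p hH h s k)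
  · exact le_rfl

lemma algState_Vref_le (hH : 1 ≤ H) [Nonempty A] (h : Fin H) (s : S) (k : ℕ) :
    (algState r ι N₀ x p k).Vref h s ≤ H :=
  (algState_Vref_antitone r ι N₀ x p hH h s (Nat.zero_le k)).trans_eq rfl

/-- Reference values do not change any more after `N₀` visits. -/
lemma algState_Vref_eq_of_settled {h : Fin H} {s : S} {k k' : ℕ} (hk : N₀ ≤ stateCount x h s k)
    (hkk' : k ≤ k') :
    (algState r ι N₀ x p k').Vref h s = (algState r ι N₀ x p k).Vref h s := by
  induction k', hkk' using Nat.le_induction with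
  | base => rfl
  | succ k' hkk' ih =>
    have hmono : stateCount x h s k ≤ stateCount x h s k' := Nat.count_monotone _ hkk'
    rw [algState_Vref_succ, if_neg (by omega), ih]

end Rows

/-! ### Concentration along a trajectory -/

/-- Truncation to `[-1, 1]`. The families of functions to which the concentration inequalities are
applied are bounded only on the event that the estimates are optimistic. Clamping makes them
bounded everywhere, as the exponential supermartingale requires, and has no effect on that
event. -/
def clamp (u : ℝ) : ℝ := max (-1) (min u 1)

lemma abs_clamp_le (u : ℝ) : |clamp u| ≤ 1 :=
  abs_le.2 ⟨le_max_left _ _, max_le (by norm_num) (min_le_right _ _)⟩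

lemma clamp_of_abs_le {u : ℝ} (hu : |u| ≤ 1) : clamp u = u := by
  rw [clamp, min_eq_left (abs_le.1 hu).2, max_eq_right (abs_le.1 hu).1]

lemma sqrt_add_le {u w : ℝ} (hu : 0 ≤ u) (hw : 0 ≤ w) : √(u + w) ≤ √u + √w := by
  refine Real.sqrt_le_iff.2 ⟨by positivity, ?_⟩
  nlinarith [Real.sq_sqrt hu, Real.sq_sqrt hw, mul_nonneg (Real.sqrt_nonneg u) (Real.sqrt_nonneg w)]

section Concentration

variable {S A : Type*} [Fintype S] [Fintype A] [DecidableEq S] [DecidableEq A] {H : ℕ}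
  (M : MDP S A H) (x : ℕ → Fin (H + 1) → S) (p : ℕ → Fin H → S → A) (K : ℕ)

/-- The sum of the conditional expectations that belongs to `visitSum`. -/
def expectSum (h : Fin H) (s : S) (a : A) (lo hi : ℕ) (g : ℕ → S → ℝ) : ℝ :=
  ∑ j ∈ window (Visit x p h s a) K lo hi, M.expect h s a (g j)

/-- The sum of the conditional variances that belongs to `visitSum`. -/
def cvarSum (h : Fin H) (s : S) (a : A) (lo hi : ℕ) (g : ℕ → S → ℝ) : ℝ :=
  ∑ j ∈ window (Visit x p h s a) K lo hi, M.cvar h s a (g j)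

/-- The visit sums of `g` deviate little from their expectations. For fixed `q` the bound comes
from an exponential supermartingale; optimizing over `q` gives bounds of Freedman's type. -/
def Concentrates (y : ℝ) (h : Fin H) (s : S) (a : A) (g : ℕ → S → ℝ) : Prop :=
  ∀ lo ≤ K, ∀ hi ≤ K, ∀ q : ℕ, 1 ≤ q → q ≤ K →
    |visitSum x p K h s a lo hi g - expectSum M x p K h s a lo hi g| ≤
      cvarSum M x p K h s a lo hi g / (2 * q) + 2 * q * y

variable {M x p K} {y : ℝ} {h : Fin H} {s : S} {a : A}

lemma card_window_le_K (v : ℕ → Prop) [DecidablePred v] (lo hi : ℕ) : #(window v K lo hi) ≤ K :=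
  (card_filter_le _ _).trans_eq (card_range K)

/-- The optimal `q` is `√(V / (4 y))`, where `V` is the sum of the variances; rounding it up to an
integer costs `2 y`. -/
lemma freedman_of_abs_le_one {g : ℕ → S → ℝ} (hc : Concentrates M x p K y h s a g)
    (hg : ∀ j t, |g j t| ≤ 1) (hy : 1 / 4 ≤ y) {lo hi : ℕ} (hlo : lo ≤ K) (hhi : hi ≤ K) :
    |visitSum x p K h s a lo hi g - expectSum M x p K h s a lo hi g| ≤
      2 * √(y * cvarSum M x p K h s a lo hi g) + 2 * y := by
  rcases Nat.eq_zero_or_pos K with rfl | hK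
  · simp only [visitSum, expectSum, window, range_zero, filter_empty, sum_empty, sub_zero,
      abs_zero]
    positivity
  set v := cvarSum M x p K h s a lo hi g with hv
  have hv0 : 0 ≤ v := sum_nonneg fun j _ => M.cvar_nonneg _ _ _ _
  have hvK : v ≤ K := by
    have h1 : v ≤ ∑ j ∈ window (Visit x p h s a) K lo hi, (1 : ℝ) :=
      sum_le_sum fun j _ => (M.cvar_le_expect_sq _ _ _ _).trans
        (M.expect_le _ _ _ fun t => (sq_le_one_iff_abs_le_one _).2 (hg j t))
    rw [sum_const, nsmul_eq_mul, mul_one] at h1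
    exact h1.trans (by exact_mod_cast card_window_le_K _ lo hi)
  have hK' : (1 : ℝ) ≤ K := by exact_mod_cast hK
  set r := √(v / (4 * y)) with hr
  have hr0 : 0 ≤ r := Real.sqrt_nonneg _
  have hy0 : 0 < y := by linarith
  have hr2 : r ^ 2 * (4 * y) = v := by
    rw [hr, Real.sq_sqrt (by positivity)]; field_simp
  have hrK : r ≤ K := by
    refine Real.sqrt_le_iff.2 ⟨by positivity, ?_⟩
    rw [div_le_iff₀ (by positivity)]
    nlinarith
  have hsqrt : √(y * v) = 2 * y * r := by
    rw [← hr2, Real.sqrt_eq_iff_mul_self_eq (by positivity) (by positivity)]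
    ring
  have hq1 : 1 ≤ max 1 ⌈r⌉₊ := le_max_left _ _
  have hqK : max 1 ⌈r⌉₊ ≤ K := max_le hK (Nat.ceil_le.2 hrK)
  have hqr : r ≤ ((max 1 ⌈r⌉₊ : ℕ) : ℝ) := (Nat.le_ceil r).trans (by exact_mod_cast le_max_right _ _)
  have hqr' : ((max 1 ⌈r⌉₊ : ℕ) : ℝ) ≤ r + 1 := by
    rw [Nat.cast_max]
    exact max_le (by simpa using hr0) (Nat.ceil_lt_add_one hr0).le
  refine (hc lo hlo hi hhi _ hq1 hqK).trans ?_
  set q : ℝ := ((max 1 ⌈r⌉₊ : ℕ) : ℝ)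
  have hq0 : 0 < q := Nat.cast_pos.2 hq1
  have h1 : v / (2 * q) ≤ 2 * y * r := by
    rw [div_le_iff₀ (by positivity), ← hr2]
    nlinarith [mul_le_mul_of_nonneg_left hqr (mul_nonneg hy0.le hr0)]
  have h2 : 2 * q * y ≤ 2 * (r + 1) * y := by gcongr
  rw [hsqrt]
  linarith

/-- Freedman's inequality with the variances bounded by `1`; if `y` exceeds the number `n` of the
visits, the trivial bound `2 n` of the deviation is smaller. -/
lemma hoeffding_of_abs_le_one {g : ℕ → S → ℝ} (hc : Concentrates M x p K y h s a g)
    (hg : ∀ j t, |g j t| ≤ 1) (hy : 1 / 4 ≤ y) {lo hi : ℕ} (hlo : lo ≤ K) (hhi : hi ≤ K) :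
    |visitSum x p K h s a lo hi g - expectSum M x p K h s a lo hi g| ≤
      4 * √(y * #(window (Visit x p h s a) K lo hi)) := by
  have hf := freedman_of_abs_le_one hc hg hy hlo hhi
  set n : ℝ := (#(window (Visit x p h s a) K lo hi) : ℝ) with hn
  have hn0 : 0 ≤ n := Nat.cast_nonneg _
  have hv : cvarSum M x p K h s a lo hi g ≤ n := by
    have h1 : cvarSum M x p K h s a lo hi g ≤
        ∑ j ∈ window (Visit x p h s a) K lo hi, (1 : ℝ) :=
      sum_le_sum fun j _ => (M.cvar_le_expect_sq _ _ _ _).trans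
        (M.expect_le _ _ _ fun t => (sq_le_one_iff_abs_le_one _).2 (hg j t))
    rwa [sum_const, nsmul_eq_mul, mul_one] at h1
  have h2 : √(y * cvarSum M x p K h s a lo hi g) ≤ √(y * n) :=
    Real.sqrt_le_sqrt (mul_le_mul_of_nonneg_left hv (by linarith))
  rcases le_total y n with hyn | hny
  · have : y ≤ √(y * n) := Real.le_sqrt_of_sq_le (by nlinarith)
    linarith
  · have h3 : n ≤ √(y * n) := Real.le_sqrt_of_sq_le (by nlinarith)
    have h4 : |visitSum x p K h s a lo hi g - expectSum M x p K h s a lo hi g| ≤ 2 * n := by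
      rw [visitSum, expectSum, ← sum_sub_distrib]
      refine (abs_sum_le_sum_abs _ _).trans ?_
      have : ∀ j ∈ window (Visit x p h s a) K lo hi,
          |g j (x j h.succ) - M.expect h s a (g j)| ≤ 2 := by
        intro j _
        have h5 := abs_le.1 (hg j (x j h.succ))
        have h6 := M.expect_le h s a fun t => (abs_le.1 (hg j t)).2
        have h7 := M.le_expect h s a fun t => (abs_le.1 (hg j t)).1
        exact abs_le.2 ⟨by linarith, by linarith⟩
      refine (sum_le_sum this).trans_eq ?_
      rw [sum_const, nsmul_eq_mul, hn, mul_comm]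
    have h5 : 0 ≤ √(y * n) := Real.sqrt_nonneg _
    linarith

section Scaled

variable {g : ℕ → S → ℝ} {B : ℝ} {lo hi : ℕ}

lemma eq_mul_clamp (hB : 0 < B)
    (hg : ∀ j ∈ window (Visit x p h s a) K lo hi, ∀ t, |g j t| ≤ B) :
    ∀ j ∈ window (Visit x p h s a) K lo hi, g j = fun t => B * clamp (g j t / B) := by
  intro j hj
  funext t
  rw [clamp_of_abs_le, mul_div_cancel₀ _ hB.ne']
  rw [abs_div, abs_of_pos hB]
  exact (div_le_one hB).2 (hg j hj t)

lemma visitSum_sub_expectSum_eq (hB : 0 < B)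
    (hg : ∀ j ∈ window (Visit x p h s a) K lo hi, ∀ t, |g j t| ≤ B) :
    visitSum x p K h s a lo hi g - expectSum M x p K h s a lo hi g =
      B * (visitSum x p K h s a lo hi (fun j t => clamp (g j t / B)) -
        expectSum M x p K h s a lo hi (fun j t => clamp (g j t / B))) := by
  simp only [visitSum, expectSum, ← sum_sub_distrib, mul_sum]
  refine sum_congr rfl fun j hj => ?_
  conv_lhs => rw [eq_mul_clamp hB hg j hj]
  rw [M.expect_mul_left]
  ring

/-- Freedman's inequality along the visits, for a family bounded by `B`. -/
lemma abs_visitSum_sub_le_freedman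
    (hc : Concentrates M x p K y h s a fun j t => clamp (g j t / B)) (hB : 0 < B)
    (hg : ∀ j ∈ window (Visit x p h s a) K lo hi, ∀ t, |g j t| ≤ B) (hy : 1 / 4 ≤ y)
    (hlo : lo ≤ K) (hhi : hi ≤ K) :
    |visitSum x p K h s a lo hi g - expectSum M x p K h s a lo hi g| ≤
      2 * √(y * cvarSum M x p K h s a lo hi g) + 2 * B * y := by
  have h1 := freedman_of_abs_le_one hc (fun j t => abs_clamp_le _) hy hlo hhi
  have h2 : cvarSum M x p K h s a lo hi g =
      B ^ 2 * cvarSum M x p K h s a lo hi (fun j t => clamp (g j t / B)) := by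
    simp only [cvarSum, mul_sum]
    refine sum_congr rfl fun j hj => ?_
    conv_lhs => rw [eq_mul_clamp hB hg j hj]
    rw [M.cvar_mul_left]
  rw [visitSum_sub_expectSum_eq hB hg, abs_mul, abs_of_pos hB, h2, mul_left_comm,
    Real.sqrt_mul (sq_nonneg B), Real.sqrt_sq hB.le]
  nlinarith [mul_le_mul_of_nonneg_left h1 hB.le]

/-- Hoeffding's inequality along the visits, for a family bounded by `B`. -/
lemma abs_visitSum_sub_le_hoeffding
    (hc : Concentrates M x p K y h s a fun j t => clamp (g j t / B)) (hB : 0 < B)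
    (hg : ∀ j ∈ window (Visit x p h s a) K lo hi, ∀ t, |g j t| ≤ B) (hy : 1 / 4 ≤ y)
    (hlo : lo ≤ K) (hhi : hi ≤ K) :
    |visitSum x p K h s a lo hi g - expectSum M x p K h s a lo hi g| ≤
      4 * B * √(y * #(window (Visit x p h s a) K lo hi)) := by
  have h1 := hoeffding_of_abs_le_one hc (fun j t => abs_clamp_le _) hy hlo hhi
  rw [visitSum_sub_expectSum_eq hB hg, abs_mul, abs_of_pos hB]
  nlinarith [mul_le_mul_of_nonneg_left h1 hB.le]

lemma visitSum_sq_le (n : ℝ) (hn : n = #(window (Visit x p h s a) K lo hi)) :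
    visitSum x p K h s a lo hi g ^ 2 ≤ n * visitSum x p K h s a lo hi (fun j t => g j t ^ 2) := by
  rw [hn]
  exact sq_sum_le_card_mul_sum_sq

lemma rpow_three_quarters {ι n : ℝ} (hι : 0 ≤ ι) (hn : 0 ≤ n) :
    ι ^ (3 / 4 : ℝ) / n ^ (3 / 4 : ℝ) = ((ι / n) ^ (1 / 4 : ℝ)) ^ 3 := by
  rw [← Real.div_rpow hι hn, ← Real.rpow_natCast, ← Real.rpow_mul (by positivity)]
  norm_num

lemma rpow_quarter_pow_four {z : ℝ} (hz : 0 ≤ z) : (z ^ (1 / 4 : ℝ)) ^ 4 = z := by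
  rw [← Real.rpow_natCast, ← Real.rpow_mul hz]
  norm_num

/-- The empirical Bernstein inequality: the deviation of an average is controlled by the bonus,
which contains the empirical variance. The empirical variance replaces the sum of the conditional
variances up to an error of order `B² √(n ι)`, which causes the term with the exponent `3 / 4`. -/
lemma abs_average_sub_le_bonus {ι : ℝ} (hι : 1 ≤ ι)
    (hc : Concentrates M x p K (ι / 4) h s a fun j t => clamp (g j t / B))
    (hc2 : Concentrates M x p K (ι / 4) h s a fun j t => clamp (g j t ^ 2 / B ^ 2)) (hB : 0 < B)
    (hg : ∀ j ∈ window (Visit x p h s a) K lo hi, ∀ t, |g j t| ≤ B)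
    (hlo : lo ≤ K) (hhi : hi ≤ K) {n : ℝ} (hn : n = #(window (Visit x p h s a) K lo hi))
    (hn0 : 0 < n) :
    |visitSum x p K h s a lo hi g / n - expectSum M x p K h s a lo hi g / n| ≤
      2 * √((visitSum x p K h s a lo hi (fun j t => g j t ^ 2) / n
          - (visitSum x p K h s a lo hi g / n) ^ 2) / n * ι)
        + 5 * (B * ι / n + B * ι ^ (3 / 4 : ℝ) / n ^ (3 / 4 : ℝ)) := by
  have hy : 1 / 4 ≤ ι / 4 := by linarith
  have hfre := abs_visitSum_sub_le_freedman hc hB hg hy hlo hhi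
  have hhoe := abs_visitSum_sub_le_hoeffding hc hB hg hy hlo hhi
  have hhoe2 := abs_visitSum_sub_le_hoeffding (g := fun j t => g j t ^ 2) hc2 (by positivity)
    (fun j hj t => by
      rw [abs_pow]; exact pow_le_pow_left₀ (abs_nonneg _) (hg j hj t) 2) hy hlo hhi
  have hvar : cvarSum M x p K h s a lo hi g =
      expectSum M x p K h s a lo hi (fun j t => g j t ^ 2) -
        ∑ j ∈ window (Visit x p h s a) K lo hi, M.expect h s a (g j) ^ 2 := by
    simp only [cvarSum, expectSum, MDP.cvar, sum_sub_distrib]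
  have hcs : expectSum M x p K h s a lo hi g ^ 2 ≤
      n * ∑ j ∈ window (Visit x p h s a) K lo hi, M.expect h s a (g j) ^ 2 := by
    rw [hn]; exact sq_sum_le_card_mul_sum_sq
  have hS : visitSum x p K h s a lo hi g ^ 2 ≤
      n * visitSum x p K h s a lo hi (fun j t => g j t ^ 2) := visitSum_sq_le n hn
  have hS1 : |visitSum x p K h s a lo hi g| ≤ n * B := by
    refine (abs_sum_le_sum_abs _ _).trans ?_
    refine (sum_le_sum fun j hj => hg j hj _).trans_eq ?_
    rw [sum_const, nsmul_eq_mul, hn]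
  rw [← hn] at hhoe hhoe2
  rw [← sub_div, abs_div, abs_of_pos hn0]
  set S1 := visitSum x p K h s a lo hi g
  set S2 := visitSum x p K h s a lo hi (fun j t => g j t ^ 2)
  set E1 := expectSum M x p K h s a lo hi g
  set E2 := expectSum M x p K h s a lo hi (fun j t => g j t ^ 2)
  set E3 := ∑ j ∈ window (Visit x p h s a) K lo hi, M.expect h s a (g j) ^ 2
  set v := cvarSum M x p K h s a lo hi g
  set z := (ι / n) ^ (1 / 4 : ℝ) with hz
  have hz0 : 0 ≤ z := Real.rpow_nonneg (by positivity) _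
  have hz4 : z ^ 4 = ι / n := rpow_quarter_pow_four (by positivity)
  have hιz : ι = n * z ^ 4 := by rw [hz4]; field_simp
  have hsq : √(ι / 4 * n) = n * z ^ 2 / 2 := by
    rw [Real.sqrt_eq_iff_mul_self_eq (by positivity) (by positivity), hιz]
    ring
  rw [hsq] at hhoe hhoe2
  set ν := S2 / n - (S1 / n) ^ 2 with hν
  have hν0 : 0 ≤ ν := by
    rw [hν, div_pow, sub_nonneg, div_le_div_iff₀ (by positivity) hn0]
    nlinarith
  have hv : v ≤ n * (ν + 6 * B ^ 2 * z ^ 2) := by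
    have h1 : E2 ≤ S2 + 4 * B ^ 2 * (n * z ^ 2 / 2) := by linarith [(abs_le.1 hhoe2).1]
    have h2 : S1 ^ 2 - E1 ^ 2 ≤ 4 * n ^ 2 * B ^ 2 * z ^ 2 := by
      have h3 : S1 ^ 2 - E1 ^ 2 ≤ 2 * |S1| * |S1 - E1| := by
        rw [mul_assoc, ← abs_mul]
        nlinarith [le_abs_self (S1 * (S1 - E1)), sq_nonneg (S1 - E1)]
      have h4 : |S1| * |S1 - E1| ≤ (n * B) * (4 * B * (n * z ^ 2 / 2)) :=
        mul_le_mul hS1 hhoe (abs_nonneg _) (by positivity)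
      nlinarith
    have h5 : n * v ≤ n * (n * (ν + 6 * B ^ 2 * z ^ 2)) := by
      have h6 : n * (n * ν) = n * S2 - S1 ^ 2 := by rw [hν]; field_simp
      have h7 : n * E2 ≤ n * (S2 + 4 * B ^ 2 * (n * z ^ 2 / 2)) :=
        mul_le_mul_of_nonneg_left h1 hn0.le
      rw [hvar]
      nlinarith
    exact le_of_mul_le_mul_left h5 hn0
  have hroot : 2 * √(ι / 4 * v) ≤ n * (√(ν * z ^ 4) + 5 / 2 * B * z ^ 3) := by
    have h1 : ι / 4 * v ≤ (n / 2) ^ 2 * (ν * z ^ 4 + (5 / 2 * B * z ^ 3) ^ 2) := by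
      rw [hιz]
      have h2 := mul_le_mul_of_nonneg_left hv (show 0 ≤ n * z ^ 4 / 4 by positivity)
      have h3 : 0 ≤ n ^ 2 * (B ^ 2 * z ^ 6) := by positivity
      nlinarith
    have h2 : √(ι / 4 * v) ≤ n / 2 * (√(ν * z ^ 4) + 5 / 2 * B * z ^ 3) := by
      refine (Real.sqrt_le_sqrt h1).trans ?_
      rw [Real.sqrt_mul (by positivity), Real.sqrt_sq (by positivity)]
      refine mul_le_mul_of_nonneg_left ?_ (by positivity)
      refine (sqrt_add_le (by positivity) (by positivity)).trans ?_
      rw [Real.sqrt_sq (by positivity)]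
    linarith
  have hbonus : ν / n * ι = ν * z ^ 4 := by rw [hz4]; ring
  rw [hbonus, mul_div_assoc, ← hz4, mul_div_assoc, rpow_three_quarters (by linarith) hn0.le, ← hz,
    div_le_iff₀ hn0]
  have h1 : 0 ≤ B * z ^ 3 := by positivity
  have h2 : 0 ≤ B * z ^ 4 := by positivity
  have h3 := Real.sqrt_nonneg (ν * z ^ 4)
  have h4 : 2 * B * (ι / 4) = n * (B * z ^ 4 / 2) := by rw [hιz]; ring
  calc |S1 - E1| ≤ n * (√(ν * z ^ 4) + 5 / 2 * B * z ^ 3) + n * (B * z ^ 4 / 2) := by linarith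
    _ = n * (√(ν * z ^ 4) + 5 / 2 * (B * z ^ 3) + B * z ^ 4 / 2) := by ring
    _ ≤ n * (2 * √(ν * z ^ 4) + 5 * (B * z ^ 4 + B * z ^ 3)) := by
      refine mul_le_mul_of_nonneg_left ?_ hn0.le
      linarith
    _ = _ := by ring

end Scaled

/-- For a quantity that decreases along the visits, the average over the last visits is at most
the average over all visits. -/
lemma average_window_le_of_antitone {v : ℕ → Prop} [DecidablePred v] {lo hi : ℕ}
    (hhi : hi ≤ Nat.count v K) (hlo : lo < hi) {F : ℕ → ℝ}
    (hF : ∀ i j, i ≤ j → j ∈ window v K lo hi → F j ≤ F i) :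
    (∑ j ∈ window v K lo hi, F j) / ((hi - lo : ℕ) : ℝ) ≤ (∑ j ∈ window v K 0 hi, F j) / hi := by
  have hsplit : window v K 0 hi = window v K 0 lo ∪ window v K lo hi := by
    ext j
    simp only [mem_window, mem_union]
    constructor
    · rintro ⟨h1, h2, h3, h4⟩
      rcases lt_or_ge (Nat.count v j) lo with h5 | h5
      · exact Or.inl ⟨h1, h2, h3, h5⟩
      · exact Or.inr ⟨h1, h2, h5, h4⟩
    · rintro (⟨h1, h2, h3, h4⟩ | ⟨h1, h2, h3, h4⟩)
      · exact ⟨h1, h2, h3, h4.trans hlo⟩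
      · exact ⟨h1, h2, Nat.zero_le _, h4⟩
  have hdisj : Disjoint (window v K 0 lo) (window v K lo hi) := by
    rw [disjoint_left]
    intro j h1 h2
    have := (mem_window.1 h1).2.2.2
    have := (mem_window.1 h2).2.2.1
    omega
  have hc1 : #(window v K 0 lo) = lo := card_window (by omega)
  have hc2 : #(window v K lo hi) = hi - lo := card_window hhi
  have key : (lo : ℝ) * ∑ j ∈ window v K lo hi, F j ≤
      ((hi - lo : ℕ) : ℝ) * ∑ i ∈ window v K 0 lo, F i := by
    calc (lo : ℝ) * ∑ j ∈ window v K lo hi, F j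
        = ∑ i ∈ window v K 0 lo, ∑ j ∈ window v K lo hi, F j := by
          rw [sum_const, hc1, nsmul_eq_mul]
      _ ≤ ∑ i ∈ window v K 0 lo, ∑ j ∈ window v K lo hi, F i := by
          refine sum_le_sum fun i hi' => sum_le_sum fun j hj => hF i j ?_ hj
          by_contra hlt
          have h1 := Nat.count_monotone v (not_le.1 hlt).le
          have h2 := (mem_window.1 hi').2.2.2
          have h3 := (mem_window.1 hj).2.2.1
          omega
      _ = _ := by simp only [sum_const, hc2, nsmul_eq_mul, mul_sum]
  have h0 : (0 : ℝ) < hi := by exact_mod_cast (Nat.zero_le lo).trans_lt hlo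
  have h0' : (0 : ℝ) < ((hi - lo : ℕ) : ℝ) := by exact_mod_cast Nat.sub_pos_of_lt hlo
  rw [div_le_div_iff₀ h0' h0, hsplit, sum_union hdisj]
  have : (hi : ℝ) = ((hi - lo : ℕ) : ℝ) + lo := by
    rw [Nat.cast_sub hlo.le]; ring
  rw [this]
  linarith

end Concentration

/-! ### Optimism -/

section Optimism

variable {S A : Type*} [Fintype S] [Fintype A] [DecidableEq S] [DecidableEq A] {H : ℕ}
  (M : MDP S A H) (ι : ℝ) (N₀ : ℕ) (x : ℕ → Fin (H + 1) → S) (p : ℕ → Fin H → S → A) (K : ℕ)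

/-- The reference value minus the optimal value of the next state, if that state has been visited
`N₀` times before episode `j`, and `0` otherwise. -/
def settledAdv (h : Fin H) (j : ℕ) (t : S) : ℝ :=
  nextVal (fun i s => if N₀ ≤ stateCount x i s j then
    (algState M.r ι N₀ x p j).Vref i s - M.Vstar i s else 0) h t

/-- The indicator that the next state has been visited less than `N₀` times before episode `j`. -/
def unsettled (h : Fin H) (j : ℕ) (t : S) : ℝ :=
  nextVal (fun i s => if N₀ ≤ stateCount x i s j then 0 else 1) h t

/-- The event that all the sums which the analysis needs are close to their conditional
expectations. With the deviation parameter `ι / 4` the resulting confidence widths match the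
bonuses of the algorithm. -/
structure ConcentrationEvent (β' : ℝ) : Prop where
  star : ∀ h s a, Concentrates M x p K (ι / 4) h s a fun _ t => clamp (M.Vstar (h + 1) t / H)
  starSq : ∀ h s a, Concentrates M x p K (ι / 4) h s a fun _ t =>
    clamp ((M.Vstar (h + 1) t - M.expect h s a (M.Vstar (h + 1))) ^ 2 / H ^ 2)
  ref : ∀ h s a, Concentrates M x p K (ι / 4) h s a fun j t =>
    clamp (obsRef M.r ι N₀ x p h j t / H)
  refSq : ∀ h s a, Concentrates M x p K (ι / 4) h s a fun j t =>
    clamp (obsRef M.r ι N₀ x p h j t ^ 2 / H ^ 2)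
  adv : ∀ h s a, Concentrates M x p K (ι / 4) h s a fun j t =>
    clamp ((obsV M.r ι N₀ x p h j t - obsRef M.r ι N₀ x p h j t) / H)
  advSq : ∀ h s a, Concentrates M x p K (ι / 4) h s a fun j t =>
    clamp ((obsV M.r ι N₀ x p h j t - obsRef M.r ι N₀ x p h j t) ^ 2 / H ^ 2)
  settled : ∀ h s a, Concentrates M x p K (ι / 4) h s a fun j t =>
    clamp (settledAdv M ι N₀ x p h j t / β')

variable {M ι N₀ x p K}

lemma nextVal_Vstar [Nonempty A] (h : Fin H) (t : S) :
    nextVal (fun i s => M.Vstar i s) h t = M.Vstar (h + 1) t := by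
  simp only [nextVal]
  split_ifs with hh
  · rfl
  · exact (M.Vstar_of_le (not_lt.1 hh) t).symm

lemma nextVal_mono {f g : Fin H → S → ℝ} (hfg : ∀ i s, f i s ≤ g i s) (h : Fin H) (t : S) :
    nextVal f h t ≤ nextVal g h t := by
  simp only [nextVal]
  split_ifs with hh
  · exact hfg _ _
  · exact le_rfl

variable (M ι N₀ x p) in
/-- All estimates at the start of episode `j` are optimistic. -/
def Optimistic (j : ℕ) : Prop := ∀ h s a, M.Qstar h s a ≤ (algState M.r ι N₀ x p j).Q h s a

lemma Optimistic.Vstar_le_V [Nonempty A] {j : ℕ} (ho : Optimistic M ι N₀ x p j) (h : Fin H)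
    (s : S) : M.Vstar h s ≤ (algState M.r ι N₀ x p j).V h s := by
  rw [algState_V, M.Vstar_eq_iSup_Qstar]
  exact ciSup_mono (Set.finite_range _).bddAbove fun a => ho h s a

lemma Optimistic.Vstar_le_obsV [Nonempty A] {j : ℕ} (ho : Optimistic M ι N₀ x p j) (h : Fin H)
    (t : S) : M.Vstar (h + 1) t ≤ obsV M.r ι N₀ x p h j t := by
  rw [← nextVal_Vstar]
  exact nextVal_mono ho.Vstar_le_V h t

lemma obsV_le_obsRef [Nonempty A] (h : Fin H) (j : ℕ) (t : S) :
    obsV M.r ι N₀ x p h j t ≤ obsRef M.r ι N₀ x p h j t :=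
  nextVal_mono (fun i s => algState_V_le_Vref M.r ι N₀ x p (by have := i.2; omega) i s j) h t

lemma obsRef_le [Nonempty A] (h : Fin H) (j : ℕ) (t : S) :
    obsRef M.r ι N₀ x p h j t ≤ H := by
  simp only [obsRef, nextVal]
  split_ifs
  · exact algState_Vref_le M.r ι N₀ x p (by have := h.2; omega) _ _ _
  · exact Nat.cast_nonneg _

lemma obsRef_antitone [Nonempty A] (h : Fin H) (t : S) :
    Antitone fun j => obsRef M.r ι N₀ x p h j t := fun i j hij =>
  nextVal_mono (fun k s => algState_Vref_antitone M.r ι N₀ x p (by have := k.2; omega) k s hij) h t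

lemma visitSum_sub (h : Fin H) (s : S) (a : A) (lo hi : ℕ) (f g : ℕ → S → ℝ) :
    visitSum x p K h s a lo hi (fun j t => f j t - g j t) =
      visitSum x p K h s a lo hi f - visitSum x p K h s a lo hi g := by
  simp only [visitSum, sum_sub_distrib]

lemma expectSum_sub (h : Fin H) (s : S) (a : A) (lo hi : ℕ) (f g : ℕ → S → ℝ) :
    expectSum M x p K h s a lo hi (fun j t => f j t - g j t) =
      expectSum M x p K h s a lo hi f - expectSum M x p K h s a lo hi g := by
  simp only [expectSum, M.expect_sub, sum_sub_distrib]

lemma visitCount_le (h : Fin H) (s : S) (a : A) (k : ℕ) : visitCount x p h s a k ≤ k :=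
  Nat.count_le _

lemma average_expectSum_const {h : Fin H} {s : S} {a : A} {lo hi : ℕ} {n : ℝ} (hn0 : 0 < n)
    (hn : n = #(window (Visit x p h s a) K lo hi)) (f : S → ℝ) :
    expectSum M x p K h s a lo hi (fun _ => f) / n = M.expect h s a f := by
  rw [expectSum, sum_const, nsmul_eq_mul, ← hn, mul_div_cancel_left₀ _ hn0.ne']

/-- The average form of Hoeffding's inequality along the visits. -/
lemma abs_average_sub_le_hoeffding {h : Fin H} {s : S} {a : A} {g : ℕ → S → ℝ} {B : ℝ}
    {lo hi : ℕ} (hι : 1 ≤ ι)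
    (hc : Concentrates M x p K (ι / 4) h s a fun j t => clamp (g j t / B)) (hB : 0 < B)
    (hg : ∀ j ∈ window (Visit x p h s a) K lo hi, ∀ t, |g j t| ≤ B)
    (hlo : lo ≤ K) (hhi : hi ≤ K) {n : ℝ} (hn : n = #(window (Visit x p h s a) K lo hi))
    (hn0 : 0 < n) :
    |visitSum x p K h s a lo hi g / n - expectSum M x p K h s a lo hi g / n| ≤
      2 * (B * √(ι / n)) := by
  have h1 := abs_visitSum_sub_le_hoeffding hc hB hg (by linarith) hlo hhi
  rw [← hn] at h1
  rw [← sub_div, abs_div, abs_of_pos hn0, div_le_iff₀ hn0]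
  refine h1.trans (le_of_eq ?_)
  have : √(ι / 4 * n) = √(ι / n) * (n / 2) := by
    rw [Real.sqrt_eq_iff_mul_self_eq (by positivity) (by positivity), eq_comm]
    have h2 := Real.mul_self_sqrt (show 0 ≤ ι / n by positivity)
    calc √(ι / n) * (n / 2) * (√(ι / n) * (n / 2))
        = √(ι / n) * √(ι / n) * (n / 2 * (n / 2)) := by ring
      _ = ι / 4 * n := by rw [h2]; field_simp; norm_num
  rw [this]
  ring

lemma hoeffdingBonus_eq {ι : ℝ} (H n : ℕ) :
    hoeffdingBonus H ι n = 2 * (H * √(ι / n)) := by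
  rw [hoeffdingBonus, show (H : ℝ) ^ 2 / n * ι = (H : ℝ) ^ 2 * (ι / n) by ring,
    Real.sqrt_mul (by positivity), Real.sqrt_sq (by positivity)]

section StageAverages

variable {h : Fin H} {s : S} {a : A} {j : ℕ}

lemma card_window_stage (hj : stageEnd H (j + 1) ≤ visitCount x p h s a K) :
    (stageLen H j : ℝ) =
      #(window (Visit x p h s a) K (stageEnd H j) (stageEnd H (j + 1))) := by
  rw [card_window hj, stageEnd_succ, Nat.add_sub_cancel_left]

lemma card_window_all (hj : stageEnd H (j + 1) ≤ visitCount x p h s a K) :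
    (stageEnd H (j + 1) : ℝ) = #(window (Visit x p h s a) K 0 (stageEnd H (j + 1))) := by
  rw [card_window hj, Nat.sub_zero]

lemma window_stage_subset (x : ℕ → Fin (H + 1) → S) (p : ℕ → Fin H → S → A) (K : ℕ) (h : Fin H)
    (s : S) (a : A) (j : ℕ) :
    window (Visit x p h s a) K (stageEnd H j) (stageEnd H (j + 1)) ⊆
      window (Visit x p h s a) K 0 (stageEnd H (j + 1)) :=
  window_subset K (Nat.zero_le _) le_rfl

lemma abs_average_Vstar_sub_le [Nonempty A] {β' : ℝ} (hι : 1 ≤ ι)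
    (hE : ConcentrationEvent M ι N₀ x p K β') {lo hi : ℕ} (hlo : lo ≤ K) (hhi : hi ≤ K) {n : ℝ}
    (hn : n = #(window (Visit x p h s a) K lo hi)) (hn0 : 0 < n) :
    |visitSum x p K h s a lo hi (fun _ t => M.Vstar (h + 1) t) / n
      - M.expect h s a (M.Vstar (h + 1))| ≤ 2 * (H * √(ι / n)) := by
  have hH0 : (0 : ℝ) < H := by exact_mod_cast (Nat.zero_le _).trans_lt h.2
  have := abs_average_sub_le_hoeffding hι (hE.star h s a) hH0
    (fun j _ t => by rw [abs_of_nonneg (M.Vstar_nonneg _ _)]; exact M.Vstar_le _ _) hlo hhi hn hn0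
  rwa [average_expectSum_const hn0 hn] at this

lemma Qstar_le_hoeffdingEst [Nonempty A] {β' : ℝ} (hι : 1 ≤ ι)
    (hE : ConcentrationEvent M ι N₀ x p K β')
    (hj : stageEnd H (j + 1) ≤ visitCount x p h s a K)
    (ho : ∀ i ∈ window (Visit x p h s a) K 0 (stageEnd H (j + 1)), Optimistic M ι N₀ x p i) :
    M.Qstar h s a ≤ hoeffdingEst M.r ι N₀ x p K h s a j := by
  have hH : 1 ≤ H := (Nat.zero_le _).trans_lt h.2
  have hK := hj.trans (visitCount_le h s a K)
  have hE0 := (stageEnd_strictMono hH).monotone (Nat.le_succ j)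
  have hn := card_window_stage hj
  have hn0 : (0 : ℝ) < stageLen H j := by exact_mod_cast stageLen_pos hH j
  have h1 := (abs_le.1 (abs_average_Vstar_sub_le hι hE (hE0.trans hK) hK hn hn0)).1
  have h2 : visitSum x p K h s a (stageEnd H j) (stageEnd H (j + 1))
        (fun _ t => M.Vstar (h + 1) t) ≤
      visitSum x p K h s a (stageEnd H j) (stageEnd H (j + 1)) (obsV M.r ι N₀ x p h) :=
    sum_le_sum fun i hi => (ho i (window_stage_subset x p K h s a j hi)).Vstar_le_obsV h _
  have h3 := div_le_div_of_nonneg_right h2 hn0.le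
  rw [hoeffdingEst, hoeffdingBonus_eq, MDP.Qstar]
  linarith

/-- The two empirical Bernstein bonuses cover the two deviations; moreover the average of all
past reference functions is at least their average over the last stage, since reference functions
decrease. -/
lemma Qstar_le_advEst [Nonempty A] {β' : ℝ} (hι : 1 ≤ ι)
    (hE : ConcentrationEvent M ι N₀ x p K β')
    (hj : stageEnd H (j + 1) ≤ visitCount x p h s a K)
    (ho : ∀ i ∈ window (Visit x p h s a) K 0 (stageEnd H (j + 1)), Optimistic M ι N₀ x p i) :
    M.Qstar h s a ≤ advEst M.r ι N₀ x p K h s a j := by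
  have hH : 1 ≤ H := (Nat.zero_le _).trans_lt h.2
  have hH0 : (0 : ℝ) < H := by exact_mod_cast hH
  have hK := hj.trans (visitCount_le h s a K)
  have hlt := stageEnd_strictMono hH (Nat.lt_succ_self j)
  have hn := card_window_stage hj
  have hn0 : (0 : ℝ) < stageLen H j := by exact_mod_cast stageLen_pos hH j
  have hm := card_window_all hj
  have hm0 : (0 : ℝ) < stageEnd H (j + 1) := by exact_mod_cast (Nat.zero_le _).trans_lt hlt
  have hb : ∀ i ∈ window (Visit x p h s a) K 0 (stageEnd H (j + 1)), ∀ t,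
      0 ≤ obsV M.r ι N₀ x p h i t ∧ obsV M.r ι N₀ x p h i t ≤ obsRef M.r ι N₀ x p h i t ∧
        obsRef M.r ι N₀ x p h i t ≤ H := fun i hi t =>
    ⟨(M.Vstar_nonneg _ _).trans ((ho i hi).Vstar_le_obsV h t), obsV_le_obsRef h i t,
      obsRef_le h i t⟩
  have h1 := abs_average_sub_le_bonus hι (hE.ref h s a) (hE.refSq h s a) hH0
    (fun i hi t => by
      obtain ⟨h1, h2, h3⟩ := hb i hi t
      exact abs_le.2 ⟨by linarith, h3⟩) (Nat.zero_le _) hK hm hm0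
  have h2 := abs_average_sub_le_bonus hι (hE.adv h s a) (hE.advSq h s a) hH0
    (fun i hi t => by
      obtain ⟨h1, h2, h3⟩ := hb i (window_stage_subset x p K h s a j hi) t
      exact abs_le.2 ⟨by linarith, by linarith⟩) (hlt.le.trans hK) hK hn hn0
  rw [expectSum_sub, sub_div] at h2
  have h3 : expectSum M x p K h s a (stageEnd H j) (stageEnd H (j + 1)) (obsRef M.r ι N₀ x p h)
      / stageLen H j ≤
      expectSum M x p K h s a 0 (stageEnd H (j + 1)) (obsRef M.r ι N₀ x p h)
      / stageEnd H (j + 1) := by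
    have := average_window_le_of_antitone (K := K) (v := Visit x p h s a) hj hlt
      (F := fun i => M.expect h s a (obsRef M.r ι N₀ x p h i))
      (fun i i' hii' _ => M.expect_mono h s a fun t => obsRef_antitone h t hii')
    rwa [show stageEnd H (j + 1) - stageEnd H j = stageLen H j by
      rw [stageEnd_succ, Nat.add_sub_cancel_left]] at this
  have h4 : M.expect h s a (M.Vstar (h + 1)) ≤
      expectSum M x p K h s a (stageEnd H j) (stageEnd H (j + 1)) (obsV M.r ι N₀ x p h)
        / stageLen H j := by
    rw [← average_expectSum_const hn0 hn (M := M) (M.Vstar (h + 1))]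
    refine div_le_div_of_nonneg_right (sum_le_sum fun i hi => ?_) hn0.le
    exact M.expect_mono h s a
      ((ho i (window_stage_subset x p K h s a j hi)).Vstar_le_obsV h)
  have h5 := (abs_le.1 h1).1
  have h6 := (abs_le.1 h2).1
  rw [advEst, advBonus, MDP.Qstar]
  linarith

end StageAverages

/-- On the concentration event all estimates are optimistic. -/
theorem optimistic [Nonempty A] {β' : ℝ} (hι : 1 ≤ ι)
    (hE : ConcentrationEvent M ι N₀ x p K β') {k : ℕ} (hk : k ≤ K) :
    Optimistic M ι N₀ x p k := by
  induction k using Nat.strong_induction_on with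
  | _ k ih =>
    intro h s a
    have hH : 1 ≤ H := (Nat.zero_le _).trans_lt h.2
    rcases k with _ | k
    · exact M.Qstar_le h s a
    · by_cases he : EndsStage x p h s a k
      · have hcount : stageEnd H (visitStage x p h s a k + 1) = visitCount x p h s a (k + 1) := by
          rw [visitCount_succ, if_pos he.1, he.2]
        have hj : stageEnd H (visitStage x p h s a k + 1) ≤ visitCount x p h s a K := by
          rw [hcount]; exact Nat.count_monotone _ hk
        have ho : ∀ i ∈ window (Visit x p h s a) K 0 (stageEnd H (visitStage x p h s a k + 1)),
            Optimistic M ι N₀ x p i := by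
          intro i hi
          have hik := lt_of_mem_window hi hcount.le
          exact ih i hik (hik.le.trans hk)
        rw [algState_Q_succ_of_endsStage M.r ι N₀ x p hH hk he]
        exact le_min (Qstar_le_hoeffdingEst hι hE hj ho)
          (le_min (Qstar_le_advEst hι hE hj ho) (ih k (Nat.lt_succ_self k) (by omega) h s a))
      · rw [algState_Q_succ_of_not_endsStage M.r ι N₀ x p hH he]
        exact ih k (Nat.lt_succ_self k) (by omega) h s a

/-- Once a stage has been completed, the estimate of `Q` is at most the two estimates from the
end of the last completed stage. -/
lemma algState_Q_le_est {h : Fin H} {s : S} {a : A} {k j : ℕ} (hk : k ≤ K)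
    (hj : visitStage x p h s a k = j + 1) :
    (algState M.r ι N₀ x p k).Q h s a ≤ hoeffdingEst M.r ι N₀ x p K h s a j ∧
      (algState M.r ι N₀ x p k).Q h s a ≤ advEst M.r ι N₀ x p K h s a j := by
  have hH : 1 ≤ H := (Nat.zero_le _).trans_lt h.2
  induction k with
  | zero =>
    have : visitStage x p h s a 0 = 0 := by
      rw [visitStage, stageIdx_eq_iff hH]
      exact ⟨le_rfl, stageEnd_strictMono hH Nat.zero_lt_one⟩
    omega
  | succ k ih =>
    by_cases he : EndsStage x p h s a k
    · have h1 := visitStage_succ_of_endsStage x p hH he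
      rw [algState_Q_succ_of_endsStage M.r ι N₀ x p hH hk he,
        show visitStage x p h s a k = j by omega]
      exact ⟨min_le_left _ _, (min_le_right _ _).trans (min_le_left _ _)⟩
    · rw [algState_Q_succ_of_not_endsStage M.r ι N₀ x p hH he]
      rw [visitStage_succ_of_not_endsStage x p hH he] at hj
      exact ih (by omega) hj

end Optimism

/-! ### Unrolling the recursion for the estimation errors -/

lemma one_add_inv_pow_le_three {H h : ℕ} (hh : h ≤ H) : (1 + 1 / (H : ℝ)) ^ h ≤ 3 := by
  rcases Nat.eq_zero_or_pos H with rfl | hH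
  · obtain rfl : h = 0 := by omega
    norm_num
  have hH0 : (0 : ℝ) < H := by exact_mod_cast hH
  calc (1 + 1 / (H : ℝ)) ^ h ≤ (1 + 1 / (H : ℝ)) ^ H :=
        pow_le_pow_right₀ (by have : 0 ≤ 1 / (H : ℝ) := by positivity
                              linarith) hh
    _ ≤ Real.exp (1 / H) ^ H := by
        refine pow_le_pow_left₀ (by positivity) ?_ _
        have := Real.add_one_le_exp (1 / (H : ℝ))
        linarith
    _ = Real.exp 1 := by rw [← Real.exp_nat_mul]; congr 1; field_simp
    _ ≤ 3 := by linarith [Real.exp_one_lt_d9]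

/-- Suppose that the errors `Z h k` are at most the cost `c h k` plus an average, with weights
`R h k`, of the errors at the next step. If every column sum of `R h` is at most `1 + 1 / H`,
weights stay below `(1 + 1 / H) ^ H ≤ 3` when the recursion is unrolled, and their total does not
grow. -/
theorem sum_mul_le_of_recursion {H K : ℕ} {R : Fin H → ℕ → ℕ → ℝ} {Z : ℕ → ℕ → ℝ}
    {c : Fin H → ℕ → ℝ} (hR0 : ∀ h k j, 0 ≤ R h k j)
    (hrow : ∀ h, ∀ k < K, ∑ j ∈ range K, R h k j ≤ 1)
    (hcol : ∀ h, ∀ j < K, ∑ k ∈ range K, R h k j ≤ 1 + 1 / H)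
    (hZ : ∀ h : Fin H, ∀ k < K, Z h k ≤ c h k + ∑ j ∈ range K, R h k j * Z (h + 1) j)
    (hZH : ∀ k, Z H k ≤ 0) {W Φ : ℝ}
    (hΦ : ∀ (h : Fin H) (w : ℕ → ℝ), (∀ k < K, 0 ≤ w k) → (∀ k < K, w k ≤ 3) →
      ∑ k ∈ range K, w k ≤ W → ∑ k ∈ range K, w k * c h k ≤ Φ)
    (h : Fin H) (w : ℕ → ℝ) (hw0 : ∀ k < K, 0 ≤ w k) (hw1 : ∀ k < K, w k ≤ 1)
    (hw : ∑ k ∈ range K, w k ≤ W) : ∑ k ∈ range K, w k * Z h k ≤ H * Φ := by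
  have hΦ0 : 0 ≤ Φ := by
    have hW : 0 ≤ W := (sum_nonneg fun k hk => hw0 k (mem_range.1 hk)).trans hw
    have := hΦ h (fun _ => 0) (fun _ _ => le_rfl) (fun _ _ => by norm_num) (by simpa using hW)
    simpa using this
  have key : ∀ n h : ℕ, h + n = H → ∀ w : ℕ → ℝ, (∀ k < K, 0 ≤ w k) →
      (∀ k < K, w k ≤ (1 + 1 / (H : ℝ)) ^ h) → ∑ k ∈ range K, w k ≤ W →
      ∑ k ∈ range K, w k * Z h k ≤ n * Φ := by
    intro n
    induction n with
    | zero =>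
      rintro h rfl w hw0 - -
      rw [Nat.cast_zero, zero_mul]
      exact sum_nonpos fun k hk =>
        mul_nonpos_of_nonneg_of_nonpos (hw0 k (mem_range.1 hk)) (hZH k)
    | succ n ih =>
      intro h hn w hw0 hw1 hw
      have hh : h < H := by omega
      have hw0' : ∀ j < K, 0 ≤ ∑ k ∈ range K, w k * R ⟨h, hh⟩ k j := fun j _ =>
        sum_nonneg fun k hk => mul_nonneg (hw0 k (mem_range.1 hk)) (hR0 _ _ _)
      have hw1' : ∀ j < K, ∑ k ∈ range K, w k * R ⟨h, hh⟩ k j ≤ (1 + 1 / (H : ℝ)) ^ (h + 1) := by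
        intro j hj
        calc ∑ k ∈ range K, w k * R ⟨h, hh⟩ k j
            ≤ ∑ k ∈ range K, (1 + 1 / (H : ℝ)) ^ h * R ⟨h, hh⟩ k j :=
              sum_le_sum fun k hk =>
                mul_le_mul_of_nonneg_right (hw1 k (mem_range.1 hk)) (hR0 _ _ _)
          _ = (1 + 1 / (H : ℝ)) ^ h * ∑ k ∈ range K, R ⟨h, hh⟩ k j := by rw [mul_sum]
          _ ≤ (1 + 1 / (H : ℝ)) ^ h * (1 + 1 / H) :=
              mul_le_mul_of_nonneg_left (hcol _ j hj) (by positivity)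
          _ = _ := (pow_succ _ _).symm
      have hw' : ∑ j ∈ range K, ∑ k ∈ range K, w k * R ⟨h, hh⟩ k j ≤ W := by
        rw [sum_comm]
        refine le_trans (sum_le_sum fun k hk => ?_) hw
        rw [← mul_sum]
        exact mul_le_of_le_one_right (hw0 k (mem_range.1 hk)) (hrow _ k (mem_range.1 hk))
      have h1 := ih (h + 1) (by omega) _ hw0' hw1' hw'
      have h2 := hΦ ⟨h, hh⟩ w hw0
        (fun k hk => (hw1 k hk).trans (one_add_inv_pow_le_three hh.le)) hw
      calc ∑ k ∈ range K, w k * Z h k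
          ≤ ∑ k ∈ range K, w k * (c ⟨h, hh⟩ k + ∑ j ∈ range K, R ⟨h, hh⟩ k j * Z (h + 1) j) :=
            sum_le_sum fun k hk => mul_le_mul_of_nonneg_left (hZ ⟨h, hh⟩ k (mem_range.1 hk))
              (hw0 k (mem_range.1 hk))
        _ = ∑ k ∈ range K, w k * c ⟨h, hh⟩ k +
              ∑ j ∈ range K, (∑ k ∈ range K, w k * R ⟨h, hh⟩ k j) * Z (h + 1) j := by
            simp only [mul_add, sum_add_distrib, mul_sum, sum_mul]
            congr 1
            rw [sum_comm]
            simp only [mul_assoc]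
        _ ≤ Φ + n * Φ := add_le_add h2 h1
        _ = ((n + 1 : ℕ) : ℝ) * Φ := by push_cast; ring
  refine (key (H - h) h (by have := h.2; omega) w hw0 (fun k hk => (hw1 k hk).trans ?_) hw).trans ?_
  · exact one_le_pow₀ (by have : 0 ≤ 1 / (H : ℝ) := by positivity
                          linarith)
  · exact mul_le_mul_of_nonneg_right (by exact_mod_cast Nat.sub_le _ _) hΦ0

/-! ### Sums over visit numbers -/

lemma sum_inv_succ_le {n K : ℕ} (hn : n ≤ K) :
    ∑ m ∈ range n, 1 / ((m : ℝ) + 1) ≤ 1 + Real.log K := by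
  calc ∑ m ∈ range n, 1 / ((m : ℝ) + 1) ≤ ∑ m ∈ range K, 1 / ((m : ℝ) + 1) :=
        sum_le_sum_of_subset_of_nonneg (range_subset_range.2 hn) fun _ _ _ => by positivity
    _ = harmonic K := by simp [harmonic]
    _ ≤ 1 + Real.log K := harmonic_le_one_add_log K

lemma sum_inv_sqrt_succ_le (n : ℕ) : ∑ m ∈ range n, 1 / √((m : ℝ) + 1) ≤ 2 * √n := by
  induction n with
  | zero => simp
  | succ n ih =>
    rw [sum_range_succ]
    push_cast
    have h1 : (0 : ℝ) < √((n : ℝ) + 1) := Real.sqrt_pos.2 (by positivity)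
    have h2 := Real.sq_sqrt (show (0 : ℝ) ≤ n + 1 by positivity)
    have h3 := Real.sq_sqrt (show (0 : ℝ) ≤ n by positivity)
    have h4 : 1 / √((n : ℝ) + 1) ≤ 2 * √((n : ℝ) + 1) - 2 * √n := by
      rw [div_le_iff₀ h1]
      nlinarith [sq_nonneg (√((n : ℝ) + 1) - √n)]
    linarith

/-- The terms `√(D / m)` that exceed `ε` are those with `m < D / ε²`. -/
lemma sum_max_sqrt_sub_le {D ε : ℝ} (hD : 0 ≤ D) (hε : 0 < ε) (n : ℕ) :
    ∑ m ∈ range n, max (√(D / ((m : ℝ) + 1)) - ε) 0 ≤ 2 * D / ε := by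
  set N := ⌊D / ε ^ 2⌋₊ with hN
  have hterm : ∀ m ∈ range n, max (√(D / ((m : ℝ) + 1)) - ε) 0 ≤
      if m < N then √D * (1 / √((m : ℝ) + 1)) else 0 := by
    intro m _
    split_ifs with hm
    · rw [mul_one_div, ← Real.sqrt_div hD]
      exact max_le (by linarith) (Real.sqrt_nonneg _)
    · refine max_le ?_ le_rfl
      have h1 : D / ε ^ 2 < (m : ℝ) + 1 := by
        have := Nat.lt_of_floor_lt (show ⌊D / ε ^ 2⌋₊ < m + 1 by omega)
        exact_mod_cast this
      have h2 : √(D / ((m : ℝ) + 1)) ≤ ε := by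
        refine Real.sqrt_le_iff.2 ⟨hε.le, ?_⟩
        rw [div_lt_iff₀ (by positivity)] at h1
        rw [div_le_iff₀ (by positivity)]
        linarith
      linarith
  refine (sum_le_sum hterm).trans ?_
  rw [← sum_filter]
  calc ∑ m ∈ (range n).filter (· < N), √D * (1 / √((m : ℝ) + 1))
      ≤ ∑ m ∈ range N, √D * (1 / √((m : ℝ) + 1)) := by
        refine sum_le_sum_of_subset_of_nonneg ?_ fun _ _ _ => by positivity
        intro m hm
        exact mem_range.2 (mem_filter.1 hm).2
    _ = √D * ∑ m ∈ range N, 1 / √((m : ℝ) + 1) := by rw [mul_sum]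
    _ ≤ √D * (2 * √(D / ε ^ 2)) := by
        refine mul_le_mul_of_nonneg_left ?_ (Real.sqrt_nonneg _)
        refine (sum_inv_sqrt_succ_le N).trans ?_
        exact mul_le_mul_of_nonneg_left
          (Real.sqrt_le_sqrt (Nat.floor_le (by positivity))) (by norm_num)
    _ = 2 * D / ε := by
        rw [Real.sqrt_div hD, Real.sqrt_sq hε.le]
        have := Real.mul_self_sqrt hD
        calc √D * (2 * (√D / ε)) = 2 * (√D * √D) / ε := by ring
          _ = _ := by rw [this]

section CostSums

variable {S A : Type*} [Fintype S] [Fintype A] [DecidableEq S] [DecidableEq A] {H : ℕ}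
  (M : MDP S A H) (ι : ℝ) (N₀ : ℕ) (x : ℕ → Fin (H + 1) → S) (p : ℕ → Fin H → S → A) (K : ℕ)

/-- The number of earlier visits to the state and action of episode `k` at step `h`. -/
def ownCount (h : Fin H) (k : ℕ) : ℕ :=
  visitCount x p h (x k h.castSucc) (p k h (x k h.castSucc)) k

/-- The number of earlier visits to the state and action of episode `k` at step `h` that led to a
state with less than `N₀` visits. -/
def ownUnsettled (h : Fin H) (k : ℕ) : ℝ :=
  ∑ j ∈ (range k).filter (Visit x p h (x k h.castSucc) (p k h (x k h.castSucc))),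
    unsettled N₀ x h j (x j h.succ)

lemma sum_visit_eq {β : Type*} [AddCommMonoid β] (h : Fin H) (k : ℕ) (F : S → A → β) :
    ∑ s, ∑ a, (if Visit x p h s a k then F s a else 0) =
      F (x k h.castSucc) (p k h (x k h.castSucc)) := by
  rw [sum_eq_single (x k h.castSucc), sum_eq_single (p k h (x k h.castSucc))]
  · simp [Visit]
  · intro a _ ha
    rw [if_neg]
    simp [Visit, ha.symm]
  · simp
  · intro s _ hs
    refine sum_eq_zero fun a _ => if_neg ?_
    simp [Visit, hs.symm]
  · simp

/-- The visits of one triple have the numbers `0, 1, 2, …`. -/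
lemma sum_ownCount_le (h : Fin H) {F : ℕ → ℝ} {G : ℝ} (hF : ∀ n ≤ K, ∑ m ∈ range n, F m ≤ G) :
    ∑ k ∈ range K, F (ownCount x p h k) ≤ Fintype.card S * Fintype.card A * G := by
  calc ∑ k ∈ range K, F (ownCount x p h k)
      = ∑ k ∈ range K, ∑ s, ∑ a,
          (if Visit x p h s a k then F (visitCount x p h s a k) else 0) :=
        sum_congr rfl fun k _ => (sum_visit_eq x p h k fun s a => F (visitCount x p h s a k)).symm
    _ = ∑ s, ∑ a, ∑ k ∈ range K,
          (if Visit x p h s a k then F (visitCount x p h s a k) else 0) := by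
        rw [sum_comm]
        exact sum_congr rfl fun s _ => sum_comm
    _ ≤ ∑ s : S, ∑ a : A, G := by
        refine sum_le_sum fun s _ => sum_le_sum fun a _ => ?_
        rw [← sum_filter]
        exact (sum_filter_count F K).trans_le (hF _ (Nat.count_le _))
    _ = _ := by simp only [sum_const, card_univ, nsmul_eq_mul]; ring

lemma sum_stateCount_lt_le (i : Fin H) :
    ∑ j ∈ range K, (if N₀ ≤ stateCount x i (x j i.castSucc) j then (0 : ℝ) else 1) ≤
      Fintype.card S * N₀ := by
  have hterm : ∀ j, (if N₀ ≤ stateCount x i (x j i.castSucc) j then (0 : ℝ) else 1) =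
      ∑ s, if x j i.castSucc = s then (if N₀ ≤ stateCount x i s j then (0 : ℝ) else 1) else 0 := by
    intro j
    rw [sum_ite_eq]
    simp
  simp only [hterm]
  rw [sum_comm]
  calc _ ≤ ∑ s : S, (N₀ : ℝ) := by
        refine sum_le_sum fun s _ => ?_
        rw [← sum_filter]
        refine (sum_filter_count (v := fun j => x j i.castSucc = s)
          (fun m => if N₀ ≤ m then (0 : ℝ) else 1) K).trans_le ?_
        have : ∀ n, ∑ m ∈ range n, (if N₀ ≤ m then (0 : ℝ) else 1) ≤ N₀ := by
          intro n
          have h1 : ∀ m ∈ range n, (if N₀ ≤ m then (0 : ℝ) else 1) =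
              if m < N₀ then 1 else 0 := by
            intro m _
            by_cases hm : m < N₀
            · rw [if_neg (by omega), if_pos hm]
            · rw [if_pos (by omega), if_neg hm]
          rw [sum_congr rfl h1, ← sum_filter, sum_const, nsmul_eq_mul, mul_one]
          have h2 : (range n).filter (· < N₀) ⊆ range N₀ := fun m hm =>
            mem_range.2 (mem_filter.1 hm).2
          exact_mod_cast (card_le_card h2).trans_eq (card_range N₀)
        exact this _
    _ = _ := by simp

lemma unsettled_nonneg (h : Fin H) (j : ℕ) (t : S) : 0 ≤ unsettled N₀ x h j t := by
  simp only [unsettled, nextVal]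
  split_ifs <;> norm_num

lemma sum_unsettled_le (h : Fin H) :
    ∑ j ∈ range K, unsettled N₀ x h j (x j h.succ) ≤ Fintype.card S * N₀ := by
  by_cases hh : (h : ℕ) + 1 < H
  · refine le_trans (le_of_eq ?_) (sum_stateCount_lt_le N₀ x K ⟨h + 1, hh⟩)
    refine sum_congr rfl fun j _ => ?_
    simp only [unsettled, nextVal, dif_pos hh]
    rfl
  · simp only [unsettled, nextVal, dif_neg hh, sum_const_zero]
    positivity

/-- The pairs of visits are summed in the other order: each of the at most `S N₀` visits to an
unsettled next state enters the later visits of its triple, with weights that sum to a logarithm. -/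
lemma sum_ownUnsettled_le (h : Fin H) :
    ∑ k ∈ range K, ownUnsettled N₀ x p h k * (1 / ((ownCount x p h k : ℝ) + 1)) ≤
      Fintype.card S * N₀ * (1 + Real.log K) := by
  have hsym : ∀ j k, Visit x p h (x k h.castSucc) (p k h (x k h.castSucc)) j ↔
      Visit x p h (x j h.castSucc) (p j h (x j h.castSucc)) k := by
    intro j k
    rw [visit_iff, visit_iff]
    constructor <;> rintro ⟨h1, h2⟩ <;> exact ⟨h1.symm, h2.symm⟩
  have hlog : 0 ≤ 1 + Real.log K := by
    rcases Nat.eq_zero_or_pos K with rfl | hK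
    · simp
    · have := Real.log_nonneg (show (1 : ℝ) ≤ K by exact_mod_cast hK)
      linarith
  calc ∑ k ∈ range K, ownUnsettled N₀ x p h k * (1 / ((ownCount x p h k : ℝ) + 1))
      ≤ ∑ k ∈ range K, ∑ j ∈ range K,
          (if Visit x p h (x j h.castSucc) (p j h (x j h.castSucc)) k then
            unsettled N₀ x h j (x j h.succ) * (1 / ((visitCount x p h (x j h.castSucc)
              (p j h (x j h.castSucc)) k : ℝ) + 1)) else 0) := by
        refine sum_le_sum fun k hk => ?_
        rw [ownUnsettled, sum_mul, ← sum_filter]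
        refine (sum_le_sum_of_subset_of_nonneg (t := (range K).filter
          (Visit x p h (x k h.castSucc) (p k h (x k h.castSucc)))) ?_ ?_).trans (le_of_eq ?_)
        · exact filter_subset_filter _ (range_subset_range.2 (mem_range.1 hk).le)
        · intro j _ _
          exact mul_nonneg (unsettled_nonneg N₀ x h j _) (by positivity)
        · refine sum_congr (filter_congr fun j _ => hsym j k) fun j hj => ?_
          have hv := (visit_iff x p).1 (mem_filter.1 hj).2
          rw [ownCount, hv.2, hv.1]
    _ = ∑ j ∈ range K, unsettled N₀ x h j (x j h.succ) * ∑ k ∈ (range K).filter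
          (Visit x p h (x j h.castSucc) (p j h (x j h.castSucc))),
          (1 / ((visitCount x p h (x j h.castSucc) (p j h (x j h.castSucc)) k : ℝ) + 1)) := by
        rw [sum_comm]
        refine sum_congr rfl fun j _ => ?_
        rw [← sum_filter, mul_sum]
    _ ≤ ∑ j ∈ range K, unsettled N₀ x h j (x j h.succ) * (1 + Real.log K) := by
        refine sum_le_sum fun j _ => mul_le_mul_of_nonneg_left ?_ (unsettled_nonneg N₀ x h j _)
        exact (sum_filter_count (fun m => 1 / ((m : ℝ) + 1)) K).trans_le
          (sum_inv_succ_le (Nat.count_le _))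
    _ ≤ _ := by
        rw [← sum_mul]
        exact mul_le_mul_of_nonneg_right (sum_unsettled_le N₀ x K h) hlog

/-- The cost of episode `k` at step `h`, before the errors of the next step are added: the first
stage costs `H`; afterwards there is a leading term `√(D / m)` and lower-order terms, where `m` is
the number of the visit (from `1`). -/
def localCost (D G L : ℝ) (h : Fin H) (k : ℕ) : ℝ :=
  (if ownCount x p h k < H then (H : ℝ) else 0) + √(D / ((ownCount x p h k : ℝ) + 1))
    + G * (1 / ((ownCount x p h k : ℝ) + 1))
    + L * (ownUnsettled N₀ x p h k * (1 / ((ownCount x p h k : ℝ) + 1)))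

lemma ownUnsettled_nonneg (h : Fin H) (k : ℕ) : 0 ≤ ownUnsettled N₀ x p h k :=
  sum_nonneg fun j _ => unsettled_nonneg N₀ x h j _

/-- The total weighted cost. In place of a bound by `√(D W)` for the leading term it contains a
free parameter `ε`, to be chosen below the gaps. -/
lemma sum_mul_localCost_le {D G L ε W : ℝ} (hD : 0 ≤ D) (hG : 0 ≤ G) (hL : 0 ≤ L) (hε : 0 < ε)
    (h : Fin H) {w : ℕ → ℝ} (hw0 : ∀ k < K, 0 ≤ w k) (hw3 : ∀ k < K, w k ≤ 3)
    (hw : ∑ k ∈ range K, w k ≤ W) :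
    ∑ k ∈ range K, w k * localCost N₀ x p D G L h k ≤
      ε * W + 3 * (Fintype.card S * Fintype.card A * ((H : ℝ) ^ 2 + 2 * D / ε
        + G * (1 + Real.log K)) + L * (Fintype.card S * N₀ * (1 + Real.log K))) := by
  have hterm : ∀ k ∈ range K, w k * localCost N₀ x p D G L h k ≤ ε * w k + 3 *
      (((if ownCount x p h k < H then (H : ℝ) else 0)
        + max (√(D / ((ownCount x p h k : ℝ) + 1)) - ε) 0
        + G * (1 / ((ownCount x p h k : ℝ) + 1)))
        + L * (ownUnsettled N₀ x p h k * (1 / ((ownCount x p h k : ℝ) + 1)))) := by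
    intro k hk
    have h0 := hw0 k (mem_range.1 hk)
    have h3 := hw3 k (mem_range.1 hk)
    have hu := ownUnsettled_nonneg N₀ x p h k
    have h1 : localCost N₀ x p D G L h k ≤ ε +
        (((if ownCount x p h k < H then (H : ℝ) else 0)
        + max (√(D / ((ownCount x p h k : ℝ) + 1)) - ε) 0
        + G * (1 / ((ownCount x p h k : ℝ) + 1)))
        + L * (ownUnsettled N₀ x p h k * (1 / ((ownCount x p h k : ℝ) + 1)))) := by
      have := le_max_left (√(D / ((ownCount x p h k : ℝ) + 1)) - ε) 0
      rw [localCost]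
      linarith
    refine (mul_le_mul_of_nonneg_left h1 h0).trans ?_
    rw [mul_add, mul_comm (w k) ε]
    refine add_le_add le_rfl (mul_le_mul_of_nonneg_right h3 ?_)
    have : 0 ≤ (if ownCount x p h k < H then (H : ℝ) else 0) := by split_ifs <;> positivity
    positivity
  refine (sum_le_sum hterm).trans ?_
  rw [sum_add_distrib, ← mul_sum, ← mul_sum]
  refine add_le_add (mul_le_mul_of_nonneg_left hw hε.le)
    (mul_le_mul_of_nonneg_left ?_ (by norm_num))
  rw [sum_add_distrib, ← mul_sum]
  refine add_le_add ?_ (mul_le_mul_of_nonneg_left (sum_ownUnsettled_le N₀ x p K h) hL)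
  refine sum_ownCount_le x p K h (F := fun m => (if m < H then (H : ℝ) else 0)
    + max (√(D / ((m : ℝ) + 1)) - ε) 0 + G * (1 / ((m : ℝ) + 1))) fun n hn => ?_
  rw [sum_add_distrib, sum_add_distrib, ← mul_sum]
  refine add_le_add (add_le_add ?_ (sum_max_sqrt_sub_le hD hε n))
    (mul_le_mul_of_nonneg_left (sum_inv_succ_le hn) hG)
  rw [← sum_filter, sum_const, nsmul_eq_mul, sq]
  refine mul_le_mul_of_nonneg_right ?_ (Nat.cast_nonneg _)
  have h2 : (range n).filter (· < H) ⊆ range H := fun m hm => mem_range.2 (mem_filter.1 hm).2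
  exact_mod_cast (card_le_card h2).trans_eq (card_range H)

/-- The weight of episode `j` in the average over the last completed stage that episode `k`
uses at step `h`. -/
def stageWeight (h : Fin H) (k j : ℕ) : ℝ :=
  if Visit x p h (x k h.castSucc) (p k h (x k h.castSucc)) j ∧
      visitStage x p h (x k h.castSucc) (p k h (x k h.castSucc)) k =
        visitStage x p h (x k h.castSucc) (p k h (x k h.castSucc)) j + 1 then
    1 / (stageLen H (visitStage x p h (x k h.castSucc) (p k h (x k h.castSucc)) j) : ℝ)
  else 0

lemma stageWeight_nonneg (h : Fin H) (k j : ℕ) : 0 ≤ stageWeight x p h k j := by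
  rw [stageWeight]; split_ifs <;> positivity

variable {x p K}

lemma mem_window_stage_iff {h : Fin H} {s : S} {a : A} {i j : ℕ} :
    j ∈ window (Visit x p h s a) K (stageEnd H i) (stageEnd H (i + 1)) ↔
      j ∈ range K ∧ Visit x p h s a j ∧ visitStage x p h s a j = i := by
  have hH : 1 ≤ H := (Nat.zero_le _).trans_lt h.2
  rw [mem_window, visitStage, stageIdx_eq_iff hH, mem_range]
  rfl

lemma sum_stageWeight_mul {h : Fin H} {k i : ℕ}
    (hi : visitStage x p h (x k h.castSucc) (p k h (x k h.castSucc)) k = i + 1) (f : ℕ → ℝ) :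
    ∑ j ∈ range K, stageWeight x p h k j * f j =
      (∑ j ∈ window (Visit x p h (x k h.castSucc) (p k h (x k h.castSucc))) K
        (stageEnd H i) (stageEnd H (i + 1)), f j) / stageLen H i := by
  have : window (Visit x p h (x k h.castSucc) (p k h (x k h.castSucc))) K
        (stageEnd H i) (stageEnd H (i + 1)) = (range K).filter fun j =>
      Visit x p h (x k h.castSucc) (p k h (x k h.castSucc)) j ∧
        visitStage x p h (x k h.castSucc) (p k h (x k h.castSucc)) j = i := by
    ext j
    rw [mem_window_stage_iff, mem_filter]
  rw [this, sum_filter, sum_div]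
  refine sum_congr rfl fun j _ => ?_
  rw [stageWeight, hi]
  by_cases hv : Visit x p h (x k h.castSucc) (p k h (x k h.castSucc)) j ∧
      visitStage x p h (x k h.castSucc) (p k h (x k h.castSucc)) j = i
  · rw [if_pos hv, if_pos ⟨hv.1, by omega⟩, hv.2]
    ring
  · rw [if_neg hv, if_neg]
    · ring
    · rintro ⟨h1, h2⟩
      exact hv ⟨h1, by omega⟩

lemma stageWeight_of_stage_zero {h : Fin H} {k : ℕ}
    (hi : visitStage x p h (x k h.castSucc) (p k h (x k h.castSucc)) k = 0) (j : ℕ) :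
    stageWeight x p h k j = 0 := by
  rw [stageWeight, if_neg]
  rintro ⟨-, h2⟩
  omega

lemma sum_stageWeight_row_le (h : Fin H) (k : ℕ) :
    ∑ j ∈ range K, stageWeight x p h k j ≤ 1 := by
  have hH : 1 ≤ H := (Nat.zero_le _).trans_lt h.2
  rcases hi : visitStage x p h (x k h.castSucc) (p k h (x k h.castSucc)) k with _ | i
  · rw [sum_eq_zero fun j _ => stageWeight_of_stage_zero hi j]
    norm_num
  · have h1 := sum_stageWeight_mul (K := K) hi fun _ => 1
    simp only [mul_one] at h1
    rw [h1, sum_const, nsmul_eq_mul, mul_one]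
    refine div_le_one_of_le₀ ?_ (Nat.cast_nonneg _)
    have h2 := card_window_le (v := Visit x p h (x k h.castSucc) (p k h (x k h.castSucc))) K
      (stageEnd H i) (stageEnd H (i + 1))
    rw [stageEnd_succ, Nat.add_sub_cancel_left] at h2
    rw [stageEnd_succ]
    exact_mod_cast h2

/-- Episode `j` is used only by the visits of the stage after its own, and this stage is longer by a
factor of at most `1 + 1 / H`. -/
lemma sum_stageWeight_col_le (h : Fin H) (j : ℕ) :
    ∑ k ∈ range K, stageWeight x p h k j ≤ 1 + 1 / H := by
  have hH : 1 ≤ H := (Nat.zero_le _).trans_lt h.2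
  set s := x j h.castSucc with hs
  set a := p j h s with ha
  set i := visitStage x p h s a j with hi
  have hlen : (0 : ℝ) < stageLen H i := by exact_mod_cast stageLen_pos hH i
  have hterm : ∀ k ∈ range K, stageWeight x p h k j ≤
      if k ∈ window (Visit x p h s a) K (stageEnd H (i + 1)) (stageEnd H (i + 1 + 1)) then
        1 / (stageLen H i : ℝ) else 0 := by
    intro k hk
    rw [stageWeight]
    split_ifs with h1 h2 h2
    · obtain ⟨h3, h4⟩ := (visit_iff x p).1 h1.1
      rw [h4, h3]
    · exfalso
      apply h2
      obtain ⟨hv, hstage⟩ := h1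
      obtain ⟨h3, h4⟩ := (visit_iff x p).1 hv
      rw [h4, h3] at hstage
      rw [mem_window_stage_iff]
      exact ⟨hk, (visit_iff x p).2 ⟨h3.symm, h4.symm⟩, hstage⟩
    · positivity
    · exact le_rfl
  refine (sum_le_sum hterm).trans ?_
  rw [← sum_filter, sum_const, nsmul_eq_mul, mul_one_div, div_le_iff₀ hlen]
  refine le_trans ?_ (stageLen_succ_le hH i)
  have h2 := card_window_le (v := Visit x p h s a) K
      (stageEnd H (i + 1)) (stageEnd H (i + 1 + 1))
  rw [stageEnd_succ H (i + 1), Nat.add_sub_cancel_left, ← stageEnd_succ H (i + 1)] at h2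
  refine le_trans ?_ (Nat.cast_le.2 h2)
  refine Nat.cast_le.2 (card_le_card fun k hk => (mem_filter.1 hk).2)

variable (x p)

/-- The error of the estimate of `Q` at the state and action of episode `k` at step `h`, which is
`0` after the last step. -/
def ownError (h k : ℕ) : ℝ :=
  if hh : h < H then
    (algState M.r ι N₀ x p k).Q ⟨h, hh⟩ (x k (Fin.castSucc ⟨h, hh⟩))
        (p k ⟨h, hh⟩ (x k (Fin.castSucc ⟨h, hh⟩)))
      - M.Qstar ⟨h, hh⟩ (x k (Fin.castSucc ⟨h, hh⟩)) (p k ⟨h, hh⟩ (x k (Fin.castSucc ⟨h, hh⟩)))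
  else 0

variable {M ι N₀ x p}

lemma ownError_fin (h : Fin H) (k : ℕ) :
    ownError M ι N₀ x p h k =
      (algState M.r ι N₀ x p k).Q h (x k h.castSucc) (p k h (x k h.castSucc))
      - M.Qstar h (x k h.castSucc) (p k h (x k h.castSucc)) := by
  rw [ownError, dif_pos h.2]

variable (M ι N₀ x p K) in
/-- The policies before episode `K` are greedy with respect to the current estimates. -/
def Greedy : Prop := ∀ k < K, ∀ (h : Fin H) (s : S) (a : A),
  (algState M.r ι N₀ x p k).Q h s a ≤ (algState M.r ι N₀ x p k).Q h s (p k h s)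

lemma V_sub_Vstar_le_ownError [Nonempty A] (hg : Greedy M ι N₀ x p K) (h : Fin H) {k : ℕ}
    (hk : k < K) :
    (algState M.r ι N₀ x p k).V h (x k h.castSucc) - M.Vstar h (x k h.castSucc) ≤
      ownError M ι N₀ x p h k := by
  rw [ownError_fin, algState_V]
  exact sub_le_sub (ciSup_le fun a => hg k hk h _ a) (M.Qstar_le_Vstar _ _ _)

lemma obsV_sub_Vstar_le_ownError [Nonempty A] (hg : Greedy M ι N₀ x p K) (h : Fin H) {k : ℕ}
    (hk : k < K) :
    obsV M.r ι N₀ x p h k (x k h.succ) - M.Vstar (h + 1) (x k h.succ) ≤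
      ownError M ι N₀ x p (h + 1) k := by
  by_cases hh : (h : ℕ) + 1 < H
  · simp only [obsV, nextVal, dif_pos hh]
    exact V_sub_Vstar_le_ownError hg ⟨h + 1, hh⟩ hk
  · simp only [obsV, nextVal, dif_neg hh, ownError]
    rw [M.Vstar_of_le (not_lt.1 hh), sub_zero]

/-- If after the first stage the error of every estimate is at most a local cost plus the average
error of the values observed in the last completed stage, the weighted sum of the errors is
bounded by `H` times the total cost of one step. -/
theorem sum_mul_ownError_le [Nonempty A] {D G L ε W : ℝ} (hD : 0 ≤ D) (hG : 0 ≤ G) (hL : 0 ≤ L)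
    (hε : 0 < ε) (hg : Greedy M ι N₀ x p K)
    (hloc : ∀ (h : Fin H), ∀ k < K, ∀ i,
      visitStage x p h (x k h.castSucc) (p k h (x k h.castSucc)) k = i + 1 →
      ownError M ι N₀ x p h k ≤ √(D / ((ownCount x p h k : ℝ) + 1))
        + G * (1 / ((ownCount x p h k : ℝ) + 1))
        + L * (ownUnsettled N₀ x p h k * (1 / ((ownCount x p h k : ℝ) + 1)))
        + visitSum x p K h (x k h.castSucc) (p k h (x k h.castSucc)) (stageEnd H i)
          (stageEnd H (i + 1)) (fun j t => obsV M.r ι N₀ x p h j t - M.Vstar (h + 1) t)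
          / stageLen H i)
    (h : Fin H) {w : ℕ → ℝ} (hw0 : ∀ k < K, 0 ≤ w k) (hw1 : ∀ k < K, w k ≤ 1)
    (hw : ∑ k ∈ range K, w k ≤ W) :
    ∑ k ∈ range K, w k * ownError M ι N₀ x p h k ≤
      H * (ε * W + 3 * (Fintype.card S * Fintype.card A * ((H : ℝ) ^ 2 + 2 * D / ε
        + G * (1 + Real.log K)) + L * (Fintype.card S * N₀ * (1 + Real.log K)))) := by
  have hH : 1 ≤ H := (Nat.zero_le _).trans_lt h.2
  refine sum_mul_le_of_recursion (R := stageWeight x p) (Z := ownError M ι N₀ x p)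
    (c := localCost N₀ x p D G L) (stageWeight_nonneg x p) (fun h k _ => sum_stageWeight_row_le h k)
    (fun h j _ => sum_stageWeight_col_le h j) ?_ (fun k => by simp [ownError])
    (fun h w h0 h3 hW => sum_mul_localCost_le N₀ x p K hD hG hL hε h h0 h3 hW) h w hw0 hw1 hw
  intro h k hk
  have hu := ownUnsettled_nonneg N₀ x p h k
  have hpos : 0 ≤ √(D / ((ownCount x p h k : ℝ) + 1))
        + G * (1 / ((ownCount x p h k : ℝ) + 1))
        + L * (ownUnsettled N₀ x p h k * (1 / ((ownCount x p h k : ℝ) + 1))) := by positivity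
  have hind : (if ownCount x p h k < H then (H : ℝ) else 0) ≥ 0 := by
    split_ifs <;> positivity
  rcases hi : visitStage x p h (x k h.castSucc) (p k h (x k h.castSucc)) k with _ | i
  · have hlt : ownCount x p h k < H := by
      have := ((stageIdx_eq_iff hH).1 hi).2
      rwa [stageEnd_succ, stageEnd_zero, zero_add, show stageLen H 0 = H from rfl] at this
    have hQ : (algState M.r ι N₀ x p k).Q h (x k h.castSucc) (p k h (x k h.castSucc)) ≤ H := by
      have h1 : ∀ k s a, (algState M.r ι N₀ x p k).Q h s a ≤ (H : ℝ) - (h : ℕ) := by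
        intro k s a
        induction k with
        | zero => exact le_rfl
        | succ k ih => exact (algState_Q_succ_le M.r ι N₀ x p hH h s a k).trans ih
      exact (h1 _ _ _).trans (sub_le_self _ (Nat.cast_nonneg _))
    have hQ' := M.Qstar_nonneg h (x k h.castSucc) (p k h (x k h.castSucc))
    rw [sum_eq_zero fun j _ => by rw [stageWeight_of_stage_zero hi j, zero_mul], ownError_fin,
      localCost, if_pos hlt]
    linarith
  · rw [sum_stageWeight_mul hi]
    have h1 := hloc h k hk i hi
    have h2 : visitSum x p K h (x k h.castSucc) (p k h (x k h.castSucc)) (stageEnd H i)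
          (stageEnd H (i + 1)) (fun j t => obsV M.r ι N₀ x p h j t - M.Vstar (h + 1) t) ≤
        ∑ j ∈ window (Visit x p h (x k h.castSucc) (p k h (x k h.castSucc))) K
          (stageEnd H i) (stageEnd H (i + 1)), ownError M ι N₀ x p (h + 1) j :=
      sum_le_sum fun j hj => obsV_sub_Vstar_le_ownError hg h (mem_window.1 hj).1
    have h3 := div_le_div_of_nonneg_right h2 (Nat.cast_nonneg (stageLen H i) : (0 : ℝ) ≤ _)
    rw [localCost]
    linarith

end CostSums

section LocalBounds

variable {S A : Type*} [Fintype S] [Fintype A] [DecidableEq S] [DecidableEq A] {H : ℕ}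
  {M : MDP S A H} {ι : ℝ} {N₀ : ℕ} {x : ℕ → Fin (H + 1) → S} {p : ℕ → Fin H → S → A} {K : ℕ}

/-! ### Accuracy of the estimates after `N₀` visits -/

/-- The number of a visit is comparable to the number of visits up to the end of the last completed
stage, and it is at most `12 H` times the length of that stage. -/
lemma ownCount_succ_le {h : Fin H} {k i : ℕ}
    (hi : visitStage x p h (x k h.castSucc) (p k h (x k h.castSucc)) k = i + 1) :
    (ownCount x p h k : ℝ) + 1 ≤ 3 * stageEnd H (i + 1) ∧
      (ownCount x p h k : ℝ) + 1 ≤ 12 * H * stageLen H i ∧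
      stageEnd H (i + 1) ≤ ownCount x p h k := by
  have hH : 1 ≤ H := (Nat.zero_le _).trans_lt h.2
  obtain ⟨h1, h2⟩ := (stageIdx_eq_iff hH).1 hi
  change _ ≤ ownCount x p h k at h1
  change ownCount x p h k < _ at h2
  have h3 := stageLen_succ_le_two_mul hH i
  have h4 := stageEnd_succ_le hH i
  have h5 : stageLen H i ≤ stageEnd H (i + 1) := by rw [stageEnd_succ]; omega
  rw [stageEnd_succ H (i + 1)] at h2
  have h6 : ownCount x p h k + 1 ≤ 3 * stageEnd H (i + 1) := by omega
  have h7 : ownCount x p h k + 1 ≤ 12 * H * stageLen H i := by linarith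
  exact ⟨by exact_mod_cast h6, by exact_mod_cast h7, h1⟩

lemma stageEnd_le_visitCount {h : Fin H} {k i : ℕ} (hk : k < K)
    (hi : visitStage x p h (x k h.castSucc) (p k h (x k h.castSucc)) k = i + 1) :
    stageEnd H (i + 1) ≤ visitCount x p h (x k h.castSucc) (p k h (x k h.castSucc)) K :=
  (ownCount_succ_le hi).2.2.trans (Nat.count_monotone _ hk.le)

/-- The local error bound that the Hoeffding-type update provides. -/
lemma ownError_le_hoeffding [Nonempty A] {β' : ℝ} (hι : 1 ≤ ι)
    (hE : ConcentrationEvent M ι N₀ x p K β') {h : Fin H} {k i : ℕ} (hk : k < K)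
    (hi : visitStage x p h (x k h.castSucc) (p k h (x k h.castSucc)) k = i + 1) :
    ownError M ι N₀ x p h k ≤ √(192 * H ^ 3 * ι / ((ownCount x p h k : ℝ) + 1)) +
      visitSum x p K h (x k h.castSucc) (p k h (x k h.castSucc)) (stageEnd H i)
          (stageEnd H (i + 1)) (fun j t => obsV M.r ι N₀ x p h j t - M.Vstar (h + 1) t)
          / stageLen H i := by
  have hH : 1 ≤ H := (Nat.zero_le _).trans_lt h.2
  have hH0 : (0 : ℝ) < H := by exact_mod_cast hH
  have hj := stageEnd_le_visitCount hk hi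
  have hK := hj.trans (visitCount_le _ _ _ K)
  have hlt := stageEnd_strictMono hH (Nat.lt_succ_self i)
  have hn := card_window_stage hj
  have hn0 : (0 : ℝ) < stageLen H i := by exact_mod_cast stageLen_pos hH i
  have h1 := (abs_le.1 (abs_average_Vstar_sub_le hι hE (hlt.le.trans hK) hK hn hn0)).2
  have h2 := (algState_Q_le_est (M := M) (ι := ι) (N₀ := N₀) hk.le hi).1
  have hm := (ownCount_succ_le hi).2.1
  have h3 : 4 * (H * √(ι / stageLen H i)) ≤ √(192 * H ^ 3 * ι / ((ownCount x p h k : ℝ) + 1)) := by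
    refine Real.le_sqrt_of_sq_le ?_
    rw [mul_pow, mul_pow, Real.sq_sqrt (by positivity), le_div_iff₀ (by positivity)]
    calc 4 ^ 2 * ((H : ℝ) ^ 2 * (ι / stageLen H i)) * ((ownCount x p h k : ℝ) + 1)
        ≤ 4 ^ 2 * ((H : ℝ) ^ 2 * (ι / stageLen H i)) * (12 * H * stageLen H i) := by gcongr
      _ = 192 * H ^ 3 * ι := by field_simp; ring
  rw [hoeffdingEst, hoeffdingBonus_eq] at h2
  rw [ownError_fin, MDP.Qstar, visitSum_sub, sub_div]
  linarith

lemma sum_range_ite_stateCount (h : Fin H) (s : S) {k : ℕ} (hk : k < K) :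
    ∑ j ∈ range K, (if x j h.castSucc = s ∧ j ≤ k then (1 : ℝ) else 0) =
      stateCount x h s (k + 1) := by
  rw [← sum_filter, sum_const, nsmul_eq_mul, mul_one, stateCount, Nat.count_eq_card_filter_range]
  congr 2
  ext j
  simp only [mem_filter, mem_range]
  constructor
  · rintro ⟨h1, h2, h3⟩; exact ⟨by omega, h2⟩
  · rintro ⟨h1, h2⟩; exact ⟨by omega, h2, by omega⟩

/-- If the estimate of a state were off by more than `β'` at its `N₀`-th visit, it would have been
so at all earlier visits, and the sum of these errors would contradict `sum_mul_ownError_le`. -/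
lemma V_sub_Vstar_le_of_visits [Nonempty A] {β' : ℝ} (hι : 1 ≤ ι) (hβ : 0 < β')
    (hE : ConcentrationEvent M ι N₀ x p K β') (hg : Greedy M ι N₀ x p K)
    (hN : 5000 * (Fintype.card S * Fintype.card A * (H : ℝ) ^ 5 * ι) / β' ^ 2 ≤ N₀)
    {h : Fin H} {s : S} {k : ℕ} (hk : k < K) (hs : x k h.castSucc = s)
    (hcount : N₀ ≤ stateCount x h s k + 1) :
    (algState M.r ι N₀ x p k).V h s - M.Vstar h s ≤ β' := by
  by_contra! hlt
  have hH : 1 ≤ H := (Nat.zero_le _).trans_lt h.2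
  have hH0 : (0 : ℝ) < H := by exact_mod_cast hH
  have hH1 : (1 : ℝ) ≤ H := by exact_mod_cast hH
  have hS : (0 : ℝ) < Fintype.card S := by exact_mod_cast Fintype.card_pos_iff.2 ⟨s⟩
  have hA : (0 : ℝ) < Fintype.card A := by exact_mod_cast Fintype.card_pos
  have hβH : β' ≤ H := by
    have h1 := (algState_V_le_Vref M.r ι N₀ x p hH h s k).trans
      (algState_Vref_le M.r ι N₀ x p hH h s k)
    have h2 := M.Vstar_nonneg h s
    linarith
  set W : ℝ := (stateCount x h s (k + 1) : ℝ) with hW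
  have hWN : (N₀ : ℝ) ≤ W := by
    rw [hW, stateCount, Nat.count_succ, if_pos hs]
    exact_mod_cast hcount
  have hsum := sum_range_ite_stateCount (x := x) h s hk
  have hD : 0 ≤ 192 * (H : ℝ) ^ 3 * ι := by positivity
  -- the weights select the visits to `s` up to episode `k`; with this `ε` the term `H ε W` is half of
  -- the lower bound `β' W` for the sum of the errors
  have h1 := sum_mul_ownError_le (D := 192 * H ^ 3 * ι) (G := 0) (L := 0) (ε := β' / (2 * H))
    (W := W) hD le_rfl le_rfl (by positivity) hg
    (fun h k hk i hi => by
      have := ownError_le_hoeffding hι hE hk hi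
      simpa using this) h (w := fun j => if x j h.castSucc = s ∧ j ≤ k then 1 else 0)
    (fun j _ => by split_ifs <;> norm_num) (fun j _ => by split_ifs <;> norm_num) hsum.le
  have h2 : β' * W ≤ ∑ j ∈ range K, (if x j h.castSucc = s ∧ j ≤ k then (1 : ℝ) else 0) *
      ownError M ι N₀ x p h j := by
    rw [hW, ← hsum, mul_sum]
    refine sum_le_sum fun j hj => ?_
    split_ifs with hc
    · rw [mul_one, one_mul]
      have h3 := V_sub_Vstar_le_ownError hg h (mem_range.1 hj)
      have h4 := algState_V_antitone M.r ι N₀ x p hH h s hc.2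
      rw [hc.1] at h3
      simp only at h4
      linarith
    · simp
  have h3 := h2.trans h1
  simp only [zero_mul, add_zero] at h3
  have h4 : (H : ℝ) * (β' / (2 * H) * W) = β' * W / 2 := by field_simp
  have h5 : 2 * (192 * (H : ℝ) ^ 3 * ι) / (β' / (2 * H)) = 768 * H ^ 4 * ι / β' := by
    field_simp; norm_num
  have h6 : (H : ℝ) ^ 2 ≤ H ^ 4 * ι / β' := by
    rw [le_div_iff₀ hβ]
    have : (H : ℝ) ^ 2 * β' ≤ H ^ 2 * H := by gcongr
    have h7 : (H : ℝ) ^ 2 * H ≤ H ^ 4 * ι := by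
      calc (H : ℝ) ^ 2 * H = H ^ 3 * 1 := by ring
        _ ≤ H ^ 4 * ι := by gcongr; norm_num
    linarith
  have h7 : β' * W / 2 ≤ H * (3 * (Fintype.card S * Fintype.card A * (769 * (H ^ 4 * ι / β')))) := by
    have h8 : (H : ℝ) * (3 * (Fintype.card S * Fintype.card A *
        (H ^ 2 + 2 * (192 * (H : ℝ) ^ 3 * ι) / (β' / (2 * H))))) ≤
        H * (3 * (Fintype.card S * Fintype.card A * (769 * (H ^ 4 * ι / β')))) := by
      rw [h5]
      gcongr
      have : 768 * (H : ℝ) ^ 4 * ι / β' = 768 * (H ^ 4 * ι / β') := by ring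
      linarith
    rw [mul_add, h4] at h3
    linarith
  have h8 : W ≤ 4614 * (Fintype.card S * Fintype.card A * (H : ℝ) ^ 5 * ι) / β' ^ 2 := by
    rw [le_div_iff₀ (by positivity)]
    have h9 := mul_le_mul_of_nonneg_left h7 hβ.le
    have h10 : β' * (H * (3 * (Fintype.card S * Fintype.card A * (769 * ((H : ℝ) ^ 4 * ι / β'))))) =
        2307 * (Fintype.card S * Fintype.card A * (H : ℝ) ^ 5 * ι) := by
      field_simp; norm_num
    rw [h10] at h9
    nlinarith
  have h9 : 0 < Fintype.card S * Fintype.card A * (H : ℝ) ^ 5 * ι / β' ^ 2 := by positivity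
  have h10 := (hN.trans hWN).trans h8
  rw [mul_div_assoc 5000, mul_div_assoc 4614] at h10
  linarith

/-- Settled reference values are `β'`-accurate. -/
lemma Vref_sub_Vstar_le_of_settled [Nonempty A] {β' : ℝ} (hι : 1 ≤ ι) (hβ : 0 < β')
    (hE : ConcentrationEvent M ι N₀ x p K β') (hg : Greedy M ι N₀ x p K)
    (hN : 5000 * (Fintype.card S * Fintype.card A * (H : ℝ) ^ 5 * ι) / β' ^ 2 ≤ N₀)
    (hN1 : 1 ≤ N₀) {h : Fin H} {s : S} {j : ℕ} (hj : j ≤ K) (hset : N₀ ≤ stateCount x h s j) :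
    (algState M.r ι N₀ x p j).Vref h s - M.Vstar h s ≤ β' := by
  have hH : 1 ≤ H := (Nat.zero_le _).trans_lt h.2
  induction j with
  | zero => simp [stateCount] at hset; omega
  | succ j ih =>
    by_cases hset' : N₀ ≤ stateCount x h s j
    · rw [algState_Vref_eq_of_settled M.r ι N₀ x p hset' (Nat.le_succ j)]
      exact ih (by omega) hset'
    · have hcount : stateCount x h s (j + 1) = stateCount x h s j +
        if x j h.castSucc = s then 1 else 0 := Nat.count_succ _ _
      have hs : x j h.castSucc = s := by
        by_contra hs
        rw [if_neg hs] at hcount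
        omega
      rw [if_pos hs] at hcount
      have h1 := V_sub_Vstar_le_of_visits hι hβ hE hg hN hj hs (by omega)
      have h2 := algState_V_antitone M.r ι N₀ x p hH h s (Nat.le_succ j)
      simp only [Nat.succ_eq_add_one] at h2
      rw [algState_Vref_succ, if_pos ⟨hs, by omega⟩]
      linarith

/-! ### The local error bound of the reference-advantage update -/

/-- Settled reference values are accurate: the conclusion of `Vref_sub_Vstar_le_of_settled`. -/
def RefAccurate (M : MDP S A H) (ι : ℝ) (N₀ : ℕ) (x : ℕ → Fin (H + 1) → S)
    (p : ℕ → Fin H → S → A) (K : ℕ) (β' : ℝ) : Prop :=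
  ∀ (h : Fin H) (s : S), ∀ j ≤ K, N₀ ≤ stateCount x h s j →
    (algState M.r ι N₀ x p j).Vref h s - M.Vstar h s ≤ β'

lemma settledAdv_mono [Nonempty A] {h : Fin H} {j j' : ℕ} (hjj' : j ≤ j')
    (ho : Optimistic M ι N₀ x p j') (t : S) :
    settledAdv M ι N₀ x p h j t ≤ settledAdv M ι N₀ x p h j' t := by
  have hH : 1 ≤ H := (Nat.zero_le _).trans_lt h.2
  refine nextVal_mono (fun i s => ?_) h t
  have hmono : stateCount x i s j ≤ stateCount x i s j' := Nat.count_monotone _ hjj'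
  split_ifs with h1 h2 h2
  · rw [algState_Vref_eq_of_settled M.r ι N₀ x p h1 hjj']
  · omega
  · exact sub_nonneg.2 ((ho.Vstar_le_V i s).trans (algState_V_le_Vref M.r ι N₀ x p hH i s j'))
  · exact le_rfl

/-- The reference values exceed the optimal values by at most `β'` at settled states, and by at
most `H` elsewhere. -/
lemma obsRef_sub_Vstar_bounds [Nonempty A] {β' : ℝ} (hβ : 0 ≤ β')
    (hacc : RefAccurate M ι N₀ x p K β') {j : ℕ} (hj : j ≤ K) (ho : Optimistic M ι N₀ x p j)
    (h : Fin H) (t : S) :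
    0 ≤ settledAdv M ι N₀ x p h j t ∧ settledAdv M ι N₀ x p h j t ≤ β' ∧
      settledAdv M ι N₀ x p h j t ≤ obsRef M.r ι N₀ x p h j t - M.Vstar (h + 1) t ∧
      obsRef M.r ι N₀ x p h j t - M.Vstar (h + 1) t ≤
        settledAdv M ι N₀ x p h j t + H * unsettled N₀ x h j t ∧
      (obsRef M.r ι N₀ x p h j t - M.Vstar (h + 1) t) ^ 2 ≤
        β' ^ 2 + H ^ 2 * unsettled N₀ x h j t := by
  have hH : 1 ≤ H := (Nat.zero_le _).trans_lt h.2
  by_cases hh : (h : ℕ) + 1 < H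
  · have h1 : 0 ≤ (algState M.r ι N₀ x p j).Vref ⟨h + 1, hh⟩ t - M.Vstar (h + 1) t :=
      sub_nonneg.2 ((ho.Vstar_le_V ⟨h + 1, hh⟩ t).trans (algState_V_le_Vref M.r ι N₀ x p hH _ t j))
    have h2 := algState_Vref_le M.r ι N₀ x p hH ⟨h + 1, hh⟩ t j
    have h3 := M.Vstar_nonneg (h + 1) t
    simp only [settledAdv, unsettled, obsRef, nextVal, dif_pos hh]
    split_ifs with hset
    · have h4 := hacc ⟨h + 1, hh⟩ t j hj hset
      exact ⟨h1, h4, le_rfl, by simp, by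
        rw [mul_zero, add_zero]; exact pow_le_pow_left₀ h1 h4 2⟩
    · refine ⟨le_rfl, hβ, h1, by linarith, ?_⟩
      have : ((algState M.r ι N₀ x p j).Vref ⟨h + 1, hh⟩ t - M.Vstar (h + 1) t) ^ 2 ≤
          (H : ℝ) ^ 2 := pow_le_pow_left₀ h1 (by linarith) 2
      nlinarith
  · simp only [settledAdv, unsettled, obsRef, nextVal, dif_neg hh]
    rw [M.Vstar_of_le (not_lt.1 hh)]
    exact ⟨le_rfl, hβ, by simp, by simp, by simpa using sq_nonneg β'⟩

/-- The empirical second moment of `V⋆` about its mean, compared with its variance. -/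
lemma visitSum_sq_dev_le [Nonempty A] {β' : ℝ} (hι : 1 ≤ ι)
    (hE : ConcentrationEvent M ι N₀ x p K β') {h : Fin H} {s : S} {a : A} {hi : ℕ} (hhi : hi ≤ K)
    {n : ℝ} (hn : n = #(window (Visit x p h s a) K 0 hi)) :
    visitSum x p K h s a 0 hi
        (fun _ t => (M.Vstar (h + 1) t - M.expect h s a (M.Vstar (h + 1))) ^ 2) ≤
      2 * n * M.cvar h s a (M.Vstar (h + 1)) + H ^ 2 * ι := by
  have hH0 : (0 : ℝ) < H := by exact_mod_cast (Nat.zero_le _).trans_lt h.2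
  set μ := M.expect h s a (M.Vstar (h + 1)) with hμ
  set σ := M.cvar h s a (M.Vstar (h + 1)) with hσ
  have hσ0 : 0 ≤ σ := M.cvar_nonneg _ _ _ _
  have hn0 : 0 ≤ n := by rw [hn]; positivity
  have hμ0 : 0 ≤ μ := M.le_expect _ _ _ fun t => M.Vstar_nonneg _ _
  have hμH : μ ≤ H := M.expect_le _ _ _ fun t => M.Vstar_le _ _
  have hdev : ∀ t, (M.Vstar (h + 1) t - μ) ^ 2 ≤ (H : ℝ) ^ 2 := fun t => by
    rw [sq_le_sq, abs_of_pos hH0]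
    have h1 := M.Vstar_nonneg (h + 1) t
    have h2 := M.Vstar_le (h + 1) t
    exact abs_le.2 ⟨by linarith, by linarith⟩
  have h1 := abs_visitSum_sub_le_freedman (lo := 0) (hi := hi)
    (g := fun _ t => (M.Vstar (h + 1) t - μ) ^ 2) (hE.starSq h s a) (by positivity)
    (fun j _ t => by rw [abs_of_nonneg (sq_nonneg _)]; exact hdev t) (by linarith)
    (Nat.zero_le _) hhi
  have h2 : expectSum M x p K h s a 0 hi (fun _ t => (M.Vstar (h + 1) t - μ) ^ 2) = n * σ := by
    rw [expectSum, sum_const, nsmul_eq_mul, ← hn, hσ, M.cvar_eq_expect_sq]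
  have h3 : cvarSum M x p K h s a 0 hi (fun _ t => (M.Vstar (h + 1) t - μ) ^ 2) ≤
      n * (H ^ 2 * σ) := by
    rw [cvarSum, sum_const, nsmul_eq_mul, ← hn]
    refine mul_le_mul_of_nonneg_left ?_ hn0
    refine (M.cvar_le_expect_sq _ _ _ _).trans ?_
    rw [hσ, M.cvar_eq_expect_sq, ← M.expect_mul_left]
    refine M.expect_mono _ _ _ fun t => ?_
    rw [sq ((M.Vstar (h + 1) t - μ) ^ 2)]
    exact mul_le_mul_of_nonneg_right (hdev t) (sq_nonneg _)
  have h4 : √(ι / 4 * cvarSum M x p K h s a 0 hi (fun _ t => (M.Vstar (h + 1) t - μ) ^ 2)) ≤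
      (n * σ + H ^ 2 * ι / 4) / 2 := by
    refine Real.sqrt_le_iff.2 ⟨by positivity, ?_⟩
    have h5 := mul_le_mul_of_nonneg_left h3 (show 0 ≤ ι / 4 by linarith)
    nlinarith [sq_nonneg (n * σ - H ^ 2 * ι / 4)]
  have h5 := (abs_le.1 h1).2
  rw [h2] at h5
  nlinarith [mul_nonneg hn0 hσ0, mul_nonneg (sq_nonneg (H : ℝ)) (zero_le_one.trans hι)]

/-- The width of the reference part. Here `ν` stands for the empirical variance of the reference
values, `α` and `γ` for `ι` divided by the numbers of all visits and of those in the last stage,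
`B` for `H`, and `V` for the fraction of the visits that lead to unsettled states. -/
lemma sqrt_refVariance_le {ν q β' B α γ : ℝ} (hα : 0 ≤ α) (hαγ : α ≤ γ) (hq : 0 ≤ q)
    (hβ : 0 ≤ β') {V : ℝ} (hV : 0 ≤ V)
    (hν : ν ≤ 4 * q + 2 * β' ^ 2 + 2 * B ^ 2 * α + 2 * B ^ 2 * V) (hU : 0 ≤ B) :
    √(ν * α) ≤ 2 * √(q * α) + 3 / 2 * (β' * √γ) + 3 / 2 * (B * α) + 3 / 4 * (B * (V + α)) := by
  have hγ : 0 ≤ γ := hα.trans hαγ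
  have e1 : ν * α ≤ ((4 * (q * α) + 2 * (β' ^ 2 * γ)) + 2 * (B * α) ^ 2) + 2 * (B ^ 2 * V * α) := by
    have e2 := mul_le_mul_of_nonneg_right hν hα
    have e5 := mul_le_mul_of_nonneg_left hαγ (sq_nonneg β')
    linarith only [e2, e5]
  refine (Real.sqrt_le_sqrt e1).trans ?_
  refine (sqrt_add_le (by positivity) (by positivity)).trans ?_
  refine add_le_add ((sqrt_add_le (by positivity) (by positivity)).trans (add_le_add
    ((sqrt_add_le (by positivity) (by positivity)).trans (add_le_add ?_ ?_)) ?_)) ?_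
  · rw [Real.sqrt_mul (by norm_num), show (4 : ℝ) = 2 ^ 2 by norm_num,
      Real.sqrt_sq (by norm_num)]
  · refine Real.sqrt_le_iff.2 ⟨by positivity, ?_⟩
    rw [mul_pow, mul_pow, Real.sq_sqrt hγ]
    linarith only [mul_nonneg (sq_nonneg β') hγ]
  · refine Real.sqrt_le_iff.2 ⟨by positivity, ?_⟩
    linarith only [sq_nonneg (B * α)]
  · refine Real.sqrt_le_iff.2 ⟨by positivity, ?_⟩
    have e6 : V * α ≤ (V + α) ^ 2 / 4 := by linarith only [sq_nonneg (V - α)]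
    have e7 := mul_le_mul_of_nonneg_left e6 (sq_nonneg B)
    linarith only [sq_nonneg (B * (V + α)), e7]

/-- The width of the advantage part, with the same conventions. -/
lemma sqrt_advVariance_le {ν β' B V γ : ℝ} (hγ : 0 ≤ γ) (hβ : 0 ≤ β') (hV : 0 ≤ V)
    (hν : ν ≤ β' ^ 2 + B ^ 2 * V) : √(ν * γ) ≤ β' * √γ + (V + B ^ 2 * γ) / 2 := by
  have e1 : ν * γ ≤ β' ^ 2 * γ + B ^ 2 * V * γ := by
    have e2 := mul_le_mul_of_nonneg_right hν hγ
    linarith only [e2]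
  refine (Real.sqrt_le_sqrt e1).trans ((sqrt_add_le (by positivity) (by positivity)).trans
    (add_le_add ?_ ?_))
  · rw [Real.sqrt_mul (sq_nonneg _), Real.sqrt_sq hβ]
  · refine Real.sqrt_le_iff.2 ⟨by positivity, ?_⟩
    linarith only [sq_nonneg (V - B ^ 2 * γ)]

lemma mul_rpow_three_quarters_le {B β' γ : ℝ} (hγ : 0 ≤ γ) (hβ : 0 < β') :
    B * (γ ^ (1 / 4 : ℝ)) ^ 3 ≤ (β' * √γ + B ^ 2 / β' * γ) / 2 := by
  set z := γ ^ (1 / 4 : ℝ) with hz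
  have hz0 : 0 ≤ z := Real.rpow_nonneg hγ _
  have hz4 : z ^ 4 = γ := rpow_quarter_pow_four hγ
  have hz2 : √γ = z ^ 2 := by
    rw [Real.sqrt_eq_iff_mul_self_eq hγ (by positivity), ← hz4]; ring
  rw [hz2, ← hz4]
  have e1 : 0 ≤ (β' - B * z) ^ 2 / β' * z ^ 2 := by positivity
  have e2 : (β' - B * z) ^ 2 / β' * z ^ 2 =
      β' * z ^ 2 - 2 * (B * z ^ 3) + B ^ 2 / β' * z ^ 4 := by
    field_simp; ring
  linarith only [e1, e2]

/-- A numerical bound for the bonus of the reference-advantage update in terms of bounds for the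
two empirical variances. The term with the exponent `3 / 4` is split by the inequality of the
arithmetic and geometric means with the weight `β'`. -/
lemma advBonus_le {n nc : ℕ} {mu sig mu' sig' q β' U : ℝ} (hH : 1 ≤ H) (hι : 1 ≤ ι)
    (hnc : 0 < nc) (hn : nc ≤ n) (hq : 0 ≤ q) (hβ : 0 < β') (hU : 0 ≤ U)
    (h1 : sig / n - (mu / n) ^ 2 ≤
      4 * q + 2 * β' ^ 2 + 2 * H ^ 2 * (ι / n) + 2 * H ^ 2 * (U / n))
    (h2 : sig' / nc - (mu' / nc) ^ 2 ≤ β' ^ 2 + H ^ 2 * (U / nc)) :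
    advBonus H ι n nc mu sig mu' sig' ≤ 4 * √(q * ι / n) + 10 * (β' * √(ι / nc))
      + ι / nc * (20 * H ^ 2 + 5 * H ^ 2 / β') + U * (3 / 2 * H / n + 1 / nc) := by
  have hH0 : (1 : ℝ) ≤ H := by exact_mod_cast hH
  have hnc0 : (0 : ℝ) < nc := by exact_mod_cast hnc
  have hn' : (nc : ℝ) ≤ n := by exact_mod_cast hn
  have hn0 : (0 : ℝ) < n := hnc0.trans_le hn'
  have hι0 : 0 < ι := by linarith
  have hα0 : 0 ≤ ι / n := by positivity
  have hγ0 : 0 ≤ ι / nc := by positivity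
  have hαγ : ι / n ≤ ι / nc := div_le_div_of_nonneg_left hι0.le hnc0 hn'
  have hb1 := sqrt_refVariance_le hα0 hαγ hq hβ.le (show 0 ≤ U / n by positivity) h1
    (Nat.cast_nonneg H)
  have hb2 := sqrt_advVariance_le hγ0 hβ.le (show 0 ≤ U / nc by positivity) h2
  have hamgm := mul_rpow_three_quarters_le (B := H) hγ0 hβ
  have h34 : ι ^ (3 / 4 : ℝ) / (nc : ℝ) ^ (3 / 4 : ℝ) = ((ι / nc) ^ (1 / 4 : ℝ)) ^ 3 :=
    rpow_three_quarters hι0.le hnc0.le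
  have h34' : ι ^ (3 / 4 : ℝ) / (n : ℝ) ^ (3 / 4 : ℝ) ≤ ((ι / nc) ^ (1 / 4 : ℝ)) ^ 3 := by
    rw [rpow_three_quarters hι0.le hn0.le]
    exact pow_le_pow_left₀ (Real.rpow_nonneg hα0 _) (Real.rpow_le_rpow hα0 hαγ (by norm_num)) 3
  have e1 : (H : ℝ) * ι ^ (3 / 4 : ℝ) / (n : ℝ) ^ (3 / 4 : ℝ) ≤
      H * ((ι / nc) ^ (1 / 4 : ℝ)) ^ 3 := by
    rw [mul_div_assoc]; exact mul_le_mul_of_nonneg_left h34' (by positivity)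
  have e2 : (H : ℝ) * ι ^ (3 / 4 : ℝ) / (nc : ℝ) ^ (3 / 4 : ℝ) =
      H * ((ι / nc) ^ (1 / 4 : ℝ)) ^ 3 := by
    rw [mul_div_assoc, h34]
  have e3 : (H : ℝ) * ι / n ≤ H * (ι / nc) := by
    rw [mul_div_assoc]; exact mul_le_mul_of_nonneg_left hαγ (by positivity)
  have e4 : (H : ℝ) * ι / nc = H * (ι / nc) := by rw [mul_div_assoc]
  have e5 : (H : ℝ) * (ι / nc) ≤ H ^ 2 * (ι / nc) := by
    refine mul_le_mul_of_nonneg_right ?_ hγ0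
    nlinarith
  have e6 : (H : ℝ) * (ι / n) ≤ H * (ι / nc) := mul_le_mul_of_nonneg_left hαγ (by positivity)
  have e8 : ι / nc * (20 * (H : ℝ) ^ 2 + 5 * H ^ 2 / β') =
      20 * (H ^ 2 * (ι / nc)) + 5 * (H ^ 2 / β' * (ι / nc)) := by ring
  have e9 : U * (3 / 2 * H / n + 1 / nc) = 3 / 2 * (H * (U / n)) + U / nc := by ring
  have e10 : (sig / n - (mu / n) ^ 2) / n * ι = (sig / n - (mu / n) ^ 2) * (ι / n) := by ring
  have e11 : (sig' / nc - (mu' / nc) ^ 2) / nc * ι = (sig' / nc - (mu' / nc) ^ 2) * (ι / nc) := by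
    ring
  rw [advBonus, e8, e9, e10, e11, e2, e4, mul_div_assoc q]
  have e7 : 0 ≤ (H : ℝ) ^ 2 * (ι / nc) := by positivity
  linarith only [hb1, hb2, hamgm, e1, e3, e5, e6, e7]

section StageBounds

variable {h : Fin H} {s : S} {a : A} {i : ℕ} {β' U : ℝ}

variable (M ι N₀ x p K) in
/-- The reference values seen up to the end of stage `i` exceed the optimal values by at most `β'`
at settled states; there are at most `U` visits to unsettled ones. -/
structure RefBounds (h : Fin H) (s : S) (a : A) (i : ℕ) (β' U : ℝ) : Prop where
  count : stageEnd H (i + 1) ≤ visitCount x p h s a K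
  opt : ∀ j ∈ window (Visit x p h s a) K 0 (stageEnd H (i + 1)), Optimistic M ι N₀ x p j
  settled_nonneg : ∀ j ∈ window (Visit x p h s a) K 0 (stageEnd H (i + 1)), ∀ t,
    0 ≤ settledAdv M ι N₀ x p h j t
  settled_le : ∀ j ∈ window (Visit x p h s a) K 0 (stageEnd H (i + 1)), ∀ t,
    settledAdv M ι N₀ x p h j t ≤ β'
  settled_le_adv : ∀ j ∈ window (Visit x p h s a) K 0 (stageEnd H (i + 1)), ∀ t,
    settledAdv M ι N₀ x p h j t ≤ obsRef M.r ι N₀ x p h j t - M.Vstar (h + 1) t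
  adv_le : ∀ j ∈ window (Visit x p h s a) K 0 (stageEnd H (i + 1)), ∀ t,
    obsRef M.r ι N₀ x p h j t - M.Vstar (h + 1) t ≤
      settledAdv M ι N₀ x p h j t + H * unsettled N₀ x h j t
  adv_sq_le : ∀ j ∈ window (Visit x p h s a) K 0 (stageEnd H (i + 1)), ∀ t,
    (obsRef M.r ι N₀ x p h j t - M.Vstar (h + 1) t) ^ 2 ≤ β' ^ 2 + H ^ 2 * unsettled N₀ x h j t
  unsettled_le : visitSum x p K h s a 0 (stageEnd H (i + 1)) (unsettled N₀ x h) ≤ U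

lemma RefBounds.unsettled_stage_le (hb : RefBounds M ι N₀ x p K h s a i β' U) :
    visitSum x p K h s a (stageEnd H i) (stageEnd H (i + 1)) (unsettled N₀ x h) ≤ U :=
  (sum_le_sum_of_subset_of_nonneg (window_stage_subset x p K h s a i)
    fun j _ _ => unsettled_nonneg N₀ x h j _).trans hb.unsettled_le

/-- The empirical variance of the reference values. -/
lemma RefBounds.refVariance_le [Nonempty A] (hι : 1 ≤ ι)
    (hE : ConcentrationEvent M ι N₀ x p K β') (hb : RefBounds M ι N₀ x p K h s a i β' U) :
    visitSum x p K h s a 0 (stageEnd H (i + 1)) (fun j t => obsRef M.r ι N₀ x p h j t ^ 2)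
        / stageEnd H (i + 1)
      - (visitSum x p K h s a 0 (stageEnd H (i + 1)) (obsRef M.r ι N₀ x p h)
        / stageEnd H (i + 1)) ^ 2 ≤
      4 * M.maxVar + 2 * β' ^ 2 + 2 * H ^ 2 * (ι / stageEnd H (i + 1))
        + 2 * H ^ 2 * (U / stageEnd H (i + 1)) := by
  have hH : 1 ≤ H := (Nat.zero_le _).trans_lt h.2
  have hK := hb.count.trans (visitCount_le _ _ _ K)
  have hn := card_window_all hb.count
  have hn0' : (0 : ℝ) < stageEnd H (i + 1) := by
    exact_mod_cast (Nat.zero_le _).trans_lt (stageEnd_strictMono hH (Nat.lt_succ_self i))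
  have e1 := visitSum_sq_dev_le hι hE hK hn
  set μ := M.expect h s a (M.Vstar (h + 1)) with hμ
  have e2 : visitSum x p K h s a 0 (stageEnd H (i + 1))
        (fun j t => (obsRef M.r ι N₀ x p h j t - μ) ^ 2) ≤
      2 * visitSum x p K h s a 0 (stageEnd H (i + 1))
        (fun _ t => (M.Vstar (h + 1) t - μ) ^ 2) +
      2 * (stageEnd H (i + 1) * β' ^ 2 + H ^ 2 * U) := by
    have e3 : visitSum x p K h s a 0 (stageEnd H (i + 1))
        (fun j t => (obsRef M.r ι N₀ x p h j t - μ) ^ 2) ≤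
        ∑ j ∈ window (Visit x p h s a) K 0 (stageEnd H (i + 1)),
          (2 * (M.Vstar (h + 1) (x j h.succ) - μ) ^ 2 +
            2 * (β' ^ 2 + H ^ 2 * unsettled N₀ x h j (x j h.succ))) := by
      refine sum_le_sum fun j hj' => ?_
      have e4 := hb.adv_sq_le j hj' (x j h.succ)
      linarith only [e4, sq_nonneg ((obsRef M.r ι N₀ x p h j (x j h.succ)
        - M.Vstar (h + 1) (x j h.succ)) - (M.Vstar (h + 1) (x j h.succ) - μ))]
    refine e3.trans ?_
    rw [sum_add_distrib, ← mul_sum, ← mul_sum, sum_add_distrib, sum_const, nsmul_eq_mul, ← hn,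
      ← mul_sum]
    have e5 := mul_le_mul_of_nonneg_left hb.unsettled_le (sq_nonneg (H : ℝ))
    simp only [visitSum] at e5 ⊢
    linarith only [e5]
  have e6 : visitSum x p K h s a 0 (stageEnd H (i + 1))
        (fun j t => (obsRef M.r ι N₀ x p h j t - μ) ^ 2) =
      visitSum x p K h s a 0 (stageEnd H (i + 1)) (fun j t => obsRef M.r ι N₀ x p h j t ^ 2)
      - 2 * μ * visitSum x p K h s a 0 (stageEnd H (i + 1)) (obsRef M.r ι N₀ x p h)
      + stageEnd H (i + 1) * μ ^ 2 := by
    simp only [visitSum, sub_sq, sum_add_distrib, sum_sub_distrib, mul_sum, sum_const,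
      nsmul_eq_mul, ← hn]
    congr 2
    exact sum_congr rfl fun j _ => by ring
  have e7 := mul_le_mul_of_nonneg_left (M.cvar_le_maxVar h s a) hn0'.le
  set S1 := visitSum x p K h s a 0 (stageEnd H (i + 1)) (obsRef M.r ι N₀ x p h)
  set S2 := visitSum x p K h s a 0 (stageEnd H (i + 1)) (fun j t => obsRef M.r ι N₀ x p h j t ^ 2)
  set n : ℝ := (stageEnd H (i + 1) : ℝ)
  have e8 : S2 / n - (S1 / n) ^ 2 ≤ (S2 - 2 * μ * S1 + n * μ ^ 2) / n := by
    have : (S2 - 2 * μ * S1 + n * μ ^ 2) / n = S2 / n - 2 * μ * (S1 / n) + μ ^ 2 := by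
      field_simp
    rw [this]
    linarith only [sq_nonneg (S1 / n - μ)]
  refine e8.trans ?_
  rw [div_le_iff₀ hn0', ← e6]
  have e9 : (4 * M.maxVar + 2 * β' ^ 2 + 2 * H ^ 2 * (ι / n) + 2 * H ^ 2 * (U / n)) * n =
      4 * (n * M.maxVar) + 2 * (n * β' ^ 2) + 2 * (H ^ 2 * ι) + 2 * (H ^ 2 * U) := by
    field_simp
  rw [e9]
  linarith only [e1, e2, e7]

/-- The empirical variance of the advantages. -/
lemma RefBounds.advVariance_le [Nonempty A] (hb : RefBounds M ι N₀ x p K h s a i β' U) :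
    visitSum x p K h s a (stageEnd H i) (stageEnd H (i + 1))
          (fun j t => (obsV M.r ι N₀ x p h j t - obsRef M.r ι N₀ x p h j t) ^ 2) / stageLen H i
      - (visitSum x p K h s a (stageEnd H i) (stageEnd H (i + 1))
          (fun j t => obsV M.r ι N₀ x p h j t - obsRef M.r ι N₀ x p h j t) / stageLen H i) ^ 2 ≤
      β' ^ 2 + H ^ 2 * (U / stageLen H i) := by
  have hnc := card_window_stage hb.count
  have hnc0' : (0 : ℝ) < stageLen H i := by
    exact_mod_cast stageLen_pos ((Nat.zero_le _).trans_lt h.2) i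
  refine (sub_le_self _ (sq_nonneg _)).trans ?_
  rw [div_le_iff₀ hnc0']
  have e1 : visitSum x p K h s a (stageEnd H i) (stageEnd H (i + 1))
        (fun j t => (obsV M.r ι N₀ x p h j t - obsRef M.r ι N₀ x p h j t) ^ 2) ≤
      ∑ j ∈ window (Visit x p h s a) K (stageEnd H i) (stageEnd H (i + 1)),
        (β' ^ 2 + H ^ 2 * unsettled N₀ x h j (x j h.succ)) := by
    refine sum_le_sum fun j hj' => ?_
    have hj'' := window_stage_subset x p K h s a i hj'
    refine le_trans ?_ (hb.adv_sq_le j hj'' (x j h.succ))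
    have e2 := (hb.opt j hj'').Vstar_le_obsV h (x j h.succ)
    have e3 : obsV M.r ι N₀ x p h j (x j h.succ) ≤ obsRef M.r ι N₀ x p h j (x j h.succ) :=
      obsV_le_obsRef h j (x j h.succ)
    change (obsV M.r ι N₀ x p h j (x j h.succ) - obsRef M.r ι N₀ x p h j (x j h.succ)) ^ 2 ≤ _
    rw [sub_sq_comm]
    exact pow_le_pow_left₀ (sub_nonneg.2 e3) (sub_le_sub_left e2 _) 2
  refine e1.trans ?_
  rw [sum_add_distrib, sum_const, nsmul_eq_mul, ← hnc, ← mul_sum]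
  have e5 := mul_le_mul_of_nonneg_left hb.unsettled_stage_le (sq_nonneg (H : ℝ))
  simp only [visitSum] at e5
  have e9 : (β' ^ 2 + H ^ 2 * (U / stageLen H i)) * stageLen H i =
      stageLen H i * β' ^ 2 + H ^ 2 * U := by field_simp
  rw [e9]
  linarith only [e5]

/-- The average of the optimal values over all visits. -/
lemma average_Vstar_sub_le_variance [Nonempty A] (hι : 1 ≤ ι)
    (hE : ConcentrationEvent M ι N₀ x p K β')
    (hj : stageEnd H (i + 1) ≤ visitCount x p h s a K) :
    visitSum x p K h s a 0 (stageEnd H (i + 1)) (fun _ t => M.Vstar (h + 1) t)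
      / stageEnd H (i + 1) - M.expect h s a (M.Vstar (h + 1)) ≤
      √(M.maxVar * ι / stageEnd H (i + 1)) + H * (ι / stageLen H i) := by
  have hH : 1 ≤ H := (Nat.zero_le _).trans_lt h.2
  have hH0 : (0 : ℝ) < H := by exact_mod_cast hH
  have hK := hj.trans (visitCount_le _ _ _ K)
  have hn := card_window_all hj
  have hnc0' : (0 : ℝ) < stageLen H i := by exact_mod_cast stageLen_pos hH i
  have hncn : (stageLen H i : ℝ) ≤ stageEnd H (i + 1) := by
    rw [stageEnd_succ]; exact_mod_cast Nat.le_add_left _ _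
  have hn0' : (0 : ℝ) < stageEnd H (i + 1) := hnc0'.trans_le hncn
  have hq0 : 0 ≤ M.maxVar := M.maxVar_nonneg
  have hι0 : 0 < ι := by linarith
  have e1 := (abs_le.1 (abs_visitSum_sub_le_freedman (lo := 0) (hE.star h s a) hH0
    (fun j _ t => by rw [abs_of_nonneg (M.Vstar_nonneg _ _)]; exact M.Vstar_le _ _)
    (by linarith) (Nat.zero_le _) hK)).2
  rw [← average_expectSum_const hn0' hn (M.Vstar (h + 1)), ← sub_div, div_le_iff₀ hn0']
  refine e1.trans ?_
  have e2 : cvarSum M x p K h s a 0 (stageEnd H (i + 1)) (fun _ t => M.Vstar (h + 1) t) ≤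
      stageEnd H (i + 1) * M.maxVar := by
    rw [cvarSum, sum_const, nsmul_eq_mul, ← hn]
    exact mul_le_mul_of_nonneg_left (M.cvar_le_maxVar h s a) hn0'.le
  have e3 : √(ι / 4 * cvarSum M x p K h s a 0 (stageEnd H (i + 1))
      (fun _ t => M.Vstar (h + 1) t)) ≤
      √(M.maxVar * ι / stageEnd H (i + 1)) * stageEnd H (i + 1) / 2 := by
    refine Real.sqrt_le_iff.2 ⟨by positivity, ?_⟩
    rw [div_pow, mul_pow, Real.sq_sqrt (by positivity)]
    have e4 := mul_le_mul_of_nonneg_left e2 (show 0 ≤ ι / 4 by linarith)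
    have e5 : M.maxVar * ι / stageEnd H (i + 1) * (stageEnd H (i + 1) : ℝ) ^ 2 / 2 ^ 2 =
        ι / 4 * (stageEnd H (i + 1) * M.maxVar) := by field_simp; norm_num
    linarith only [e4, e5]
  have e6 : (H : ℝ) * ι ≤ H * (ι / stageLen H i) * stageEnd H (i + 1) := by
    rw [mul_div_assoc', div_mul_eq_mul_div, le_div_iff₀ hnc0']
    exact mul_le_mul_of_nonneg_left hncn (by positivity)
  have e7 : 0 ≤ (H : ℝ) * ι := by positivity
  linarith only [e3, e6, e7]

/-- The settled parts of the reference values are increasing in time, so that, up to deviations,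
their average over all visits is at most their average over the last stage. -/
lemma RefBounds.average_settledAdv_le [Nonempty A] (hι : 1 ≤ ι) (hβ : 0 < β')
    (hE : ConcentrationEvent M ι N₀ x p K β') (hb : RefBounds M ι N₀ x p K h s a i β' U) :
    visitSum x p K h s a 0 (stageEnd H (i + 1)) (settledAdv M ι N₀ x p h)
        / stageEnd H (i + 1)
      - visitSum x p K h s a (stageEnd H i) (stageEnd H (i + 1)) (settledAdv M ι N₀ x p h)
        / stageLen H i ≤ 4 * (β' * √(ι / stageLen H i)) := by
  have hH : 1 ≤ H := (Nat.zero_le _).trans_lt h.2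
  have hj := hb.count
  have hK := hj.trans (visitCount_le _ _ _ K)
  have hlt := stageEnd_strictMono hH (Nat.lt_succ_self i)
  have hn := card_window_all hj
  have hnc := card_window_stage hj
  have hnc0' : (0 : ℝ) < stageLen H i := by exact_mod_cast stageLen_pos hH i
  have hncn : (stageLen H i : ℝ) ≤ stageEnd H (i + 1) := by
    rw [stageEnd_succ]; exact_mod_cast Nat.le_add_left _ _
  have hn0' : (0 : ℝ) < stageEnd H (i + 1) := hnc0'.trans_le hncn
  have hsub := window_stage_subset x p K h s a i
  have hbd : ∀ j ∈ window (Visit x p h s a) K 0 (stageEnd H (i + 1)), ∀ t,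
      |settledAdv M ι N₀ x p h j t| ≤ β' := fun j hj' t => by
    rw [abs_of_nonneg (hb.settled_nonneg j hj' t)]; exact hb.settled_le j hj' t
  have e1 := (abs_le.1 (abs_average_sub_le_hoeffding hι (hE.settled h s a) hβ hbd
    (Nat.zero_le _) hK hn hn0')).2
  have e2 := (abs_le.1 (abs_average_sub_le_hoeffding hι (hE.settled h s a) hβ
    (fun j hj' => hbd j (hsub hj')) (hlt.le.trans hK) hK hnc hnc0')).1
  have e3 : √(ι / stageEnd H (i + 1)) ≤ √(ι / stageLen H i) :=
    Real.sqrt_le_sqrt (div_le_div_of_nonneg_left (by linarith) hnc0' hncn)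
  have e4 : expectSum M x p K h s a 0 (stageEnd H (i + 1)) (settledAdv M ι N₀ x p h)
        / stageEnd H (i + 1) ≤
      expectSum M x p K h s a (stageEnd H i) (stageEnd H (i + 1)) (settledAdv M ι N₀ x p h)
        / stageLen H i := by
    have := average_window_le_of_antitone (K := K) (v := Visit x p h s a) hj hlt
      (F := fun j => - M.expect h s a (settledAdv M ι N₀ x p h j))
      (fun j j' hjj' hj' => neg_le_neg (M.expect_mono h s a fun t =>
        settledAdv_mono hjj' (hb.opt j' (hsub hj')) t))
    rw [show stageEnd H (i + 1) - stageEnd H i = stageLen H i by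
      rw [stageEnd_succ, Nat.add_sub_cancel_left], sum_neg_distrib, sum_neg_distrib, neg_div,
      neg_div] at this
    exact neg_le_neg_iff.1 this
  have e5 := mul_le_mul_of_nonneg_left e3 hβ.le
  linarith only [e1, e2, e4, e5]

lemma RefBounds.visitSum_obsRef_le (hb : RefBounds M ι N₀ x p K h s a i β' U) :
    visitSum x p K h s a 0 (stageEnd H (i + 1)) (obsRef M.r ι N₀ x p h) ≤
      visitSum x p K h s a 0 (stageEnd H (i + 1)) (fun _ t => M.Vstar (h + 1) t) +
      visitSum x p K h s a 0 (stageEnd H (i + 1)) (settledAdv M ι N₀ x p h) + H * U := by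
  have e1 : visitSum x p K h s a 0 (stageEnd H (i + 1)) (obsRef M.r ι N₀ x p h) ≤
      ∑ j ∈ window (Visit x p h s a) K 0 (stageEnd H (i + 1)),
        (M.Vstar (h + 1) (x j h.succ) + settledAdv M ι N₀ x p h j (x j h.succ)
          + H * unsettled N₀ x h j (x j h.succ)) :=
    sum_le_sum fun j hj' => by linarith [hb.adv_le j hj' (x j h.succ)]
  refine e1.trans ?_
  rw [sum_add_distrib, sum_add_distrib, ← mul_sum]
  exact add_le_add le_rfl (mul_le_mul_of_nonneg_left hb.unsettled_le (Nat.cast_nonneg H))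

lemma RefBounds.visitSum_adv_le (hb : RefBounds M ι N₀ x p K h s a i β' U) :
    visitSum x p K h s a (stageEnd H i) (stageEnd H (i + 1))
        (fun j t => obsV M.r ι N₀ x p h j t - obsRef M.r ι N₀ x p h j t) ≤
      visitSum x p K h s a (stageEnd H i) (stageEnd H (i + 1))
        (fun j t => obsV M.r ι N₀ x p h j t - M.Vstar (h + 1) t) -
      visitSum x p K h s a (stageEnd H i) (stageEnd H (i + 1)) (settledAdv M ι N₀ x p h) := by
  rw [← visitSum_sub]
  exact sum_le_sum fun j hj' => by
    linarith [hb.settled_le_adv j (window_stage_subset x p K h s a i hj') (x j h.succ)]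

/-- The estimate of the reference-advantage update at the end of a stage: the deviations of the
settled part of the reference values are of order `β'`, since these values are `β'`-accurate, and
the deviations of `V⋆` itself are controlled by its variance. -/
lemma RefBounds.advEst_sub_Qstar_le [Nonempty A] (hι : 1 ≤ ι) (hβ : 0 < β') (hU : 0 ≤ U)
    (hE : ConcentrationEvent M ι N₀ x p K β') (hb : RefBounds M ι N₀ x p K h s a i β' U) :
    advEst M.r ι N₀ x p K h s a i - M.Qstar h s a ≤
      (5 * √(M.maxVar * ι / stageEnd H (i + 1)) + 14 * (β' * √(ι / stageLen H i)))
        + ι / stageLen H i * (21 * H ^ 2 + 5 * H ^ 2 / β')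
        + U * (5 / 2 * H / stageEnd H (i + 1) + 1 / stageLen H i)
        + visitSum x p K h s a (stageEnd H i) (stageEnd H (i + 1))
          (fun j t => obsV M.r ι N₀ x p h j t - M.Vstar (h + 1) t) / stageLen H i := by
  have hH : 1 ≤ H := (Nat.zero_le _).trans_lt h.2
  have hH1 : (1 : ℝ) ≤ H := by exact_mod_cast hH
  have hnc0 : 0 < stageLen H i := stageLen_pos hH i
  have hnc0' : (0 : ℝ) < stageLen H i := by exact_mod_cast hnc0
  have hncn : stageLen H i ≤ stageEnd H (i + 1) := by rw [stageEnd_succ]; omega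
  have hn0' : (0 : ℝ) < stageEnd H (i + 1) := by exact_mod_cast hnc0.trans_le hncn
  have hbonus := advBonus_le hH hι hnc0 hncn M.maxVar_nonneg hβ hU (hb.refVariance_le hι hE)
    hb.advVariance_le
  have hstar := average_Vstar_sub_le_variance hι hE hb.count
  have hset := hb.average_settledAdv_le hι hβ hE
  have hdiv1 := div_le_div_of_nonneg_right hb.visitSum_obsRef_le hn0'.le
  have hdiv2 := div_le_div_of_nonneg_right hb.visitSum_adv_le hnc0'.le
  rw [add_div, add_div] at hdiv1
  rw [sub_div] at hdiv2
  have hHH : H * (ι / stageLen H i) ≤ ι / stageLen H i * H ^ 2 := by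
    rw [mul_comm]
    refine mul_le_mul_of_nonneg_left ?_ (by positivity)
    nlinarith
  have e1 : ι / stageLen H i * (21 * (H : ℝ) ^ 2 + 5 * H ^ 2 / β') =
      ι / stageLen H i * (20 * H ^ 2 + 5 * H ^ 2 / β') + ι / stageLen H i * H ^ 2 := by ring
  have e2 : U * (5 / 2 * H / stageEnd H (i + 1) + 1 / stageLen H i) =
      U * (3 / 2 * H / stageEnd H (i + 1) + 1 / stageLen H i) + H * U / stageEnd H (i + 1) := by
    ring
  rw [advEst, MDP.Qstar, e1, e2]
  linarith only [hbonus, hstar, hset, hdiv1, hdiv2, hHH]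

end StageBounds

/-- The local error bound that the reference-advantage update provides. -/
lemma ownError_le_advantage [Nonempty A] {β' : ℝ} (hι : 1 ≤ ι) (hβ : 0 < β')
    (hE : ConcentrationEvent M ι N₀ x p K β') (hacc : RefAccurate M ι N₀ x p K β')
    {h : Fin H} {k i : ℕ} (hk : k < K)
    (hi : visitStage x p h (x k h.castSucc) (p k h (x k h.castSucc)) k = i + 1) :
    ownError M ι N₀ x p h k ≤
      √(5000 * ((M.maxVar + β' ^ 2 * H) * ι) / ((ownCount x p h k : ℝ) + 1))
        + 12 * H * ι * (21 * H ^ 2 + 5 * H ^ 2 / β') * (1 / ((ownCount x p h k : ℝ) + 1))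
        + 20 * H * (ownUnsettled N₀ x p h k * (1 / ((ownCount x p h k : ℝ) + 1)))
        + visitSum x p K h (x k h.castSucc) (p k h (x k h.castSucc)) (stageEnd H i)
          (stageEnd H (i + 1)) (fun j t => obsV M.r ι N₀ x p h j t - M.Vstar (h + 1) t)
          / stageLen H i := by
  have hH : 1 ≤ H := (Nat.zero_le _).trans_lt h.2
  have hH0 : (0 : ℝ) < H := by exact_mod_cast hH
  have hj := stageEnd_le_visitCount hk hi
  have hest := (algState_Q_le_est (M := M) (ι := ι) (N₀ := N₀) hk.le hi).2
  obtain ⟨hm3, hm12, hcount⟩ := ownCount_succ_le hi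
  have hopt : ∀ j ∈ window (Visit x p h (x k h.castSucc) (p k h (x k h.castSucc))) K 0
      (stageEnd H (i + 1)), j ≤ K ∧ Optimistic M ι N₀ x p j := fun j hj' =>
    ⟨(mem_window.1 hj').1.le, optimistic hι hE (mem_window.1 hj').1.le⟩
  have hall := fun j (hj' : j ∈ window (Visit x p h (x k h.castSucc) (p k h (x k h.castSucc))) K 0
      (stageEnd H (i + 1))) t =>
    obsRef_sub_Vstar_bounds hβ.le hacc (hopt j hj').1 (hopt j hj').2 h t
  have hb : RefBounds M ι N₀ x p K h (x k h.castSucc) (p k h (x k h.castSucc)) i β'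
      (ownUnsettled N₀ x p h k) :=
    { count := hj
      opt := fun j hj' => (hopt j hj').2
      settled_nonneg := fun j hj' t => (hall j hj' t).1
      settled_le := fun j hj' t => (hall j hj' t).2.1
      settled_le_adv := fun j hj' t => (hall j hj' t).2.2.1
      adv_le := fun j hj' t => (hall j hj' t).2.2.2.1
      adv_sq_le := fun j hj' t => (hall j hj' t).2.2.2.2
      unsettled_le := by
        refine sum_le_sum_of_subset_of_nonneg ?_ fun j _ _ => unsettled_nonneg N₀ x h j _
        intro j hj'
        exact mem_filter.2 ⟨mem_range.2 (lt_of_mem_window hj' hcount), (mem_window.1 hj').2.1⟩ }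
  have hU0 : 0 ≤ ownUnsettled N₀ x p h k := ownUnsettled_nonneg N₀ x p h k
  have hmain := hb.advEst_sub_Qstar_le hι hβ hU0 hE
  rw [ownError_fin]
  set U := ownUnsettled N₀ x p h k
  set m : ℝ := (ownCount x p h k : ℝ) + 1 with hm
  have hm0 : 0 < m := by positivity
  have hnc0' : (0 : ℝ) < stageLen H i := by exact_mod_cast stageLen_pos hH i
  have hn0' : (0 : ℝ) < stageEnd H (i + 1) := by linarith
  set q := M.maxVar with hq
  have hq0 : 0 ≤ q := M.maxVar_nonneg
  have hι0 : 0 < ι := by linarith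
  have hinv3 : 1 / (stageEnd H (i + 1) : ℝ) ≤ 3 * (1 / m) := by
    rw [mul_one_div, div_le_div_iff₀ hn0' hm0]; linarith
  have hinv12 : 1 / (stageLen H i : ℝ) ≤ 12 * H * (1 / m) := by
    rw [mul_one_div, div_le_div_iff₀ hnc0' hm0]; linarith
  have hlead : 5 * √(q * ι / stageEnd H (i + 1)) + 14 * (β' * √(ι / stageLen H i)) ≤
      √(5000 * ((q + β' ^ 2 * H) * ι) / m) := by
    refine Real.le_sqrt_of_sq_le ?_
    have e1 : (5 * √(q * ι / stageEnd H (i + 1))) ^ 2 ≤ 75 * (q * ι * (1 / m)) := by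
      rw [mul_pow, Real.sq_sqrt (by positivity)]
      have := mul_le_mul_of_nonneg_left hinv3 (show 0 ≤ q * ι by positivity)
      rw [mul_one_div] at this
      linarith only [this]
    have e2 : (14 * (β' * √(ι / stageLen H i))) ^ 2 ≤ 2352 * (β' ^ 2 * H * ι * (1 / m)) := by
      rw [mul_pow, mul_pow, Real.sq_sqrt (by positivity)]
      have := mul_le_mul_of_nonneg_left hinv12 (show 0 ≤ β' ^ 2 * ι by positivity)
      have e3 : β' ^ 2 * (ι / stageLen H i) = β' ^ 2 * ι * (1 / stageLen H i) := by ring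
      rw [e3]
      linarith only [this]
    have e3 : 5000 * ((q + β' ^ 2 * H) * ι) / m =
        5000 * (q * ι * (1 / m)) + 5000 * (β' ^ 2 * H * ι * (1 / m)) := by ring
    have e4 : 0 ≤ q * ι * (1 / m) := by positivity
    have e5 : 0 ≤ β' ^ 2 * H * ι * (1 / m) := by positivity
    rw [e3]
    linarith only [e1, e2, e4, e5,
      sq_nonneg (5 * √(q * ι / stageEnd H (i + 1)) - 14 * (β' * √(ι / stageLen H i)))]
  have hG : ι / stageLen H i * (21 * H ^ 2 + 5 * H ^ 2 / β') ≤
      12 * H * ι * (21 * H ^ 2 + 5 * H ^ 2 / β') * (1 / m) := by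
    have := mul_le_mul_of_nonneg_left hinv12
      (show 0 ≤ ι * (21 * (H : ℝ) ^ 2 + 5 * H ^ 2 / β') by positivity)
    have e1 : ι / stageLen H i * (21 * (H : ℝ) ^ 2 + 5 * H ^ 2 / β') =
      ι * (21 * (H : ℝ) ^ 2 + 5 * H ^ 2 / β') * (1 / stageLen H i) := by ring
    rw [e1]
    linarith only [this]
  have hL : U * (5 / 2 * H / stageEnd H (i + 1) + 1 / stageLen H i) ≤ 20 * H * (U * (1 / m)) := by
    have e1 := mul_le_mul_of_nonneg_left hinv3 (show 0 ≤ H * U by positivity)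
    have e2 := mul_le_mul_of_nonneg_left hinv12 hU0
    have e3 : U * (5 / 2 * H / stageEnd H (i + 1) + 1 / stageLen H i) =
        5 / 2 * (H * U * (1 / stageEnd H (i + 1))) + U * (1 / stageLen H i) := by ring
    have e4 : 0 ≤ H * (U * (1 / m)) := by positivity
    rw [e3]
    linarith only [e1, e2, e4]
  linarith only [hest, hmain, hlead, hG, hL]

end LocalBounds

/-! ### The regret bound on the concentration event -/

section GapSums

variable {S A : Type*} [Fintype S] [Fintype A] [DecidableEq S] [DecidableEq A] {H : ℕ}
  {M : MDP S A H} {ι : ℝ} {N₀ : ℕ} {x : ℕ → Fin (H + 1) → S} {p : ℕ → Fin H → S → A} {K : ℕ}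

variable (M x p) in
/-- The gap of the action taken at step `h` of episode `k`. -/
def ownGap (h : Fin H) (k : ℕ) : ℝ := M.gap h (x k h.castSucc) (p k h (x k h.castSucc))

lemma ownGap_nonneg [Nonempty A] (h : Fin H) (k : ℕ) : 0 ≤ ownGap M x p h k := M.gap_nonneg _ _ _

lemma ownGap_le [Nonempty A] (h : Fin H) (k : ℕ) : ownGap M x p h k ≤ H := M.gap_le _ _ _

/-- Optimism turns the error of the estimate into an upper bound of the gap. -/
lemma ownGap_le_ownError [Nonempty A] (hg : Greedy M ι N₀ x p K) {k : ℕ} (hk : k < K)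
    (ho : Optimistic M ι N₀ x p k) (h : Fin H) : ownGap M x p h k ≤ ownError M ι N₀ x p h k := by
  rw [ownError_fin, ownGap, MDP.gap]
  refine sub_le_sub_right ((ho.Vstar_le_V h _).trans ?_) _
  rw [algState_V]
  exact ciSup_le fun a => hg k hk h _ a

/-- The sum of the gaps at one step. The episodes with a positive gap enter the weighted error
bound with weight `1`; their number is at most the sum of the gaps divided by the minimum gap, so
that the term proportional to the number can be absorbed by the left-hand side. -/
lemma sum_ownGap_le [Nonempty A] {β' : ℝ} (hι : 1 ≤ ι) (hβ : 0 < β') (hN1 : 1 ≤ N₀)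
    (hN : 5000 * (Fintype.card S * Fintype.card A * (H : ℝ) ^ 5 * ι) / β' ^ 2 ≤ N₀)
    (hgap : ∃ h s a, 0 < M.gap h s a)
    (hg : Greedy M ι N₀ x p K) (hE : ConcentrationEvent M ι N₀ x p K β') (h : Fin H) :
    ∑ k ∈ range K, ownGap M x p h k ≤
      6 * H * (Fintype.card S * Fintype.card A * ((H : ℝ) ^ 2
        + 20000 * H * ((M.maxVar + β' ^ 2 * H) * ι) / M.gapMin
        + 12 * H * ι * (21 * H ^ 2 + 5 * H ^ 2 / β') * (1 + Real.log K))
        + 20 * H * (Fintype.card S * N₀ * (1 + Real.log K))) := by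
  have hH : 1 ≤ H := (Nat.zero_le _).trans_lt h.2
  have hH0 : (0 : ℝ) < H := by exact_mod_cast hH
  have hmin := M.gapMin_pos hgap
  have hq := M.maxVar_nonneg
  have hacc : RefAccurate M ι N₀ x p K β' := by
    intro h s j hj hs
    exact Vref_sub_Vstar_le_of_settled hι hβ hE hg hN hN1 hj hs
  set R := ∑ k ∈ range K, ownGap M x p h k with hR
  set w : ℕ → ℝ := fun k => if 0 < ownGap M x p h k then 1 else 0 with hw
  have hw0 : ∀ k < K, 0 ≤ w k := fun k _ => by simp only [hw]; split_ifs <;> norm_num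
  have hw1 : ∀ k < K, w k ≤ 1 := fun k _ => by simp only [hw]; split_ifs <;> norm_num
  have hRle : R ≤ ∑ k ∈ range K, w k * ownError M ι N₀ x p h k := by
    refine sum_le_sum fun k hk => ?_
    have hk' := mem_range.1 hk
    simp only [hw]
    split_ifs with hpos
    · rw [one_mul]
      exact ownGap_le_ownError hg hk' (optimistic hι hE hk'.le) h
    · rw [zero_mul]; exact not_lt.1 hpos
  have hWle : M.gapMin * ∑ k ∈ range K, w k ≤ R := by
    rw [mul_sum]
    refine sum_le_sum fun k _ => ?_
    simp only [hw]
    split_ifs with hpos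
    · rw [mul_one]; exact M.gapMin_le _ _ _ hpos
    · rw [mul_zero]; exact ownGap_nonneg h k
  -- `H ε W` is half of `Δ_min W`, hence at most half of the sum of the gaps
  have hmain := sum_mul_ownError_le
    (D := 5000 * ((M.maxVar + β' ^ 2 * H) * ι))
    (G := 12 * H * ι * (21 * H ^ 2 + 5 * H ^ 2 / β')) (L := 20 * H) (ε := M.gapMin / (2 * H))
    (by positivity) (by positivity) (by positivity) (by positivity) hg
    (fun h k hk i hi => ownError_le_advantage hι hβ hE hacc hk hi) h hw0 hw1 le_rfl
  have e1 : (H : ℝ) * (M.gapMin / (2 * H) * ∑ k ∈ range K, w k) =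
      M.gapMin * (∑ k ∈ range K, w k) / 2 := by
    field_simp
  have e2 : 2 * (5000 * ((M.maxVar + β' ^ 2 * H) * ι)) / (M.gapMin / (2 * H)) =
      20000 * H * ((M.maxVar + β' ^ 2 * H) * ι) / M.gapMin := by
    field_simp
    ring
  rw [mul_add, e1, e2] at hmain
  linarith only [hmain, hRle, hWle]

/-- All terms of the regret bound other than the one with the minimum gap are bounded by the
second term of the theorem. -/
lemma remainder_le {n a H β ι ℓ κ c₀ N : ℝ} (hn : 1 ≤ n) (ha : 1 ≤ a) (hH : 1 ≤ H) (hβ : 0 < β)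
    (hβH : β ≤ H) (hι : 1 ≤ ι) (hℓ : 1 ≤ ℓ) (hκ : 0 < κ) (hc₀ : 0 < c₀)
    (hN : N ≤ c₀ * n * a * H ^ 5 * ι / β ^ 2 + 1) :
    H * (6 * H * (n * a * (H ^ 2 + 12 * H * ι * (21 * H ^ 2 + 5 * H ^ 2 / (κ * β)) * ℓ)
        + 20 * H * (n * N * ℓ))) + 1 ≤
      (1639 + 360 / κ + 120 * c₀) * (H ^ 8 * n ^ 2 * a * (ι * ℓ) / β ^ 2) := by
  have h1 : 1 ≤ H / β := (one_le_div hβ).2 hβH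
  have hB : H ^ 8 * n ^ 2 * a * (ι * ℓ) / β ^ 2 = (H / β) ^ 2 * (H ^ 6 * n ^ 2 * a * (ι * ℓ)) := by
    field_simp
  have h2 : 1 ≤ (H / β) ^ 2 := one_le_pow₀ h1
  have hιℓ : 1 ≤ ι * ℓ := one_le_mul_of_one_le_of_one_le hι hℓ
  set B := H ^ 8 * n ^ 2 * a * (ι * ℓ) / β ^ 2 with hBdef
  -- with `u = H / β ≥ 1`, every term is a constant times a product that is smaller than `B` factor
  -- by factor
  have key : ∀ (i j : ℕ) (z y v : ℝ), i ≤ 2 → j ≤ 6 → 0 ≤ z → z ≤ n ^ 2 → 0 ≤ y → y ≤ a → 0 ≤ v →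
      v ≤ ι * ℓ → (H / β) ^ i * (H ^ j * z * y * v) ≤ B := by
    intro i j z y v hi hj hz0 hz hy0 hy hv0 hv
    rw [hB]
    have := pow_le_pow_right₀ h1 hi
    have := pow_le_pow_right₀ hH hj
    gcongr
  have hn2 : n ≤ n ^ 2 := by nlinarith
  have hℓ' : ℓ ≤ ι * ℓ := by nlinarith
  have k0 := key 0 0 1 1 1 (by norm_num) (by norm_num) (by norm_num) (one_le_pow₀ hn) (by norm_num)
    ha (by norm_num) hιℓ
  have k1 := key 0 4 n a 1 (by norm_num) (by norm_num) (by linarith) hn2 (by linarith)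
    le_rfl (by norm_num) hιℓ
  have k2 := key 0 5 n a (ι * ℓ) (by norm_num) (by norm_num) (by linarith) hn2 (by linarith)
    le_rfl (by linarith) le_rfl
  have k3 := key 1 4 n a (ι * ℓ) (by norm_num) (by norm_num) (by linarith) hn2 (by linarith)
    le_rfl (by linarith) le_rfl
  have k4 := key 2 6 (n ^ 2) a (ι * ℓ) (by norm_num) (by norm_num) (by positivity) le_rfl
    (by linarith) le_rfl (by linarith) le_rfl
  have k5 := key 0 3 n 1 ℓ (by norm_num) (by norm_num) (by linarith) hn2 (by norm_num)
    ha (by linarith) hℓ'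
  have hNmul : n * N * ℓ ≤ n * (c₀ * n * a * H ^ 5 * ι / β ^ 2 + 1) * ℓ := by gcongr
  have hN' := mul_le_mul_of_nonneg_left hNmul (show 0 ≤ 120 * H ^ 3 by positivity)
  have e : H * (6 * H * (n * a * (H ^ 2 + 12 * H * ι * (21 * H ^ 2 + 5 * H ^ 2 / (κ * β)) * ℓ)
        + 20 * H * (n * N * ℓ))) + 1 =
      6 * (H ^ 4 * n * a) + 1512 * (H ^ 5 * n * a * (ι * ℓ))
        + 360 / κ * (H / β * (H ^ 4 * n * a * (ι * ℓ))) + 120 * H ^ 3 * (n * N * ℓ) + 1 := by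
    field_simp
    ring
  have e' : 120 * H ^ 3 * (n * (c₀ * n * a * H ^ 5 * ι / β ^ 2 + 1) * ℓ) =
      120 * c₀ * ((H / β) ^ 2 * (H ^ 6 * n ^ 2 * a * (ι * ℓ))) + 120 * (H ^ 3 * n * ℓ) := by
    field_simp
  have k3' := mul_le_mul_of_nonneg_left k3 (show 0 ≤ 360 / κ by positivity)
  have k4' := mul_le_mul_of_nonneg_left k4 (show 0 ≤ 120 * c₀ by positivity)
  simp only [pow_zero, pow_one, one_mul, mul_one] at k0 k1 k2 k3' k5
  rw [e]
  rw [e'] at hN'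
  linarith only [hN', k0, k1, k2, k3', k4', k5]

/-- The sum of all gaps on the concentration event, where the reference values are accurate up to
`κ * β`. -/
theorem sum_sum_ownGap_le [Nonempty S] [Nonempty A] {β c₀ κ : ℝ} (hι : 1 ≤ ι) (hβ : 0 < β)
    (hβH : β ≤ H) (hc₀ : 0 < c₀) (hκ : 0 < κ) (hκc : κ ^ 2 * c₀ = 5000)
    (hgap : ∃ h s a, 0 < M.gap h s a)
    (hg : Greedy M ι (settleCount S A H c₀ β ι) x p K)
    (hE : ConcentrationEvent M ι (settleCount S A H c₀ β ι) x p K (κ * β)) :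
    ∑ k ∈ range K, ∑ h : Fin H, ownGap M x p h k + 1 ≤
      120000 * (1 + κ ^ 2) * ((M.maxVar + β ^ 2 * H) * H ^ 3 * Fintype.card S * Fintype.card A * ι
          / M.gapMin)
        + (1639 + 360 / κ + 120 * c₀) * ((H : ℝ) ^ 8 * (Fintype.card S : ℝ) ^ 2 * Fintype.card A
          * (ι * (1 + Real.log K)) / β ^ 2) := by
  obtain ⟨h₀, -⟩ := id hgap
  have hH : (1 : ℝ) ≤ H := by exact_mod_cast (Nat.zero_le _).trans_lt h₀.2
  have hn : (1 : ℝ) ≤ Fintype.card S := by exact_mod_cast Fintype.card_pos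
  have ha : (1 : ℝ) ≤ Fintype.card A := by exact_mod_cast Fintype.card_pos
  have hmin := M.gapMin_pos hgap
  have hq := M.maxVar_nonneg
  have hℓ : (1 : ℝ) ≤ 1 + Real.log K := le_add_of_nonneg_right (Real.log_natCast_nonneg K)
  have hN1 : 1 ≤ settleCount S A H c₀ β ι := Nat.one_le_ceil_iff.2 (by positivity)
  have hN2 : 5000 * (Fintype.card S * Fintype.card A * (H : ℝ) ^ 5 * ι) / (κ * β) ^ 2 ≤
      (settleCount S A H c₀ β ι : ℕ) := by
    refine le_trans (le_of_eq ?_) (Nat.le_ceil _)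
    rw [← hκc]
    field_simp
  have hN3 : ((settleCount S A H c₀ β ι : ℕ) : ℝ) ≤
      c₀ * Fintype.card S * Fintype.card A * (H : ℝ) ^ 5 * ι / β ^ 2 + 1 :=
    (Nat.ceil_lt_add_one (by positivity)).le
  have hsum : ∑ k ∈ range K, ∑ h : Fin H, ownGap M x p h k ≤ H * (6 * H * (Fintype.card S *
      Fintype.card A * ((H : ℝ) ^ 2 + 20000 * H * ((M.maxVar + (κ * β) ^ 2 * H) * ι) / M.gapMin
        + 12 * H * ι * (21 * H ^ 2 + 5 * H ^ 2 / (κ * β)) * (1 + Real.log K))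
        + 20 * H * (Fintype.card S * settleCount S A H c₀ β ι * (1 + Real.log K)))) := by
    rw [sum_comm]
    refine (sum_le_sum fun h _ =>
      sum_ownGap_le hι (mul_pos hκ hβ) hN1 hN2 hgap hg hE h).trans_eq ?_
    rw [sum_const, card_univ, Fintype.card_fin, nsmul_eq_mul]
  have hrem := remainder_le hn ha hH hβ hβH hι hℓ hκ hc₀ hN3
  have hmain : 120000 * ((M.maxVar + κ ^ 2 * β ^ 2 * H) * H ^ 3 * Fintype.card S * Fintype.card A
      * ι / M.gapMin) ≤ 120000 * (1 + κ ^ 2) * ((M.maxVar + β ^ 2 * H) * H ^ 3 * Fintype.card S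
      * Fintype.card A * ι / M.gapMin) := by
    have e1 : M.maxVar + κ ^ 2 * β ^ 2 * H ≤ (1 + κ ^ 2) * (M.maxVar + β ^ 2 * H) := by
      have : 0 ≤ κ ^ 2 * M.maxVar + β ^ 2 * H := by positivity
      linarith
    have e2 : 120000 * (1 + κ ^ 2) * ((M.maxVar + β ^ 2 * H) * H ^ 3 * Fintype.card S
      * Fintype.card A * ι / M.gapMin) = 120000 * (((1 + κ ^ 2) * (M.maxVar + β ^ 2 * H)) * H ^ 3
      * Fintype.card S * Fintype.card A * ι / M.gapMin) := by ring
    rw [e2]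
    gcongr
  have e : (H : ℝ) * (6 * H * (Fintype.card S *
      Fintype.card A * ((H : ℝ) ^ 2 + 20000 * H * ((M.maxVar + (κ * β) ^ 2 * H) * ι) / M.gapMin
        + 12 * H * ι * (21 * H ^ 2 + 5 * H ^ 2 / (κ * β)) * (1 + Real.log K))
        + 20 * H * (Fintype.card S * settleCount S A H c₀ β ι * (1 + Real.log K)))) =
      120000 * ((M.maxVar + κ ^ 2 * β ^ 2 * H) * H ^ 3 * Fintype.card S * Fintype.card A
        * ι / M.gapMin) + H * (6 * H * (Fintype.card S * Fintype.card A * ((H : ℝ) ^ 2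
        + 12 * H * ι * (21 * H ^ 2 + 5 * H ^ 2 / (κ * β)) * (1 + Real.log K))
        + 20 * H * (Fintype.card S * settleCount S A H c₀ β ι * (1 + Real.log K)))) := by
    ring
  rw [e] at hsum
  linarith only [hsum, hrem, hmain]

end GapSums

/-! ### Functions of the observed history -/

section History

variable {S A Ω : Type*} [Fintype S] [Fintype A] [DecidableEq S] [DecidableEq A]
  {mΩ : MeasurableSpace Ω} {H : ℕ} {M : MDP S A H} {ι : ℝ} {N₀ K : ℕ}
  {μ : Measure Ω} {ℱ : Filtration ℕ mΩ}
  {X : ℕ → Fin (H + 1) → Ω → S} {π : ℕ → Ω → Fin H → S → A}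

/-- Two sample points agree in the policies up to episode `k` and in the states up to the `h`-th
state of episode `k`. -/
structure SamePast (X : ℕ → Fin (H + 1) → Ω → S) (π : ℕ → Ω → Fin H → S → A) (k : ℕ)
    (h : Fin (H + 1)) (ω ω' : Ω) : Prop where
  state : ∀ j < k, ∀ i, X j i ω = X j i ω'
  state_last : ∀ i ≤ h, X k i ω = X k i ω'
  policy : ∀ j ≤ k, π j ω = π j ω'

/-- A function of the observed history is measurable with respect to the information at that time,
because the history takes finitely many values, each on a measurable set. -/
lemma IsRun.measurable_of_samePast {β : Type*} [MeasurableSpace β]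
    (hrun : IsRun M ι N₀ K μ ℱ X π) {k : ℕ} (hk : k < K) (h : Fin (H + 1)) {f : Ω → β}
    (hf : ∀ ω ω', SamePast X π k h ω ω' → f ω = f ω') : Measurable[ℱ (k * (H + 1) + h)] f := by
  intro B _
  -- the atoms of the history
  let F : (Fin (k + 1) → Fin (H + 1) → S) × (Fin (k + 1) → Fin H → S → A) → Set Ω := fun y =>
    {ω | (∀ (j : Fin (k + 1)) (i : Fin (H + 1)), ((j : ℕ) < k ∨ i ≤ h) → X j i ω = y.1 j i) ∧
      ∀ j : Fin (k + 1), π j ω = y.2 j}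
  have hmono : ∀ {n}, n ≤ k * (H + 1) + h → ∀ {s}, MeasurableSet[ℱ n] s →
      MeasurableSet[ℱ (k * (H + 1) + h)] s := fun hn s hs => ℱ.mono hn s hs
  have hlt : ∀ {j}, j < k → (j + 1) * (H + 1) ≤ k * (H + 1) := fun hj =>
    Nat.mul_le_mul_right _ hj
  have hF : ∀ y, MeasurableSet[ℱ (k * (H + 1) + h)] (F y) := by
    intro y
    simp only [F, Set.ofPred_and, Set.ofPred_forall]
    refine MeasurableSet.inter ?_ ?_
    · refine MeasurableSet.iInter fun j => MeasurableSet.iInter fun i =>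
        MeasurableSet.iInter fun hji => ?_
      have hjk : (j : ℕ) ≤ k := Nat.lt_succ_iff.1 j.2
      refine hmono ?_ (hrun.measurable_state j (hjk.trans_lt hk) i (y.1 j i))
      rcases hjk.lt_or_eq with hj | hj
      · have := hlt hj
        have := i.2
        rw [add_mul] at *
        omega
      · rw [hj]
        have : i ≤ h := hji.resolve_left (by omega)
        exact Nat.add_le_add_left this _
    · refine MeasurableSet.iInter fun j => ?_
      have hjk : (j : ℕ) ≤ k := Nat.lt_succ_iff.1 j.2
      exact hmono (le_trans (Nat.mul_le_mul_right _ hjk) (Nat.le_add_right _ _))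
        (hrun.measurable_policy j (hjk.trans_lt hk) (y.2 j))
  have hB : f ⁻¹' B = ⋃ y, ⋃ (_ : F y ⊆ f ⁻¹' B), F y := by
    ext ω
    simp only [Set.mem_iUnion]
    refine ⟨fun hω => ⟨(fun j i => X j i ω, fun j => π j ω), fun ω' hω' => ?_,
      fun _ _ _ => rfl, fun _ => rfl⟩, fun ⟨y, hy, hωy⟩ => hy hωy⟩
    have : SamePast X π k h ω' ω :=
      ⟨fun j hj i => hω'.1 ⟨j, by omega⟩ i (Or.inl hj),
        fun i hi => hω'.1 ⟨k, by omega⟩ i (Or.inr hi), fun j hj => hω'.2 ⟨j, by omega⟩⟩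
    rw [Set.mem_preimage, hf _ _ this]
    exact hω
  rw [hB]
  exact MeasurableSet.iUnion fun y => MeasurableSet.iUnion fun _ => hF y

/-- A function of the observed history takes finitely many values. -/
lemma exists_bound_of_samePast {k : ℕ} {h : Fin (H + 1)} {f : Ω → ℝ}
    (hf : ∀ ω ω', SamePast X π k h ω ω' → f ω = f ω') : ∃ C, ∀ ω, ‖f ω‖ ≤ C := by
  let hist : Ω → (Fin (k + 1) → Fin (H + 1) → S) × (Fin (k + 1) → Fin H → S → A) :=
    fun ω => (fun j i => X j i ω, fun j => π j ω)
  have hfac : Function.FactorsThrough f hist := by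
    intro ω ω' hω
    have h1 := fun j => congrFun (congrArg Prod.fst hω) j
    have h2 := fun j => congrFun (congrArg Prod.snd hω) j
    exact hf _ _ ⟨fun j hj i => congrFun (h1 ⟨j, by omega⟩) i,
      fun i _ => congrFun (h1 ⟨k, by omega⟩) i, fun j hj => h2 ⟨j, by omega⟩⟩
  obtain ⟨g, rfl⟩ := (Function.factorsThrough_iff f).1 hfac
  obtain ⟨C, hC⟩ := (Set.finite_range fun y => ‖g y‖).bddAbove
  exact ⟨C, fun ω => hC ⟨hist ω, rfl⟩⟩

lemma IsRun.integrable_of_samePast [IsFiniteMeasure μ] (hrun : IsRun M ι N₀ K μ ℱ X π) {k : ℕ}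
    (hk : k < K) (h : Fin (H + 1)) {f : Ω → ℝ}
    (hf : ∀ ω ω', SamePast X π k h ω ω' → f ω = f ω') : Integrable f μ := by
  obtain ⟨C, hC⟩ := exists_bound_of_samePast hf
  exact Integrable.of_bound
    ((hrun.measurable_of_samePast hk h hf).mono (ℱ.le _) le_rfl).aestronglyMeasurable C
    (Filter.Eventually.of_forall hC)

/-- Integrating out the next state: given the past, it has the distribution prescribed by the
MDP. -/
lemma IsRun.integral_next [IsProbabilityMeasure μ] (hrun : IsRun M ι N₀ K μ ℱ X π) {k : ℕ}
    (hk : k < K) (h : Fin H) {Z : S → Ω → ℝ}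
    (hZ : ∀ t ω ω', SamePast X π k h.castSucc ω ω' → Z t ω = Z t ω') :
    ∫ ω, Z (X k h.succ ω) ω ∂μ =
      ∫ ω, M.expect h (X k h.castSucc ω) (π k ω h (X k h.castSucc ω)) (fun t => Z t ω) ∂μ := by
  have hindm : ∀ t, MeasurableSet {ω | X k h.succ ω = t} := fun t =>
    ℱ.le _ _ (hrun.measurable_state k hk h.succ t)
  have hZm : ∀ t, Measurable[ℱ (k * (H + 1) + h)] (Z t) := fun t =>
    hrun.measurable_of_samePast hk h.castSucc (hZ t)
  have hind : ∀ t, Integrable ({ω | X k h.succ ω = t}.indicator fun _ => (1 : ℝ)) μ := fun t =>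
    (integrable_const 1).indicator (hindm t)
  have hprod : ∀ t, Integrable
      ({ω | X k h.succ ω = t}.indicator (fun _ => (1 : ℝ)) * Z t) μ := by
    intro t
    obtain ⟨C, hC⟩ := exists_bound_of_samePast (hZ t)
    exact (hind t).mul_bdd (c := C) ((hZm t).mono (ℱ.le _) le_rfl).aestronglyMeasurable
      (Filter.Eventually.of_forall hC)
  have hsum : ∀ ω, Z (X k h.succ ω) ω =
      ∑ t, ({ω | X k h.succ ω = t}.indicator (fun _ => (1 : ℝ)) * Z t) ω := by
    intro ω
    simp [Set.indicator_apply]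
  have hcond : ∀ t, ∫ ω, ({ω | X k h.succ ω = t}.indicator (fun _ => (1 : ℝ)) * Z t) ω ∂μ =
      ∫ ω, M.P h (X k h.castSucc ω) (π k ω h (X k h.castSucc ω)) t * Z t ω ∂μ := by
    intro t
    rw [← integral_condExp (ℱ.le (k * (H + 1) + h))]
    refine integral_congr_ae ?_
    refine (condExp_mul_of_stronglyMeasurable_right (hZm t).stronglyMeasurable (hprod t)
      (hind t)).trans ?_
    filter_upwards [hrun.transition k hk h t] with ω hω
    rw [Pi.mul_apply, hω]
  have hint : ∀ t, Integrable
      (fun ω => M.P h (X k h.castSucc ω) (π k ω h (X k h.castSucc ω)) t * Z t ω) μ := fun t =>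
    hrun.integrable_of_samePast hk h.castSucc fun ω ω' hω => by
      rw [hω.state_last _ le_rfl, hω.policy _ le_rfl, hZ t ω ω' hω]
  simp only [hsum, MDP.expect]
  rw [integral_finsetSum _ fun t _ => hprod t, integral_finsetSum _ fun t _ => hint t]
  exact sum_congr rfl fun t _ => hcond t

end History

/-! ### The decomposition of the expected regret into gaps -/

section Decomposition

variable {S A Ω : Type*} [Fintype S] [Fintype A] [DecidableEq S] [DecidableEq A]
  {mΩ : MeasurableSpace Ω} {H : ℕ} {M : MDP S A H} {ι : ℝ} {N₀ K : ℕ}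
  {μ : Measure Ω} {ℱ : Filtration ℕ mΩ}
  {X : ℕ → Fin (H + 1) → Ω → S} {π : ℕ → Ω → Fin H → S → A}

lemma IsRun.integrable_ownGap [IsProbabilityMeasure μ] (hrun : IsRun M ι N₀ K μ ℱ X π) {k : ℕ}
    (hk : k < K) (h : Fin H) :
    Integrable (fun ω => ownGap M (fun j i => X j i ω) (fun j => π j ω) h k) μ :=
  hrun.integrable_of_samePast hk h.castSucc fun ω ω' hω => by
    simp only [ownGap, hω.state_last _ le_rfl, hω.policy _ le_rfl]

lemma IsRun.integrable_loss [IsProbabilityMeasure μ] (hrun : IsRun M ι N₀ K μ ℱ X π) {k : ℕ}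
    (hk : k < K) (h : Fin (H + 1)) :
    Integrable (fun ω => M.Vstar h (X k h ω) - M.V (detPolicy (π k ω)) h (X k h ω)) μ :=
  hrun.integrable_of_samePast hk h fun ω ω' hω => by
    rw [hω.state_last _ le_rfl, hω.policy _ le_rfl]

/-- The expected loss of an episode is the expected sum of the gaps of its actions. -/
lemma IsRun.integral_loss_eq [Nonempty A] [IsProbabilityMeasure μ]
    (hrun : IsRun M ι N₀ K μ ℱ X π) {k : ℕ} (hk : k < K) :
    ∫ ω, (M.Vstar 0 (X k 0 ω) - M.V (detPolicy (π k ω)) 0 (X k 0 ω)) ∂μ =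
      ∑ h : Fin H, ∫ ω, ownGap M (fun j i => X j i ω) (fun j => π j ω) h k ∂μ := by
  set L : Fin (H + 1) → ℝ := fun h =>
    ∫ ω, (M.Vstar h (X k h ω) - M.V (detPolicy (π k ω)) h (X k h ω)) ∂μ with hL
  have hstep : ∀ h : Fin H, L h.castSucc =
      ∫ ω, ownGap M (fun j i => X j i ω) (fun j => π j ω) h k ∂μ + L h.succ := by
    intro h
    have hnext := hrun.integral_next hk h
      (Z := fun t ω => M.Vstar (h + 1) t - M.V (detPolicy (π k ω)) (h + 1) t)
      (fun t ω ω' hω => by rw [hω.policy _ le_rfl])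
    have hLsucc : L h.succ = ∫ ω, (M.Vstar (h + 1) (X k h.succ ω) -
        M.V (detPolicy (π k ω)) (h + 1) (X k h.succ ω)) ∂μ := by
      simp only [hL, Fin.val_succ]
    rw [hLsucc, hnext, ← integral_add (hrun.integrable_ownGap hk h)]
    · refine integral_congr_ae (Filter.Eventually.of_forall fun ω => ?_)
      exact M.Vstar_sub_V_detPolicy (π k ω) h (X k h.castSucc ω)
    · exact hrun.integrable_of_samePast hk h.castSucc fun ω ω' hω => by
        rw [hω.state_last _ le_rfl, hω.policy _ le_rfl]
  have hlast : L (Fin.last H) = 0 := by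
    simp only [hL, Fin.val_last, M.Vstar_of_le le_rfl, M.V_of_le _ le_rfl, sub_zero,
      integral_zero]
  have htel := Fin.sum_univ_succ L
  rw [Fin.sum_univ_castSucc, hlast, add_zero, sum_congr rfl fun h _ => hstep h,
    sum_add_distrib] at htel
  have h0 : L 0 = ∫ ω, (M.Vstar 0 (X k 0 ω) - M.V (detPolicy (π k ω)) 0 (X k 0 ω)) ∂μ := by
    simp only [hL, Fin.val_zero]
  rw [← h0]
  linarith

lemma IsRun.integrable_regret [IsProbabilityMeasure μ] (hrun : IsRun M ι N₀ K μ ℱ X π) :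
    Integrable (fun ω => regret M K (fun k => X k 0 ω) (fun k => π k ω)) μ :=
  integrable_finsetSum _ fun _ hk => hrun.integrable_loss (mem_range.1 hk) 0

/-- The expected regret is the expected sum of the gaps of all actions. -/
theorem IsRun.integral_regret_eq [Nonempty A] [IsProbabilityMeasure μ]
    (hrun : IsRun M ι N₀ K μ ℱ X π) :
    ∫ ω, regret M K (fun k => X k 0 ω) (fun k => π k ω) ∂μ =
      ∫ ω, ∑ k ∈ range K, ∑ h : Fin H, ownGap M (fun j i => X j i ω) (fun j => π j ω) h k ∂μ := by
  have hint : ∀ k ∈ range K, Integrable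
      (fun ω => M.Vstar 0 (X k 0 ω) - M.V (detPolicy (π k ω)) 0 (X k 0 ω)) μ :=
    fun k hk => hrun.integrable_loss (mem_range.1 hk) 0
  simp only [regret]
  rw [integral_finsetSum _ hint,
    integral_finsetSum _ fun k hk => integrable_finsetSum _ fun h _ =>
      hrun.integrable_ownGap (mem_range.1 hk) h]
  refine sum_congr rfl fun k hk => ?_
  rw [integral_finsetSum _ fun h _ => hrun.integrable_ownGap (mem_range.1 hk) h]
  exact hrun.integral_loss_eq (mem_range.1 hk)

end Decomposition

/-! ### Predictable families -/

section Predictable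

variable {S A : Type*} [Fintype S] [Fintype A] [DecidableEq S] [DecidableEq A] {H : ℕ}

/-- Two trajectories agree in all episodes before the `n`-th. -/
def AgreeBefore (n : ℕ) (x : ℕ → Fin (H + 1) → S) (p : ℕ → Fin H → S → A)
    (x' : ℕ → Fin (H + 1) → S) (p' : ℕ → Fin H → S → A) : Prop :=
  ∀ j < n, x j = x' j ∧ p j = p' j

/-- A family of functions of the next state, one for each trajectory and each episode, that
depends only on the part of the trajectory before the episode. -/
def Predictable (g : (ℕ → Fin (H + 1) → S) → (ℕ → Fin H → S → A) → ℕ → S → ℝ) : Prop :=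
  ∀ j x p x' p', AgreeBefore j x p x' p' → g x p j = g x' p' j

variable {x x' : ℕ → Fin (H + 1) → S} {p p' : ℕ → Fin H → S → A} {n : ℕ}

lemma AgreeBefore.mono {m : ℕ} (hn : AgreeBefore n x p x' p') (hmn : m ≤ n) :
    AgreeBefore m x p x' p' := fun j hj => hn j (hj.trans_le hmn)

lemma count_congr_before {v w : ℕ → Prop} [DecidablePred v] [DecidablePred w]
    (hvw : ∀ j < n, (v j ↔ w j)) : Nat.count v n = Nat.count w n := by
  rw [Nat.count_eq_card_filter_range, Nat.count_eq_card_filter_range]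
  exact congrArg card (filter_congr fun j hj => hvw j (mem_range.1 hj))

lemma AgreeBefore.visit_iff (hn : AgreeBefore n x p x' p') (h : Fin H) (s : S) (a : A) {j : ℕ}
    (hj : j < n) : Visit x p h s a j ↔ Visit x' p' h s a j := by
  rw [Visit, Visit, (hn j hj).1, (hn j hj).2]

lemma AgreeBefore.visitCount_eq (hn : AgreeBefore n x p x' p') (h : Fin H) (s : S) (a : A) :
    visitCount x p h s a n = visitCount x' p' h s a n :=
  count_congr_before fun _ hj => hn.visit_iff h s a hj

lemma AgreeBefore.stateCount_eq (hn : AgreeBefore n x p x' p') (h : Fin H) (s : S) :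
    stateCount x h s n = stateCount x' h s n :=
  count_congr_before fun j hj => by rw [(hn j hj).1]

lemma AgreeBefore.algState_eq (hn : AgreeBefore n x p x' p') (r : Fin H → S → A → ℝ) (ι : ℝ)
    (N₀ : ℕ) : algState r ι N₀ x p n = algState r ι N₀ x' p' n := by
  induction n with
  | zero => rfl
  | succ n ih =>
    rw [algState, algState, ih (hn.mono n.le_succ), (hn n n.lt_succ_self).1,
      (hn n n.lt_succ_self).2]

lemma AgreeBefore.settledAdv_eq (hn : AgreeBefore n x p x' p') (M : MDP S A H) (ι : ℝ) (N₀ : ℕ)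
    (h : Fin H) : settledAdv M ι N₀ x p h n = settledAdv M ι N₀ x' p' h n := by
  funext t
  simp only [settledAdv, hn.stateCount_eq, hn.algState_eq M.r ι N₀]

end Predictable

/-! ### The exponential supermartingale -/

section Supermartingale

variable {S A Ω : Type*} [Fintype S] [Fintype A] [DecidableEq S] [DecidableEq A]
  {mΩ : MeasurableSpace Ω} {H : ℕ} {M : MDP S A H} {ι : ℝ} {N₀ K : ℕ}
  {μ : Measure Ω} {ℱ : Filtration ℕ mΩ}
  {X : ℕ → Fin (H + 1) → Ω → S} {π : ℕ → Ω → Fin H → S → A}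

/-- From `exp y ≤ 1 + y + y²` for `|y| ≤ 1`. -/
lemma MDP.expect_exp_le_one (M : MDP S A H) (h : Fin H) (s : S) (a : A) {f : S → ℝ} {l : ℝ}
    (hf : ∀ t, |f t| ≤ 1) (hl : |l| ≤ 1 / 2) :
    M.expect h s a (fun t => Real.exp (l * (f t - M.expect h s a f) - l ^ 2 * M.cvar h s a f))
      ≤ 1 := by
  set m := M.expect h s a f with hm
  set v := M.cvar h s a f with hv
  have hm1 : |m| ≤ 1 := abs_le.2 ⟨M.le_expect h s a fun t => (abs_le.1 (hf t)).1,
    M.expect_le h s a fun t => (abs_le.1 (hf t)).2⟩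
  have hpt : ∀ t, Real.exp (l * (f t - m) - l ^ 2 * v) ≤
      Real.exp (-(l ^ 2 * v)) * (1 + l * (f t - m) + l ^ 2 * (f t - m) ^ 2) := by
    intro t
    have h1 : |l * (f t - m)| ≤ 1 := by
      rw [abs_mul]
      have h2 : |f t - m| ≤ 2 := (abs_sub _ _).trans (by linarith [hf t])
      calc |l| * |f t - m| ≤ 1 / 2 * 2 := mul_le_mul hl h2 (abs_nonneg _) (by norm_num)
        _ = 1 := by norm_num
    have h3 := (abs_le.1 (Real.abs_exp_sub_one_sub_id_le h1)).2
    rw [sub_eq_add_neg (l * (f t - m)), Real.exp_add, mul_comm]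
    refine mul_le_mul_of_nonneg_left ?_ (Real.exp_pos _).le
    rw [mul_pow] at h3
    linarith
  refine (M.expect_mono h s a hpt).trans ?_
  rw [M.expect_mul_left, M.expect_add, M.expect_add, M.expect_mul_left, M.expect_mul_left,
    M.expect_sub, M.expect_const, M.expect_const, ← M.cvar_eq_expect_sq, ← hm, ← hv, sub_self,
    mul_zero, add_zero]
  have h4 : 1 + l ^ 2 * v ≤ Real.exp (l ^ 2 * v) := by
    rw [add_comm]; exact Real.add_one_le_exp _
  calc _ ≤ Real.exp (-(l ^ 2 * v)) * Real.exp (l ^ 2 * v) :=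
        mul_le_mul_of_nonneg_left h4 (Real.exp_pos _).le
    _ = 1 := by rw [← Real.exp_add, neg_add_cancel, Real.exp_zero]

variable (M) in
/-- The exponent of the supermartingale: the compensated sum over the visits in a window. -/
def compensatedSum (l : ℝ) (h : Fin H) (s : S) (a : A) (lo hi : ℕ) (g : ℕ → S → ℝ)
    (x : ℕ → Fin (H + 1) → S) (p : ℕ → Fin H → S → A) (n : ℕ) : ℝ :=
  ∑ j ∈ window (Visit x p h s a) n lo hi,
    (l * (g j (x j h.succ) - M.expect h s a (g j)) - l ^ 2 * M.cvar h s a (g j))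

variable {l : ℝ} {h : Fin H} {s : S} {a : A} {lo hi : ℕ}

lemma compensatedSum_succ (g : ℕ → S → ℝ) (x : ℕ → Fin (H + 1) → S) (p : ℕ → Fin H → S → A)
    (n : ℕ) : compensatedSum M l h s a lo hi g x p (n + 1) =
      compensatedSum M l h s a lo hi g x p n +
        if Visit x p h s a n ∧ lo ≤ visitCount x p h s a n ∧ visitCount x p h s a n < hi then
          l * (g n (x n h.succ) - M.expect h s a (g n)) - l ^ 2 * M.cvar h s a (g n) else 0 := by
  simp only [compensatedSum, window, sum_filter, sum_range_succ, visitCount]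
  congr!

lemma AgreeBefore.compensatedSum_eq {n : ℕ} {x x' : ℕ → Fin (H + 1) → S}
    {p p' : ℕ → Fin H → S → A} (hn : AgreeBefore n x p x' p')
    {g : (ℕ → Fin (H + 1) → S) → (ℕ → Fin H → S → A) → ℕ → S → ℝ} (hg : Predictable g) :
    compensatedSum M l h s a lo hi (g x p) x p n =
      compensatedSum M l h s a lo hi (g x' p') x' p' n := by
  induction n with
  | zero => simp [compensatedSum, window]
  | succ n ih =>
    have hn' := hn.mono n.le_succ
    rw [compensatedSum_succ, compensatedSum_succ, ih hn', hg n _ _ _ _ hn',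
      hn'.visitCount_eq h s a, (hn n n.lt_succ_self).1]
    exact congrArg _ (if_congr (and_congr_left' (hn.visit_iff h s a n.lt_succ_self)) rfl rfl)

lemma SamePast.agreeBefore {n : ℕ} {i : Fin (H + 1)} {ω ω' : Ω} (hω : SamePast X π n i ω ω') :
    AgreeBefore n (fun j i => X j i ω) (fun j => π j ω) (fun j i => X j i ω') (fun j => π j ω') :=
  fun j hj => ⟨funext fun i => hω.state j hj i, hω.policy j hj.le⟩

lemma IsRun.integrable_of_agreeBefore [IsProbabilityMeasure μ] (hrun : IsRun M ι N₀ K μ ℱ X π)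
    {n : ℕ} (hn : n ≤ K) {f : Ω → ℝ} (hf : ∀ ω ω', AgreeBefore n (fun j i => X j i ω)
      (fun j => π j ω) (fun j i => X j i ω') (fun j => π j ω') → f ω = f ω') :
    Integrable f μ := by
  rcases Nat.eq_zero_or_pos n with rfl | hpos
  · rcases isEmpty_or_nonempty Ω with hΩ | ⟨⟨ω₀⟩⟩
    · exact Integrable.of_isEmpty
    · have : f = fun _ => f ω₀ := funext fun ω => hf ω ω₀ fun j hj => absurd hj (Nat.not_lt_zero _)
      rw [this]
      exact integrable_const _
  · refine hrun.integrable_of_samePast (k := n - 1) (by omega) (Fin.last H) fun ω ω' hω => ?_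
    refine hf ω ω' fun j hj => ⟨funext fun i => ?_, hω.policy j (by omega)⟩
    rcases (show j ≤ n - 1 by omega).lt_or_eq with hj' | rfl
    · exact hω.state j hj' i
    · exact hω.state_last i (Fin.le_last i)

/-- The exponentials of the compensated sums form a supermartingale with initial value `1`. -/
lemma IsRun.integral_exp_compensatedSum_le [IsProbabilityMeasure μ]
    (hrun : IsRun M ι N₀ K μ ℱ X π)
    {g : (ℕ → Fin (H + 1) → S) → (ℕ → Fin H → S → A) → ℕ → S → ℝ} (hg : Predictable g)
    (hg1 : ∀ x p j t, |g x p j t| ≤ 1) (hl : |l| ≤ 1 / 2) {n : ℕ} (hn : n ≤ K) :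
    ∫ ω, Real.exp (compensatedSum M l h s a lo hi (g (fun j i => X j i ω) fun j => π j ω)
      (fun j i => X j i ω) (fun j => π j ω) n) ∂μ ≤ 1 := by
  induction n with
  | zero => simp [compensatedSum, window]
  | succ n ih =>
    have hnK : n < K := hn
    -- the conditional factor of episode `n`, as a function of the next state
    set Y : S → Ω → ℝ := fun t ω =>
      if Visit (fun j i => X j i ω) (fun j => π j ω) h s a n ∧
          lo ≤ visitCount (fun j i => X j i ω) (fun j => π j ω) h s a n ∧
          visitCount (fun j i => X j i ω) (fun j => π j ω) h s a n < hi then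
        l * (g (fun j i => X j i ω) (fun j => π j ω) n t -
          M.expect h s a (g (fun j i => X j i ω) (fun j => π j ω) n)) -
          l ^ 2 * M.cvar h s a (g (fun j i => X j i ω) (fun j => π j ω) n) else 0 with hY
    set Z : S → Ω → ℝ := fun t ω => Real.exp (compensatedSum M l h s a lo hi
      (g (fun j i => X j i ω) fun j => π j ω) (fun j i => X j i ω) (fun j => π j ω) n + Y t ω)
      with hZ
    have hZpast : ∀ t ω ω', SamePast X π n h.castSucc ω ω' → Z t ω = Z t ω' := by
      intro t ω ω' hω
      have hagree := hω.agreeBefore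
      have hvis : Visit (fun j i => X j i ω) (fun j => π j ω) h s a n ↔
          Visit (fun j i => X j i ω') (fun j => π j ω') h s a n := by
        rw [Visit, Visit, hω.state_last _ le_rfl, hω.policy _ le_rfl]
      simp only [hZ, hY, hagree.compensatedSum_eq hg, hg n _ _ _ _ hagree,
        hagree.visitCount_eq h s a, hvis]
    have hnext := hrun.integral_next hnK h hZpast
    have heq : ∫ ω, Real.exp (compensatedSum M l h s a lo hi
        (g (fun j i => X j i ω) fun j => π j ω) (fun j i => X j i ω) (fun j => π j ω) (n + 1)) ∂μ =
        ∫ ω, Z (X n h.succ ω) ω ∂μ := by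
      refine integral_congr_ae (Filter.Eventually.of_forall fun ω => ?_)
      simp only [hZ, hY, compensatedSum_succ]
    rw [heq, hnext]
    refine le_trans (integral_mono ?_ ?_ fun ω => ?_) (ih hnK.le)
    · exact hrun.integrable_of_samePast hnK h.castSucc fun ω ω' hω => by
        simp only [hω.state_last _ le_rfl, hω.policy _ le_rfl, fun t => hZpast t ω ω' hω]
    · exact hrun.integrable_of_agreeBefore hnK.le fun ω ω' hω => by
        rw [hω.compensatedSum_eq hg]
    · simp only [hZ, Real.exp_add]
      rw [M.expect_mul_left]
      refine mul_le_of_le_one_right (Real.exp_pos _).le ?_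
      simp only [hY]
      split_ifs with hv
      · rw [show X n h.castSucc ω = s from hv.1.1,
          show π n ω h s = a from hv.1.2]
        exact M.expect_exp_le_one h s a (hg1 _ _ n) hl
      · simp only [Real.exp_zero, M.expect_const, le_refl]

/-- The tail bound from the supermartingale and Markov's inequality. -/
lemma IsRun.measureReal_compensatedSum_ge_le [IsProbabilityMeasure μ]
    (hrun : IsRun M ι N₀ K μ ℱ X π)
    {g : (ℕ → Fin (H + 1) → S) → (ℕ → Fin H → S → A) → ℕ → S → ℝ} (hg : Predictable g)
    (hg1 : ∀ x p j t, |g x p j t| ≤ 1) (hl : |l| ≤ 1 / 2) (y : ℝ) :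
    μ.real {ω | y ≤ compensatedSum M l h s a lo hi (g (fun j i => X j i ω) fun j => π j ω)
      (fun j i => X j i ω) (fun j => π j ω) K} ≤ Real.exp (-y) := by
  have hint := hrun.integrable_of_agreeBefore (f := fun ω => Real.exp (compensatedSum M l h s a
    lo hi (g (fun j i => X j i ω) fun j => π j ω) (fun j i => X j i ω) (fun j => π j ω) K)) le_rfl
    fun ω ω' hω => by rw [hω.compensatedSum_eq hg]
  have hmarkov := mul_meas_ge_le_integral_of_nonneg
    (Filter.Eventually.of_forall fun ω => (Real.exp_pos _).le) hint (Real.exp y)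
  have h1 := hmarkov.trans (hrun.integral_exp_compensatedSum_le hg hg1 hl le_rfl)
  simp only [Real.exp_le_exp] at h1
  rw [Real.exp_neg, ← one_div, le_div_iff₀ (Real.exp_pos _), mul_comm]
  exact h1

end Supermartingale

/-! ### The probability of the concentration event -/

section UnionBound

variable {S A Ω : Type*} [Fintype S] [Fintype A] [DecidableEq S] [DecidableEq A]
  {mΩ : MeasurableSpace Ω} {H : ℕ} {M : MDP S A H} {ι : ℝ} {N₀ K : ℕ}
  {μ : Measure Ω} {ℱ : Filtration ℕ mΩ}
  {X : ℕ → Fin (H + 1) → Ω → S} {π : ℕ → Ω → Fin H → S → A}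

lemma compensatedSum_eq (l : ℝ) (h : Fin H) (s : S) (a : A) (lo hi : ℕ) (g : ℕ → S → ℝ)
    (x : ℕ → Fin (H + 1) → S) (p : ℕ → Fin H → S → A) :
    compensatedSum M l h s a lo hi g x p K =
      l * (visitSum x p K h s a lo hi g - expectSum M x p K h s a lo hi g)
        - l ^ 2 * cvarSum M x p K h s a lo hi g := by
  rw [compensatedSum, visitSum, expectSum, cvarSum, sum_sub_distrib, ← mul_sum, ← mul_sum,
    sum_sub_distrib]

/-- A failure of concentration makes one of the two exponents large. -/
lemma exists_compensatedSum_ge {y : ℝ} {h : Fin H} {s : S} {a : A} {g : ℕ → S → ℝ}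
    {x : ℕ → Fin (H + 1) → S} {p : ℕ → Fin H → S → A} (hc : ¬ Concentrates M x p K y h s a g) :
    ∃ i ∈ range (K + 1) ×ˢ range (K + 1) ×ˢ Icc 1 K ×ˢ ({1, -1} : Finset ℤ),
      y ≤ compensatedSum M ((i.2.2.2 : ℝ) / (2 * (i.2.2.1 : ℝ))) h s a i.1 i.2.1 g x p K := by
  simp only [Concentrates, not_forall, not_le] at hc
  obtain ⟨lo, hlo, hi, hhi, q, hq1, hqK, hlt⟩ := hc
  have hq : (0 : ℝ) < q := by exact_mod_cast hq1
  set D := visitSum x p K h s a lo hi g - expectSum M x p K h s a lo hi g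
  set V := cvarSum M x p K h s a lo hi g
  have key : ∀ e : ℤ, e ∈ ({1, -1} : Finset ℤ) → V / (2 * q) + 2 * q * y < e * D →
      ∃ i ∈ range (K + 1) ×ˢ range (K + 1) ×ˢ Icc 1 K ×ˢ ({1, -1} : Finset ℤ),
      y ≤ compensatedSum M ((i.2.2.2 : ℝ) / (2 * (i.2.2.1 : ℝ))) h s a i.1 i.2.1 g x p K := by
    intro e he hlt
    refine ⟨(lo, hi, q, e), ?_, ?_⟩
    · simp only [mem_product, mem_range, mem_Icc]
      exact ⟨by omega, by omega, ⟨hq1, hqK⟩, he⟩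
    · rw [compensatedSum_eq]
      have he2 : (e : ℝ) ^ 2 = 1 := by
        simp only [mem_insert, mem_singleton] at he
        rcases he with rfl | rfl <;> norm_num
      have e1 : (e : ℝ) / (2 * q) * D - (e / (2 * q)) ^ 2 * V =
          (e * D - V / (2 * q)) / (2 * q) := by
        rw [div_pow, he2]; field_simp
      change y ≤ (e : ℝ) / (2 * q) * D - (e / (2 * q)) ^ 2 * V
      rw [e1, le_div_iff₀ (by positivity)]
      linarith
  rcases abs_cases D with ⟨habs, _⟩ | ⟨habs, _⟩
  · exact key 1 (by simp) (by rw [← habs]; simpa using hlt)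
  · exact key (-1) (by simp) (by rw [habs] at hlt; simpa using hlt)

lemma IsRun.measureReal_not_concentrates_le [IsProbabilityMeasure μ]
    (hrun : IsRun M ι N₀ K μ ℱ X π)
    {g : (ℕ → Fin (H + 1) → S) → (ℕ → Fin H → S → A) → ℕ → S → ℝ} (hg : Predictable g)
    (hg1 : ∀ x p j t, |g x p j t| ≤ 1) (y : ℝ) (h : Fin H) (s : S) (a : A) :
    μ.real {ω | ¬ Concentrates M (fun j i => X j i ω) (fun j => π j ω) K y h s a
      (g (fun j i => X j i ω) fun j => π j ω)} ≤ 2 * K * (K + 1) ^ 2 * Real.exp (-y) := by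
  set I := range (K + 1) ×ˢ range (K + 1) ×ˢ Icc 1 K ×ˢ ({1, -1} : Finset ℤ) with hI
  have hsub : {ω | ¬ Concentrates M (fun j i => X j i ω) (fun j => π j ω) K y h s a
      (g (fun j i => X j i ω) fun j => π j ω)} ⊆ ⋃ i ∈ I,
      {ω | y ≤ compensatedSum M ((i.2.2.2 : ℝ) / (2 * (i.2.2.1 : ℝ))) h s a i.1 i.2.1
        (g (fun j i => X j i ω) fun j => π j ω) (fun j i => X j i ω) (fun j => π j ω) K} := by
    intro ω hω
    obtain ⟨i, hi, hle⟩ := exists_compensatedSum_ge hω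
    exact Set.mem_biUnion hi hle
  refine (measureReal_mono hsub (measure_ne_top _ _)).trans ((measureReal_biUnion_finset_le _ _).trans ?_)
  refine (sum_le_sum fun i hi => ?_).trans_eq (b := ∑ i ∈ I, Real.exp (-y)) ?_
  · refine hrun.measureReal_compensatedSum_ge_le hg hg1 ?_ y
    simp only [hI, mem_product, mem_Icc, mem_insert, mem_singleton] at hi
    obtain ⟨-, -, ⟨hq, -⟩, he⟩ := hi
    have hq' : (1 : ℝ) ≤ i.2.2.1 := by exact_mod_cast hq
    have he' : |(i.2.2.2 : ℝ)| = 1 := by rcases he with he | he <;> rw [he] <;> norm_num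
    rw [abs_div, he', abs_of_pos (by positivity)]
    exact one_div_le_one_div_of_le (by norm_num) (by linarith)
  · rw [sum_const, nsmul_eq_mul]
    simp only [hI, card_product, card_range, Nat.card_Icc, Nat.add_sub_cancel]
    rw [show #({1, -1} : Finset ℤ) = 2 from rfl]
    push_cast
    ring

lemma IsRun.measureReal_not_forall_concentrates_le [IsProbabilityMeasure μ]
    (hrun : IsRun M ι N₀ K μ ℱ X π)
    {g : Fin H → S → A → (ℕ → Fin (H + 1) → S) → (ℕ → Fin H → S → A) → ℕ → S → ℝ}
    (hg : ∀ h s a, Predictable (g h s a)) (hg1 : ∀ h s a x p j t, |g h s a x p j t| ≤ 1) (y : ℝ) :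
    μ.real {ω | ¬ ∀ h s a, Concentrates M (fun j i => X j i ω) (fun j => π j ω) K y h s a
      (g h s a (fun j i => X j i ω) fun j => π j ω)} ≤
      H * Fintype.card S * Fintype.card A * (2 * K * (K + 1) ^ 2 * Real.exp (-y)) := by
  have hsub : {ω | ¬ ∀ h s a, Concentrates M (fun j i => X j i ω) (fun j => π j ω) K y h s a
      (g h s a (fun j i => X j i ω) fun j => π j ω)} ⊆ ⋃ i : Fin H × S × A,
      {ω | ¬ Concentrates M (fun j i => X j i ω) (fun j => π j ω) K y i.1 i.2.1 i.2.2
        (g i.1 i.2.1 i.2.2 (fun j i => X j i ω) fun j => π j ω)} := by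
    intro ω hω
    simp only [Set.mem_ofPred_eq, not_forall] at hω
    obtain ⟨h, s, a, hc⟩ := hω
    exact Set.mem_iUnion.2 ⟨(h, s, a), hc⟩
  refine (measureReal_mono hsub (measure_ne_top _ _)).trans ((measureReal_iUnion_fintype_le _).trans ?_)
  refine (sum_le_sum fun i _ =>
    hrun.measureReal_not_concentrates_le (hg i.1 i.2.1 i.2.2) (hg1 i.1 i.2.1 i.2.2) y _ _ _).trans_eq
      ?_
  rw [sum_const, nsmul_eq_mul, card_univ, Fintype.card_prod, Fintype.card_prod, Fintype.card_fin]
  push_cast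
  ring

/-- The concentration event has high probability: seven families of clamped functions are
controlled by the union bound. -/
theorem IsRun.measureReal_not_concentrationEvent_le [IsProbabilityMeasure μ]
    (hrun : IsRun M ι N₀ K μ ℱ X π) (β' : ℝ) :
    μ.real {ω | ¬ ConcentrationEvent M ι N₀ (fun j i => X j i ω) (fun j => π j ω) K β'} ≤
      7 * (H * Fintype.card S * Fintype.card A * (2 * K * (K + 1) ^ 2 * Real.exp (-(ι / 4)))) := by
  let g : Fin 7 → Fin H → S → A → (ℕ → Fin (H + 1) → S) → (ℕ → Fin H → S → A) → ℕ → S → ℝ :=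
    ![fun h _ _ _ _ _ t => M.Vstar (h + 1) t / H,
      fun h s a _ _ _ t => (M.Vstar (h + 1) t - M.expect h s a (M.Vstar (h + 1))) ^ 2 / H ^ 2,
      fun h _ _ x p j t => obsRef M.r ι N₀ x p h j t / H,
      fun h _ _ x p j t => obsRef M.r ι N₀ x p h j t ^ 2 / H ^ 2,
      fun h _ _ x p j t => (obsV M.r ι N₀ x p h j t - obsRef M.r ι N₀ x p h j t) / H,
      fun h _ _ x p j t => (obsV M.r ι N₀ x p h j t - obsRef M.r ι N₀ x p h j t) ^ 2 / H ^ 2,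
      fun h _ _ x p j t => settledAdv M ι N₀ x p h j t / β']
  have hpred : ∀ i h s a, Predictable fun x p j t => clamp (g i h s a x p j t) := by
    intro i h s a j x p x' p' hj
    funext t
    fin_cases i <;>
      simp [g, obsRef, obsV, hj.algState_eq M.r ι N₀, hj.settledAdv_eq M ι N₀]
  have hsub : {ω | ¬ ConcentrationEvent M ι N₀ (fun j i => X j i ω) (fun j => π j ω) K β'} ⊆
      ⋃ i : Fin 7, {ω | ¬ ∀ h s a, Concentrates M (fun j i => X j i ω) (fun j => π j ω) K (ι / 4)
        h s a fun j t => clamp (g i h s a (fun j i => X j i ω) (fun j => π j ω) j t)} := by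
    intro ω hω
    by_contra hnot
    simp only [Set.mem_iUnion, Set.mem_ofPred_eq, not_exists, not_not] at hnot
    exact hω ⟨hnot 0, hnot 1, hnot 2, hnot 3, hnot 4, hnot 5, hnot 6⟩
  refine (measureReal_mono hsub (measure_ne_top _ _)).trans ((measureReal_iUnion_fintype_le _).trans ?_)
  refine (sum_le_sum fun i _ => hrun.measureReal_not_forall_concentrates_le (hpred i)
    (fun _ _ _ _ _ _ _ => abs_clamp_le _) (ι / 4)).trans_eq ?_
  rw [sum_const, nsmul_eq_mul, card_univ, Fintype.card_fin, Nat.cast_ofNat]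

end UnionBound

/-! ### The expected regret -/

section Main

variable {S A Ω : Type*} [Fintype S] [Fintype A] [DecidableEq S] [DecidableEq A]
  {mΩ : MeasurableSpace Ω} {H : ℕ} {M : MDP S A H} {ι : ℝ} {N₀ K : ℕ}
  {μ : Measure Ω} {ℱ : Filtration ℕ mΩ}
  {X : ℕ → Fin (H + 1) → Ω → S} {π : ℕ → Ω → Fin H → S → A}

lemma logFactor_rpow_neg {N : ℝ} (hN : 0 < N) (c : ℝ) :
    logFactor (N ^ (-c)) = Real.log 2 + c * Real.log N := by
  rw [logFactor, Real.log_div (by norm_num) (Real.rpow_pos_of_pos hN _).ne', Real.log_rpow hN]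
  ring

/-- The failure probability is so small that the failure event contributes at most `1` to the
expected regret: with `ι ≥ 44 log N` one has `exp (-ι / 4) ≤ N⁻¹¹`, while the other factors are at
most `56 N⁵`. -/
lemma failure_mul_le_one {n a H K N ι : ℝ} (hn : 1 ≤ n) (ha : 1 ≤ a) (hH : 1 ≤ H) (hK : 1 ≤ K)
    (hN : N = n * a * (K * H)) (hN2 : 2 ≤ N) (hι : 44 * Real.log N ≤ ι) :
    7 * (H * n * a * (2 * K * (K + 1) ^ 2 * Real.exp (-(ι / 4)))) * (K * (H * H)) ≤ 1 := by
  have hN0 : 0 < N := by linarith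
  have hexp : Real.exp (-(ι / 4)) ≤ 1 / N ^ 11 := by
    rw [← Real.exp_log (show 0 < 1 / N ^ 11 by positivity), Real.exp_le_exp,
      Real.log_div one_ne_zero (by positivity), Real.log_one, Real.log_pow]
    push_cast
    linarith
  have hna : 1 ≤ n * a := one_le_mul_of_one_le_of_one_le hn ha
  have hT : K * H ≤ N := by
    rw [hN]; exact le_mul_of_one_le_left (by positivity) hna
  have hHN : H ≤ N := (le_mul_of_one_le_left (by positivity) hK).trans hT
  have hKN : K + 1 ≤ 2 * N := by
    have : K ≤ N := (le_mul_of_one_le_right (by positivity) hH).trans hT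
    linarith
  have h64 : 56 ≤ N ^ 6 := by
    have := pow_le_pow_left₀ (by norm_num) hN2 6
    linarith
  calc 7 * (H * n * a * (2 * K * (K + 1) ^ 2 * Real.exp (-(ι / 4)))) * (K * (H * H))
      = 14 * (N * (K + 1) ^ 2 * (K * H) * H * Real.exp (-(ι / 4))) := by rw [hN]; ring
    _ ≤ 14 * (N * (2 * N) ^ 2 * N * N * (1 / N ^ 11)) := by gcongr
    _ = 56 / N ^ 6 := by field_simp; norm_num
    _ ≤ 1 := (div_le_one (by positivity)).2 h64

/-- The regret bound with the logarithmic factors in terms of `ι` and `K`. -/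
theorem IsRun.integral_regret_le [Nonempty S] [Nonempty A] [IsProbabilityMeasure μ]
    {β c₀ κ : ℝ} (hrun : IsRun M ι (settleCount S A H c₀ β ι) K μ ℱ X π)
    (hβ : 0 < β) (hβH : β ≤ H) (hc₀ : 0 < c₀) (hκ : 0 < κ)
    (hκc : κ ^ 2 * c₀ = 5000) (hgap : ∃ h s a, 0 < M.gap h s a) (hT : 2 ≤ (K * H : ℝ))
    (hι1 : 1 ≤ ι) (hι : 44 * Real.log (Fintype.card S * Fintype.card A * (K * H)) ≤ ι) :
    ∫ ω, regret M K (fun k => X k 0 ω) (fun k => π k ω) ∂μ ≤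
      120000 * (1 + κ ^ 2) * ((M.maxVar + β ^ 2 * H) * H ^ 3 * Fintype.card S * Fintype.card A * ι
          / M.gapMin)
        + (1639 + 360 / κ + 120 * c₀) * ((H : ℝ) ^ 8 * (Fintype.card S : ℝ) ^ 2 * Fintype.card A
          * (ι * (1 + Real.log K)) / β ^ 2) := by
  have hn : (1 : ℝ) ≤ Fintype.card S := by exact_mod_cast Fintype.card_pos
  have ha : (1 : ℝ) ≤ Fintype.card A := by exact_mod_cast Fintype.card_pos
  have hH : (1 : ℝ) ≤ H := by
    obtain ⟨h₀, -⟩ := id hgap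
    exact_mod_cast (Nat.zero_le _).trans_lt h₀.2
  have hK : (1 : ℝ) ≤ K := by
    rcases Nat.eq_zero_or_pos K with rfl | hpos
    · norm_num at hT
    · exact_mod_cast hpos
  have hmin := M.gapMin_pos hgap
  have hq := M.maxVar_nonneg
  have hℓ : (1 : ℝ) ≤ 1 + Real.log K := le_add_of_nonneg_right (Real.log_natCast_nonneg K)
  have hN2 : 2 ≤ (Fintype.card S * Fintype.card A * (K * H) : ℝ) :=
    hT.trans (le_mul_of_one_le_left (by positivity) (one_le_mul_of_one_le_of_one_le hn ha))
  set B := 120000 * (1 + κ ^ 2) * ((M.maxVar + β ^ 2 * H) * H ^ 3 * Fintype.card S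
      * Fintype.card A * ι / M.gapMin)
        + (1639 + 360 / κ + 120 * c₀) * ((H : ℝ) ^ 8 * (Fintype.card S : ℝ) ^ 2 * Fintype.card A
          * (ι * (1 + Real.log K)) / β ^ 2) with hB
  have hB1 : 1 ≤ B := by
    have h1 := remainder_le (N := 0) hn ha hH hβ hβH hι1 hℓ hκ hc₀ (by positivity)
    have h2 : 0 ≤ (H : ℝ) * (6 * H * (Fintype.card S * Fintype.card A * ((H : ℝ) ^ 2
        + 12 * H * ι * (21 * H ^ 2 + 5 * H ^ 2 / (κ * β)) * (1 + Real.log K))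
        + 20 * H * (Fintype.card S * 0 * (1 + Real.log K)))) := by positivity
    have h3 : 0 ≤ 120000 * (1 + κ ^ 2) * ((M.maxVar + β ^ 2 * H) * H ^ 3 * Fintype.card S
      * Fintype.card A * ι / M.gapMin) := by positivity
    linarith only [h1, h2, h3, hB]
  -- the set may fail to be measurable; its measurable hull has the same measure
  set bad := {ω | ¬ ConcentrationEvent M ι (settleCount S A H c₀ β ι) (fun j i => X j i ω)
    (fun j => π j ω) K (κ * β)} with hbad
  have hpoint : ∀ ω, ∑ k ∈ range K, ∑ h : Fin H,
      ownGap M (fun j i => X j i ω) (fun j => π j ω) h k ≤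
      (B - 1) + (toMeasurable μ bad).indicator (fun _ => (K * (H * H) : ℝ)) ω := by
    intro ω
    by_cases hω : ω ∈ bad
    · rw [Set.indicator_of_mem (subset_toMeasurable μ bad hω)]
      have h1 : ∑ k ∈ range K, ∑ h : Fin H,
          ownGap M (fun j i => X j i ω) (fun j => π j ω) h k ≤
          ∑ k ∈ range K, ∑ h : Fin H, (H : ℝ) :=
        sum_le_sum fun k _ => sum_le_sum fun h _ => ownGap_le h k
      simp only [sum_const, card_univ, Fintype.card_fin, card_range, nsmul_eq_mul] at h1
      linarith
    · have h1 := sum_sum_ownGap_le hι1 hβ hβH hc₀ hκ hκc hgap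
        (fun k hk h s a => hrun.greedy k hk ω h s a) (not_not.1 hω)
      have h2 : 0 ≤ (toMeasurable μ bad).indicator (fun _ => (K * (H * H) : ℝ)) ω :=
        Set.indicator_nonneg (fun _ _ => by positivity) _
      linarith
  have hmeas := measurableSet_toMeasurable μ bad
  have hind : Integrable ((toMeasurable μ bad).indicator (fun _ => (K * (H * H) : ℝ))) μ :=
    (integrable_const _).indicator hmeas
  rw [hrun.integral_regret_eq]
  refine (integral_mono (integrable_finsetSum _ fun k hk => integrable_finsetSum _ fun h _ =>
    hrun.integrable_ownGap (mem_range.1 hk) h) ((integrable_const _).add hind) hpoint).trans ?_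
  have hprob := hrun.measureReal_not_concentrationEvent_le (κ * β)
  rw [← hbad] at hprob
  have hfail := failure_mul_le_one hn ha hH hK rfl hN2 hι
  have h1 : μ.real bad * (K * (H * H)) ≤ 1 :=
    (mul_le_mul_of_nonneg_right hprob (by positivity)).trans hfail
  simp only [Pi.add_apply]
  rw [integral_add (integrable_const _) hind, integral_const, integral_indicator_const _ hmeas,
    probReal_univ, one_smul, smul_eq_mul, measureReal_def, measure_toMeasurable,
    ← measureReal_def]
  linarith

end Main

end

end UCBAdvantage

theorem theorem3p1 :
    ∃ cmin : ℝ, 0 < cmin ∧ ∀ c : ℝ, cmin ≤ c → ∀ c₀ : ℝ, 0 < c₀ → ∃ C : ℝ, 0 < C ∧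
      ∀ (S A Ω : Type*) [Fintype S] [Fintype A] [DecidableEq S] [DecidableEq A]
        [mΩ : MeasurableSpace Ω] (μ : Measure Ω) [IsProbabilityMeasure μ] (ℱ : Filtration ℕ mΩ)
        (H K : ℕ) (M : MDP S A H) (β T ι : ℝ)
        (X : ℕ → Fin (H + 1) → Ω → S) (π : ℕ → Ω → Fin H → S → A),
        (∃ h s a, 0 < M.gap h s a) →
        0 < β → β ≤ H →
        T = K * H → 2 ≤ T →
        ι = logFactor ((Fintype.card S * Fintype.card A * T) ^ (-c)) →
        IsRun M ι (settleCount S A H c₀ β ι) K μ ℱ X π →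
        Integrable (fun ω => regret M K (fun k => X k 0 ω) (fun k => π k ω)) μ ∧
        ∫ ω, regret M K (fun k => X k 0 ω) (fun k => π k ω) ∂μ ≤
          C * ((M.maxVar + β ^ 2 * H) * (H : ℝ) ^ 3 * Fintype.card S * Fintype.card A
                  * Real.log (Fintype.card S * Fintype.card A * T) / M.gapMin
                + (H : ℝ) ^ 8 * (Fintype.card S : ℝ) ^ 2 * Fintype.card A
                  * Real.log (Fintype.card S * Fintype.card A * T) * Real.log T / β ^ 2) := by
  refine ⟨44, by norm_num, fun c hc c₀ hc₀ => ?_⟩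
  set κ := √(5000 / c₀) with hκdef
  have hκ : 0 < κ := Real.sqrt_pos.2 (by positivity)
  have hκc : κ ^ 2 * c₀ = 5000 := by
    rw [hκdef, Real.sq_sqrt (by positivity)]; field_simp
  refine ⟨120000 * (1 + κ ^ 2) * (c + 1) + (1639 + 360 / κ + 120 * c₀) * (3 * (c + 1)),
    by positivity, ?_⟩
  intro S A Ω _ _ _ _ mΩ μ _ ℱ H K M β T ι X π hgap hβ hβH hT hT2 hι hrun
  refine ⟨hrun.integrable_regret, ?_⟩
  obtain ⟨h₀, s₀, a₀, -⟩ := id hgap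
  have : Nonempty S := ⟨s₀⟩
  have : Nonempty A := ⟨a₀⟩
  have hn : (1 : ℝ) ≤ Fintype.card S := by exact_mod_cast Fintype.card_pos
  have ha : (1 : ℝ) ≤ Fintype.card A := by exact_mod_cast Fintype.card_pos
  have hH : (1 : ℝ) ≤ H := by exact_mod_cast (Nat.zero_le _).trans_lt h₀.2
  have hK : (1 : ℝ) ≤ K := by
    rcases Nat.eq_zero_or_pos K with rfl | hpos
    · norm_num [hT] at hT2
    · exact_mod_cast hpos
  have hmin := M.gapMin_pos hgap
  have hq := M.maxVar_nonneg
  set N : ℝ := Fintype.card S * Fintype.card A * T with hN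
  have hTN : T ≤ N :=
    le_mul_of_one_le_left (by linarith) (one_le_mul_of_one_le_of_one_le hn ha)
  have hlog2 : (1 : ℝ) / 2 ≤ Real.log 2 := by linarith [Real.log_two_gt_d9]
  have hlogN : Real.log 2 ≤ Real.log N := Real.log_le_log (by norm_num) (hT2.trans hTN)
  have hlogT : Real.log 2 ≤ Real.log T := Real.log_le_log (by norm_num) hT2
  have hlogK : Real.log K ≤ Real.log T :=
    Real.log_le_log (by linarith) (by rw [hT]; exact le_mul_of_one_le_right (by linarith) hH)
  rw [logFactor_rpow_neg (by linarith)] at hι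
  have hcN : 44 * Real.log N ≤ c * Real.log N := mul_le_mul_of_nonneg_right hc (by linarith)
  have hιN : ι ≤ (c + 1) * Real.log N := by rw [hι]; linarith
  have hlogs : ι * (1 + Real.log K) ≤ 3 * (c + 1) * (Real.log N * Real.log T) := by
    calc ι * (1 + Real.log K) ≤ ((c + 1) * Real.log N) * (3 * Real.log T) :=
          mul_le_mul hιN (by linarith) (by linarith [Real.log_natCast_nonneg K])
            (mul_nonneg (by linarith) (by linarith))
      _ = _ := by ring
  have hmain := hrun.integral_regret_le hβ hβH hc₀ hκ hκc hgap (hT ▸ hT2) (by linarith)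
    (by rw [← hT, ← hN]; linarith)
  refine hmain.trans ?_
  set P := (M.maxVar + β ^ 2 * H) * (H : ℝ) ^ 3 * Fintype.card S * Fintype.card A with hP
  set R := (H : ℝ) ^ 8 * (Fintype.card S : ℝ) ^ 2 * Fintype.card A with hR
  have hP0 : 0 ≤ P := by positivity
  have hR0 : 0 ≤ R := by positivity
  have hlogN0 : 0 ≤ Real.log N := by linarith
  have hlogT0 : 0 ≤ Real.log T := by linarith
  have h1 : P * ι / M.gapMin ≤ (c + 1) * (P * Real.log N / M.gapMin) := by
    calc P * ι / M.gapMin ≤ P * ((c + 1) * Real.log N) / M.gapMin := by gcongr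
      _ = _ := by ring
  have h2 : R * (ι * (1 + Real.log K)) / β ^ 2 ≤
      3 * (c + 1) * (R * Real.log N * Real.log T / β ^ 2) := by
    calc R * (ι * (1 + Real.log K)) / β ^ 2 ≤
          R * (3 * (c + 1) * (Real.log N * Real.log T)) / β ^ 2 := by gcongr
      _ = _ := by ring
  set x := P * Real.log N / M.gapMin with hx
  set y := R * Real.log N * Real.log T / β ^ 2 with hy
  have hx0 : 0 ≤ x := by positivity
  have hy0 : 0 ≤ y := by positivity
  calc _ ≤ 120000 * (1 + κ ^ 2) * ((c + 1) * x) +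
        (1639 + 360 / κ + 120 * c₀) * (3 * (c + 1) * y) := by gcongr
    _ = 120000 * (1 + κ ^ 2) * (c + 1) * x +
        (1639 + 360 / κ + 120 * c₀) * (3 * (c + 1)) * y := by ring
    _ ≤ _ := by
      have e1 : 0 ≤ 120000 * (1 + κ ^ 2) * (c + 1) * y := by positivity
      have e2 : 0 ≤ (1639 + 360 / κ + 120 * c₀) * (3 * (c + 1)) * x := by positivity
      rw [add_mul, mul_add, mul_add]
      linarith only [e1, e2]
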